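/- Let $n\ge 3$ and let $\alpha=(\alpha_1,\dots,\alpha_n)\in\mathbb R_{>0}^n$ be generic, i.e. $\varepsilon_S(\alpha):=\sum_{i\in S}\alpha_i-\sum_{i\in S^c}\alpha_i\neq 0$ for every $S\subset\{1,\dots,n\}$. For row vectors $p_1,\dots,p_n\in(\mathbb C^2)^*$ and column vectors $q_1,\dots,q_n\in\mathbb C^2$, and with $(\cdot)_0$ denoting the trace-free part of a $2\times 2$ matrix, let $$\mu_{\mathbb R}(p,q)=\tfrac{\sqrt{-1}}2\sum_{i}(q_iq_i^*-p_i^*p_i)_0\oplus\bigl(\tfrac12(|q_i|^2-|p_i|^2)\bigr)_i,\qquad \mu_{\mathbb C}(p,q)=-\sum_i(q_ip_i)_0\oplus(\sqrt{-1}\,p_iq_i)_i .$$ The group $K=(SU(2)\times U(1)^n)/\{\pm1\}$ acts by $(p,q)\cdot[A;e_1,\dots,e_n]=\bigl((e_i^{-1}p_iA)_i,(A^{-1}q_ie_i)_i\bigr)$, and the hyperpolygon space is $$X(\alpha)=\bigl(\mu_{\mathbb R}^{-1}(0,\alpha)\cap\mu_{\mathbb C}^{-1}(0,0)\bigr)/K$$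 with the quotient topology and the quotient smooth structure. Let $M(\alpha)\subset X(\alpha)$ be the space of polygons, i.e. the set of classes $[0,q]$. Call $S\subset\{1,\dots,n\}$ short if $\varepsilon_S(\alpha)<0$, and let $\mathcal S'(\alpha)$ be the set of short $S$ with $|S|\ge 2$. Call $S$ straight at $(p,q)$ if $q_i$ is proportional to $q_j$ for all $i,j\in S$. For $S\in\mathcal S'(\alpha)$ put $$Z_S=\{[p,q]\in X(\alpha)\mid S\text{ and }S^c\text{ are straight at }(p,q)\},\qquad X_S=\{[p,q]\in Z_S\mid p_j=0\text{ for all }j\in S^c\}.$$ 1. The fixed-point set $X(\alpha)^{\mathbb Z/2\mathbb Z}$ of the involution $[p,q]\mapsto[-p,q]$ of $X(\alpha)$ is $$X(\alpha)^{\mathbb Z/2\mathbb Z}=M(\alpha)\cup\bigcup_{S\in\mathcal S'(\alpha)}Z_S .$$ 2. For every $S\in\mathcal S'(\alpha)$, $Z_S$, with the smooth structure induced from $X(\alpha)$, is a smooth manifold of real dimension $2(n-3)$. It is non-compact if $|S|\neq n-1$. If $|S|=n-1$, then $Z_S=X_S$, and it is compact and diffeomorphic to $\mathbb C\mathbb P^{n-3}$.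 3. In all cases, $X(\alpha)^{\mathbb Z/2\mathbb Z}$ has exactly $2^{n-1}-(n+1)$ non-compact connected components and exactly one compact connected component. -/

import Mathlib

namespace Hyperpolygon

open scoped Matrix ContDiff Manifold

/-! ### The hyperkähler quotient -/

/-- `T^*ℂ^{2n}`: pairs `(p, q)` where `p i` is a row vector and `q i` is a column vector. -/
abbrev Cotangent (n : ℕ) : Type := (Fin n → Fin 2 → ℂ) × (Fin n → Fin 2 → ℂ)

/-- The squared Euclidean (Hermitian) norm on `ℂ²`. -/
def sqNorm (v : Fin 2 → ℂ) : ℝ := ∑ k, Complex.normSq (v k)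

/-- The trace-free part `M₀ = M - (tr M / 2) I` of a `2 × 2` matrix. -/
noncomputable def traceFree (M : Matrix (Fin 2) (Fin 2) ℂ) : Matrix (Fin 2) (Fin 2) ℂ :=
  M - (M.trace / 2) • (1 : Matrix (Fin 2) (Fin 2) ℂ)

/-- The real moment map
`μ_ℝ(p,q) = (√-1/2) ∑ (q_i q_i^* - p_i^* p_i)₀ ⊕ ((|q_i|² - |p_i|²)/2)_i`. -/
noncomputable def momentReal {n : ℕ} (x : Cotangent n) :
    Matrix (Fin 2) (Fin 2) ℂ × (Fin n → ℝ) :=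
  ((Complex.I / 2) • ∑ i, traceFree
      (Matrix.vecMulVec (x.2 i) (star (x.2 i)) - Matrix.vecMulVec (star (x.1 i)) (x.1 i)),
    fun i => (sqNorm (x.2 i) - sqNorm (x.1 i)) / 2)

/-- The complex moment map `μ_ℂ(p,q) = - ∑ (q_i p_i)₀ ⊕ (√-1 p_i q_i)_i`. -/
noncomputable def momentComplex {n : ℕ} (x : Cotangent n) :
    Matrix (Fin 2) (Fin 2) ℂ × (Fin n → ℂ) :=
  (-∑ i, traceFree (Matrix.vecMulVec (x.2 i) (x.1 i)),
    fun i => Complex.I * (x.1 i ⬝ᵥ x.2 i))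

/-- The level set `μ_ℝ⁻¹(0, α) ∩ μ_ℂ⁻¹(0, 0)`. -/
def level {n : ℕ} (α : Fin n → ℝ) : Set (Cotangent n) :=
  {x | momentReal x = (0, α) ∧ momentComplex x = (0, 0)}

/-- `SU(2) × U(1)^n`. The group `K` is its quotient by the element `(-1, …, -1)`, which acts
trivially, so that the orbits of `K` are the orbits of this group. -/
abbrev KTilde (n : ℕ) : Type := Matrix.specialUnitaryGroup (Fin 2) ℂ × (Fin n → Circle)

/-- The right action
`(p,q) · [A; e_1, …, e_n] = ((e_i⁻¹ p_i A)_i, (A⁻¹ q_i e_i)_i)`. -/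
noncomputable def act {n : ℕ} (x : Cotangent n) (g : KTilde n) : Cotangent n :=
  (fun i => ((g.2 i)⁻¹ : Circle).1 • (x.1 i ᵥ* (g.1 : Matrix (Fin 2) (Fin 2) ℂ)),
    fun i => (g.2 i : ℂ) •
      (((g.1⁻¹ : Matrix.specialUnitaryGroup (Fin 2) ℂ) : Matrix (Fin 2) (Fin 2) ℂ) *ᵥ x.2 i))

theorem act_one {n : ℕ} (x : Cotangent n) : act x 1 = x := by
  ext i k <;> simp [act]

theorem act_mul {n : ℕ} (x : Cotangent n) (g h : KTilde n) :
    act (act x g) h = act x (g * h) := by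
  refine Prod.ext (funext fun i => ?_) (funext fun i => ?_)
  · simp only [act, Matrix.smul_vecMul, Matrix.vecMul_vecMul, smul_smul, Prod.fst_mul,
      Prod.snd_mul, Pi.mul_apply, Submonoid.coe_mul, mul_inv_rev]
    simp
  · simp only [act, Matrix.mulVec_smul, Matrix.mulVec_mulVec, smul_smul, Prod.fst_mul,
      Prod.snd_mul, Pi.mul_apply, Submonoid.coe_mul, mul_inv_rev, Circle.coe_mul]
    rw [mul_comm]

/-- Two points of the level set are equivalent when they lie on the same `K`-orbit. -/
def orbitSetoid {n : ℕ} (α : Fin n → ℝ) : Setoid (level α) where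
  r x y := ∃ g : KTilde n, act x.1 g = y.1
  iseqv :=
    { refl := fun x => ⟨1, act_one x.1⟩
      symm := by
        rintro x y ⟨g, hg⟩
        exact ⟨g⁻¹, by rw [← hg, act_mul, mul_inv_cancel, act_one]⟩
      trans := by
        rintro x y z ⟨g, hg⟩ ⟨h, hh⟩
        exact ⟨g * h, by rw [← hh, ← hg, act_mul]⟩ }

/-- The hyperpolygon space `X(α)`. -/
def X {n : ℕ} (α : Fin n → ℝ) : Type := Quotient (orbitSetoid α)

/-- The quotient topology on `X(α)`. -/
instance {n : ℕ} (α : Fin n → ℝ) : TopologicalSpace (X α) :=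
  inferInstanceAs (TopologicalSpace (Quotient (orbitSetoid α)))

/-- The class `[p,q]` of a point of the level set. -/
def mk {n : ℕ} (α : Fin n → ℝ) (x : level α) : X α := Quotient.mk (orbitSetoid α) x

/-! ### Short and straight sets, and the subsets of `X(α)` -/

/-- `ε_S(α) = ∑_{i ∈ S} α_i - ∑_{i ∉ S} α_i`. -/
def epsilon {n : ℕ} (α : Fin n → ℝ) (S : Finset (Fin n)) : ℝ := ∑ i ∈ S, α i - ∑ i ∈ Sᶜ, α i

/-- Genericity of `α`. -/
def IsGeneric {n : ℕ} (α : Fin n → ℝ) : Prop := ∀ S : Finset (Fin n), epsilon α S ≠ 0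

/-- Short sets. -/
def IsShort {n : ℕ} (α : Fin n → ℝ) (S : Finset (Fin n)) : Prop := epsilon α S < 0

/-- `S'(α)`, the short sets with at least two elements. -/
def shortSets' {n : ℕ} (α : Fin n → ℝ) : Set (Finset (Fin n)) := {S | IsShort α S ∧ 2 ≤ S.card}

/-- `S` is straight at `(p,q)` if `q_i` is proportional to `q_j` for all `i, j ∈ S`. -/
def IsStraight {n : ℕ} (S : Finset (Fin n)) (x : Cotangent n) : Prop :=
  ∀ i ∈ S, ∀ j ∈ S, ∃ c : ℂ, x.2 i = c • x.2 j

/-- The polygon space `M(α)`: the classes `[0,q]` in `X(α)`. -/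
def M {n : ℕ} (α : Fin n → ℝ) : Set (X α) := mk α '' {x | x.1.1 = 0}

/-- `Z_S`: the classes at which `S` and its complement are straight. -/
def Z {n : ℕ} (α : Fin n → ℝ) (S : Finset (Fin n)) : Set (X α) :=
  mk α '' {x | IsStraight S x.1 ∧ IsStraight Sᶜ x.1}

/-- `X_S`: the classes in `Z_S` with `p_j = 0` for all `j ∉ S`. -/
def XS {n : ℕ} (α : Fin n → ℝ) (S : Finset (Fin n)) : Set (X α) :=
  mk α '' {x | IsStraight S x.1 ∧ IsStraight Sᶜ x.1 ∧ ∀ j ∈ Sᶜ, x.1.1 j = 0}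

/-! ### The involution -/

theorem neg_mem_level {n : ℕ} {α : Fin n → ℝ} {x : Cotangent n} (hx : x ∈ level α) :
    ((-x.1, x.2) : Cotangent n) ∈ level α := by
  obtain ⟨h1, h2⟩ := hx
  refine ⟨?_, ?_⟩
  · rw [← h1]
    simp [momentReal, sqNorm, Matrix.vecMulVec_neg, Matrix.neg_vecMulVec]
  · have ha := congrArg Prod.fst h2
    have hb := congrArg Prod.snd h2
    have htf : ∀ N : Matrix (Fin 2) (Fin 2) ℂ, traceFree (-N) = -traceFree N := by
      intro N
      simp only [traceFree, Matrix.trace_neg, neg_div, neg_smul]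
      abel
    refine Prod.ext ?_ ?_
    · simp only [momentComplex, Pi.neg_apply, Matrix.vecMulVec_neg, htf,
        Finset.sum_neg_distrib] at ha ⊢
      rw [ha, neg_zero]
    · funext i
      have := congrFun hb i
      simp only [momentComplex, Pi.neg_apply, neg_dotProduct, mul_neg, Pi.zero_apply] at this ⊢
      rw [this, neg_zero]

/-- The involution `[p,q] ↦ [-p,q]` of `X(α)`. -/
def involution {n : ℕ} (α : Fin n → ℝ) : X α → X α :=
  Quotient.map (sa := orbitSetoid α) (sb := orbitSetoid α)
    (fun x => ⟨(-x.1.1, x.1.2), neg_mem_level x.2⟩) (by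
      rintro x y ⟨g, hg⟩
      refine ⟨g, ?_⟩
      refine Prod.ext ?_ ?_
      · simp only [← hg]
        funext i
        simp [act, Matrix.neg_vecMul]
      · simp only [← hg]
        rfl)

/-- The connected components of a subset of a topological space. -/
def components {T : Type*} [TopologicalSpace T] (F : Set T) : Set (Set T) :=
  {C | ∃ x ∈ F, C = connectedComponentIn F x}

/-! ### Smoothness on quotients

A space `N` is presented by a subset `A` of a real normed space and a map `π : A → N`. -/

/-- Let `N₁`, `N₂` be presented by `π₁ : A → N₁` and `π₂ : B → N₂`. A map `f : N₁ → N₂` is smooth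
on `s ⊆ N₁` if locally on `A` it lifts to the restriction of a smooth map between the ambient
normed spaces. When the `π`'s are smooth submersions of manifolds (such as quotient maps by free
and proper actions), this is the usual smoothness. -/
def SmoothOn {V W N₁ N₂ : Type*} [NormedAddCommGroup V] [NormedSpace ℝ V]
    [NormedAddCommGroup W] [NormedSpace ℝ W] {A : Set V} {B : Set W}
    (π₁ : A → N₁) (π₂ : B → N₂) (f : N₁ → N₂) (s : Set N₁) : Prop :=
  ∀ x : A, π₁ x ∈ s → ∃ U : Set V, IsOpen U ∧ (x : V) ∈ U ∧ ∃ F : V → W, ContDiffOn ℝ ∞ F U ∧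
    ∀ y : A, (y : V) ∈ U → π₁ y ∈ s → ∃ h : F y ∈ B, π₂ ⟨F y, h⟩ = f (π₁ y)

/-- `N₁` and `N₂` are diffeomorphic. -/
def AreDiffeomorphic {V W N₁ N₂ : Type*} [NormedAddCommGroup V] [NormedSpace ℝ V]
    [NormedAddCommGroup W] [NormedSpace ℝ W] {A : Set V} {B : Set W}
    (π₁ : A → N₁) (π₂ : B → N₂) : Prop :=
  ∃ f : N₁ ≃ N₂, SmoothOn π₁ π₂ f Set.univ ∧ SmoothOn π₂ π₁ f.symm Set.univ

/-- A normed space presented by itself. -/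
def selfProj (V : Type*) : ↥(Set.univ : Set V) → V := Subtype.val

/-- The points of the level set lying over `Y ⊆ X(α)`. -/
def overSet {n : ℕ} {α : Fin n → ℝ} (Y : Set (X α)) : Set (Cotangent n) :=
  {x | ∃ h : x ∈ level α, mk α ⟨x, h⟩ ∈ Y}

/-- A subset `Y` of `X(α)` is presented by the points of the level set lying over it. -/
def overProj {n : ℕ} {α : Fin n → ℝ} (Y : Set (X α)) (x : overSet Y) : Y :=
  ⟨mk α ⟨x.1, x.2.1⟩, x.2.2⟩

/-- `Y ⊆ X(α)`, with the subspace topology and the smooth structure induced from the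
quotient `X(α)`, is a smooth manifold of real dimension `d`: it is Hausdorff and second countable,
and it has an atlas of charts to `ℝ^d` that are diffeomorphisms onto their images. -/
def IsSmoothManifold {n : ℕ} {α : Fin n → ℝ} (Y : Set (X α)) (d : ℕ) : Prop :=
  T2Space Y ∧ SecondCountableTopology Y ∧
    ∃ cs : ChartedSpace (EuclideanSpace ℝ (Fin d)) Y,
      IsManifold (𝓡 d) ∞ Y ∧
      ∀ e ∈ cs.atlas,
        SmoothOn (overProj Y) (selfProj (EuclideanSpace ℝ (Fin d))) e e.source ∧
        SmoothOn (selfProj (EuclideanSpace ℝ (Fin d))) (overProj Y) e.symm e.target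

/-- Complex projective space `ℂP^m`. -/
abbrev CP (m : ℕ) : Type := Projectivization ℂ (Fin (m + 1) → ℂ)

/-- The presentation of `ℂP^m` as the quotient of `ℂ^{m+1} \ {0}`. -/
noncomputable def cpProj (m : ℕ) (v : {v : Fin (m + 1) → ℂ | v ≠ 0}) : CP m := Projectivization.mk ℂ v.1 v.2

end Hyperpolygon

namespace Hyperpolygon

open scoped Matrix ContDiff Manifold ComplexConjugate Topology

/-! ### The level set in coordinates -/

/-! The proof rests on an explicit model of the strata. If `S` and its complement are straight at
`(p,q)`, the real moment map equation forces the two lines spanned by the `q_i` to be orthogonal, so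
`K` moves them to the coordinate axes and makes each `q_i` a positive multiple of a basis vector
(`exists_act_eq_normalForm`). Since `p_i q_i = 0`, the matrix `q_i p_i` then has a single possibly
nonzero entry `X_i`. With `|q_i|² - |p_i|² = 2α_i`, this number determines `p_i` and `q_i`, and
`|q_i|² + |p_i|² = 2√(α_i² + |X_i|²)`. What remains of the moment map equations is that `X` sums to
zero over `S` and over `Sᶜ`, and that the energies `√(α_i² + |X_i|²)` have the same sum over both. A
residual circle acts on `X` with weight `1` on `S` and `-1` on `Sᶜ`.

Fixed points: if `[A; e]` carries `(p,q)` to `(-p,q)`, every `q_i` is an eigenvector of `A`. When `p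
≠ 0`, the `q_i` span exactly two lines, which gives `S` (`isStraight_of_act_eq_neg`). Conversely, on
a stratum the residual circle element `-1` reverses the sign of `p`.

Strata: for short `S` the restriction of `X` to `S` cannot vanish, and along each orbit of positive
rescalings the energy equation has exactly one solution, by monotonicity; it depends smoothly on `X`
by the implicit function theorem (`contDiffAt_logScale`). Hence `Z_S` is the quotient by `ℂ^*` of
the vectors that satisfy the two linear conditions and do not vanish on `S`. This is a vector bundle
of rank `|Sᶜ| - 1` over a projective space of dimension `|S| - 2`: connected, of complex dimension
`n - 3`, and compact exactly when `|Sᶜ| = 1`, in which case it is `ℂP^{n-3}`. Traces of products of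
the matrices `q_i p_i` and their adjoints are smooth invariants that give back `X` up to scaling,
hence the charts.

Components: `M(α)` is compact, and it is connected by an induction that removes one spinor at a time
(`isPreconnected_spinorPolygons`). The strata are closed and disjoint from each other and from
`M(α)`, so the components are the `Z_S` together with `M(α)` when it is nonempty. `M(α)` is nonempty
exactly when every singleton is short. Otherwise one singleton `{m}` is long, and the stratum of its
complement is the single compact component. Half of all subsets are short; discarding the empty set
and, for each `i`, the short one of `{i}` and `{i}ᶜ` leaves `2^{n-1} - (n+1)` non-compact strata. -/

theorem sqNorm_eq (v : Fin 2 → ℂ) : sqNorm v = Complex.normSq (v 0) + Complex.normSq (v 1) := by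
  simp [sqNorm, Fin.sum_univ_two]

theorem traceFree_apply (A : Matrix (Fin 2) (Fin 2) ℂ) :
    traceFree A = !![(A 0 0 - A 1 1) / 2, A 0 1; A 1 0, (A 1 1 - A 0 0) / 2] := by
  ext i j
  fin_cases i <;> fin_cases j <;> simp [traceFree, Matrix.trace, Fin.sum_univ_two] <;> ring

/-- A trace-free Hermitian matrix of size two is zero once one off-diagonal entry and the difference
of its diagonal entries are. All later computations use these scalar equations. -/
theorem mem_level_iff {n : ℕ} {α : Fin n → ℝ} {x : Cotangent n} : x ∈ level α ↔
    (∀ i, sqNorm (x.2 i) - sqNorm (x.1 i) = 2 * α i) ∧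
    (∀ i, x.1 i 0 * x.2 i 0 + x.1 i 1 * x.2 i 1 = 0) ∧
    ∑ i, (x.2 i 0 * conj (x.2 i 1) - conj (x.1 i 0) * x.1 i 1) = 0 ∧
    ∑ i, (Complex.normSq (x.2 i 0) - Complex.normSq (x.2 i 1) - Complex.normSq (x.1 i 0)
      + Complex.normSq (x.1 i 1)) = 0 ∧
    ∑ i, x.2 i 0 * x.1 i 1 = 0 ∧ ∑ i, x.2 i 1 * x.1 i 0 = 0 ∧ ∑ i, x.2 i 0 * x.1 i 0 = 0 := by
  have e1 : momentReal x = (0, α) ↔ (∀ i, sqNorm (x.2 i) - sqNorm (x.1 i) = 2 * α i) ∧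
      ∑ i, (x.2 i 0 * conj (x.2 i 1) - conj (x.1 i 0) * x.1 i 1) = 0 ∧
      ∑ i, (Complex.normSq (x.2 i 0) - Complex.normSq (x.2 i 1) - Complex.normSq (x.1 i 0)
        + Complex.normSq (x.1 i 1)) = 0 := by
    rw [momentReal, Prod.mk.injEq, smul_eq_zero_iff_right (by simp), and_comm]
    refine and_congr ?_ ?_
    · rw [funext_iff]
      refine forall_congr' fun i => ?_
      constructor <;> intro h <;> linarith
    · simp only [traceFree_apply, Matrix.sub_apply, Matrix.vecMulVec_apply, Pi.star_apply,
        RCLike.star_def]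
      have hre : ∀ s : Finset (Fin n), (((∑ i ∈ s, (Complex.normSq (x.2 i 0)
          - Complex.normSq (x.2 i 1) - Complex.normSq (x.1 i 0)
          + Complex.normSq (x.1 i 1)) : ℝ)) : ℂ) = 2 * ∑ i ∈ s,
          (x.2 i 0 * conj (x.2 i 0) - conj (x.1 i 0) * x.1 i 0 -
            (x.2 i 1 * conj (x.2 i 1) - conj (x.1 i 1) * x.1 i 1)) / 2 := by
        intro s
        push_cast
        rw [Finset.mul_sum]
        refine Finset.sum_congr rfl fun i _ => ?_
        simp only [Complex.normSq_eq_conj_mul_self]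
        ring
      constructor
      · intro h
        have h00 := congrFun (congrFun h 0) 0
        have h01 := congrFun (congrFun h 0) 1
        simp only [Matrix.sum_apply, Matrix.of_apply, Matrix.cons_val', Matrix.cons_val_zero,
          Matrix.cons_val_one, Matrix.zero_apply, Matrix.cons_val_fin_one] at h00 h01
        refine ⟨h01, ?_⟩
        have := hre Finset.univ
        rw [h00, mul_zero] at this
        exact_mod_cast this
      · rintro ⟨h01, h00⟩
        have h2 := hre Finset.univ
        rw [h00] at h2
        have h00' : ∑ i, (x.2 i 0 * conj (x.2 i 0) - conj (x.1 i 0) * x.1 i 0 -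
            (x.2 i 1 * conj (x.2 i 1) - conj (x.1 i 1) * x.1 i 1)) / 2 = 0 := by
          have := h2.symm
          simpa using this
        ext i j
        fin_cases i <;> fin_cases j <;> simp only [Fin.zero_eta, Fin.mk_one, Matrix.sum_apply,
          Matrix.of_apply, Matrix.cons_val', Matrix.cons_val_zero, Matrix.cons_val_one,
          Matrix.zero_apply, Matrix.cons_val_fin_one]
        · exact h00'
        · exact h01
        · have := congrArg conj h01
          rw [map_sum, map_zero] at this
          rw [← this]
          refine Finset.sum_congr rfl fun i _ => ?_
          simp only [map_sub, map_mul, Complex.conj_conj]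
          ring
        · rw [← neg_eq_zero, ← Finset.sum_neg_distrib, ← h00']
          refine Finset.sum_congr rfl fun i _ => ?_
          ring
  have e2 : momentComplex x = (0, 0) ↔ (∀ i, x.1 i 0 * x.2 i 0 + x.1 i 1 * x.2 i 1 = 0) ∧
      ∑ i, x.2 i 0 * x.1 i 1 = 0 ∧ ∑ i, x.2 i 1 * x.1 i 0 = 0 ∧
      ∑ i, x.2 i 0 * x.1 i 0 = 0 := by
    rw [momentComplex, Prod.mk.injEq, neg_eq_zero, and_comm]
    have hA : (fun i => Complex.I * (x.1 i ⬝ᵥ x.2 i)) = 0 ↔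
        ∀ i, x.1 i 0 * x.2 i 0 + x.1 i 1 * x.2 i 1 = 0 := by
      rw [funext_iff]
      refine forall_congr' fun i => ?_
      simp [dotProduct, Fin.sum_univ_two]
    rw [hA]
    refine and_congr_right fun h => ?_
    -- The vanishing of `p_i q_i` makes `q_i p_i` trace-free already, so one diagonal entry
    -- suffices.
    have h11 : ∀ i, x.2 i 1 * x.1 i 1 = - (x.2 i 0 * x.1 i 0) := fun i => by
      linear_combination h i
    simp only [traceFree_apply, Matrix.vecMulVec_apply, h11, sub_neg_eq_add, add_self_div_two]
    constructor
    · intro h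
      have h00 := congrFun (congrFun h 0) 0
      have h01 := congrFun (congrFun h 0) 1
      have h10 := congrFun (congrFun h 1) 0
      simp only [Matrix.sum_apply, Matrix.of_apply, Matrix.cons_val', Matrix.cons_val_zero,
        Matrix.cons_val_one, Matrix.zero_apply, Matrix.cons_val_fin_one] at h00 h01 h10
      exact ⟨h01, h10, h00⟩
    · rintro ⟨h01, h10, h00⟩
      ext i j
      fin_cases i <;> fin_cases j <;> simp only [Fin.zero_eta, Fin.mk_one, Matrix.sum_apply,
        Matrix.of_apply, Matrix.cons_val', Matrix.cons_val_zero, Matrix.cons_val_one,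
        Matrix.zero_apply, Matrix.cons_val_fin_one]
      · exact h00
      · exact h01
      · exact h10
      · rw [← neg_eq_zero, ← Finset.sum_neg_distrib, ← h00]
        refine Finset.sum_congr rfl fun i _ => ?_
        ring
  rw [level, Set.mem_ofPred_eq, e1, e2]
  tauto

/-! ### Normal forms -/

/-- `√(a² + |z|²)`. -/
noncomputable def energy (a : ℝ) (z : ℂ) : ℝ := √(a ^ 2 + Complex.normSq z)

/-- The positive `r` with `r² - |z / r|² = 2a`. -/
noncomputable def radius (a : ℝ) (z : ℂ) : ℝ := √(a + energy a z)

theorem energy_pos {a : ℝ} (ha : 0 < a) (z : ℂ) : 0 < energy a z :=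
  Real.sqrt_pos.2 (by have := Complex.normSq_nonneg z; positivity)

theorem energy_sq (a : ℝ) (z : ℂ) : energy a z ^ 2 = a ^ 2 + Complex.normSq z :=
  Real.sq_sqrt (by have := Complex.normSq_nonneg z; positivity)

theorem le_energy (a : ℝ) (z : ℂ) : a ≤ energy a z :=
  Real.le_sqrt_of_sq_le (by have := Complex.normSq_nonneg z; linarith)

theorem energy_zero {a : ℝ} (ha : 0 < a) : energy a 0 = a := by
  simp [energy, Real.sqrt_sq ha.le]

theorem radius_pos {a : ℝ} (ha : 0 < a) (z : ℂ) : 0 < radius a z :=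
  Real.sqrt_pos.2 (add_pos ha (energy_pos ha z))

theorem radius_ne_zero {a : ℝ} (ha : 0 < a) (z : ℂ) : (radius a z : ℂ) ≠ 0 :=
  Complex.ofReal_ne_zero.2 (radius_pos ha z).ne'

theorem radius_sq {a : ℝ} (ha : 0 < a) (z : ℂ) : radius a z ^ 2 = a + energy a z :=
  Real.sq_sqrt (add_pos ha (energy_pos ha z)).le

/-- With `E` the energy, `|z|² = E² - a² = (E - a)(E + a)`, and the squared radius is `E + a`. -/
theorem normSq_div_radius {a : ℝ} (ha : 0 < a) (z : ℂ) :
    Complex.normSq (z / radius a z) = energy a z - a := by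
  have h1 := radius_sq ha z
  have h2 := energy_sq a z
  have h3 := energy_pos ha z
  rw [Complex.normSq_div, Complex.normSq_ofReal, ← sq, h1, div_eq_iff (by positivity)]
  linarith [h2, sq (energy a z)]

/-- Here `r` and `c` play the roles of `|q_i|` and the entry of `p_i`: their product alone gives
back `r`, so the parameter `X_i` determines the pair. -/
theorem radius_mul {a r : ℝ} (ha : 0 < a) (hr : 0 < r) {c : ℂ}
    (h : r ^ 2 - Complex.normSq c = 2 * a) : radius a (r * c) = r := by
  have hc := Complex.normSq_nonneg c
  have : energy a (r * c) = r ^ 2 - a := by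
    rw [energy, Complex.normSq_mul, Complex.normSq_ofReal, Real.sqrt_eq_iff_mul_self_eq_of_pos]
    · have : Complex.normSq c = r ^ 2 - 2 * a := by linarith
      rw [this]; ring
    · nlinarith
  rw [radius, this, Real.sqrt_eq_iff_mul_self_eq_of_pos hr]
  ring

theorem energy_congr (a : ℝ) {z w : ℂ} (h : ‖z‖ = ‖w‖) : energy a z = energy a w := by
  simp [energy, Complex.normSq_eq_norm_sq, h]

theorem radius_congr (a : ℝ) {z w : ℂ} (h : ‖z‖ = ‖w‖) : radius a z = radius a w := by
  rw [radius, radius, energy_congr a h]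

/-- The standard point with `q_i p_i` equal to `X_i` times an elementary nilpotent matrix. -/
noncomputable def normalForm {n : ℕ} (S : Finset (Fin n)) (α : Fin n → ℝ) (X : Fin n → ℂ) :
    Cotangent n :=
  (fun i => if i ∈ S then ![0, X i / radius (α i) (X i)] else ![X i / radius (α i) (X i), 0],
    fun i => if i ∈ S then ![(radius (α i) (X i) : ℂ), 0] else ![0, (radius (α i) (X i) : ℂ)])

/-- The vectors `X` whose normal form lies in the level set. -/
structure Admissible {n : ℕ} (S : Finset (Fin n)) (α : Fin n → ℝ) (X : Fin n → ℂ) : Prop where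
  sum_eq_zero : ∑ i ∈ S, X i = 0
  sum_compl_eq_zero : ∑ i ∈ Sᶜ, X i = 0
  sum_energy : ∑ i ∈ S, energy (α i) (X i) = ∑ i ∈ Sᶜ, energy (α i) (X i)

theorem sum_ite_compl {n : ℕ} {E : Type*} [AddCommMonoid E] (S : Finset (Fin n)) (f g : Fin n → E) :
    ∑ i, (if i ∈ S then f i else g i) = ∑ i ∈ S, f i + ∑ i ∈ Sᶜ, g i := by
  rw [← Finset.sum_add_sum_compl S]
  congr 1
  · exact Finset.sum_congr rfl fun i hi => if_pos hi
  · exact Finset.sum_congr rfl fun i hi => if_neg (Finset.mem_compl.1 hi)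

/-- On the axes the length and orthogonality conditions hold automatically. The diagonal part of the
real moment map becomes the signed sum of `|q_i|² + |p_i|²`, twice the energies, and the complex one
becomes the two linear conditions. -/
theorem normalForm_mem_level_iff {n : ℕ} {S : Finset (Fin n)} {α : Fin n → ℝ} (hα : ∀ i, 0 < α i)
    {X : Fin n → ℂ} : normalForm S α X ∈ level α ↔ Admissible S α X := by
  have hr : ∀ i, (radius (α i) (X i) : ℂ) * (X i / radius (α i) (X i)) = X i := fun i => by
    have := radius_ne_zero (hα i) (X i)
    field_simp
  have hr2 : ∀ i, Complex.normSq (radius (α i) (X i) : ℂ) = α i + energy (α i) (X i) := fun i => by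
    rw [Complex.normSq_ofReal, ← sq, radius_sq (hα i)]
  rw [mem_level_iff]
  have h1 : ∀ i, sqNorm ((normalForm S α X).2 i) - sqNorm ((normalForm S α X).1 i) = 2 * α i := by
    intro i
    by_cases hi : i ∈ S <;>
    · simp only [normalForm, hi, if_true, if_false, sqNorm_eq, Matrix.cons_val_zero,
        Matrix.cons_val_one, hr2, normSq_div_radius (hα i), map_zero]
      ring
  have h2 : ∀ i, (normalForm S α X).1 i 0 * (normalForm S α X).2 i 0 +
      (normalForm S α X).1 i 1 * (normalForm S α X).2 i 1 = 0 := by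
    intro i
    by_cases hi : i ∈ S <;> simp [normalForm, hi]
  have h3 : ∀ i, (normalForm S α X).2 i 0 * conj ((normalForm S α X).2 i 1) -
      conj ((normalForm S α X).1 i 0) * (normalForm S α X).1 i 1 = 0 := by
    intro i
    by_cases hi : i ∈ S <;> simp [normalForm, hi]
  have h4 : ∀ i, Complex.normSq ((normalForm S α X).2 i 0) -
      Complex.normSq ((normalForm S α X).2 i 1) - Complex.normSq ((normalForm S α X).1 i 0) +
      Complex.normSq ((normalForm S α X).1 i 1) =
      if i ∈ S then 2 * energy (α i) (X i) else -(2 * energy (α i) (X i)) := by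
    intro i
    by_cases hi : i ∈ S <;>
    · simp only [normalForm, hi, if_true, if_false, Matrix.cons_val_zero,
        Matrix.cons_val_one, hr2, normSq_div_radius (hα i), map_zero]
      ring
  have h5 : ∀ i, (normalForm S α X).2 i 0 * (normalForm S α X).1 i 1 =
      if i ∈ S then X i else 0 := by
    intro i
    by_cases hi : i ∈ S <;> simp [normalForm, hi, hr]
  have h6 : ∀ i, (normalForm S α X).2 i 1 * (normalForm S α X).1 i 0 =
      if i ∈ S then 0 else X i := by
    intro i
    by_cases hi : i ∈ S <;> simp [normalForm, hi, hr]
  have h7 : ∀ i, (normalForm S α X).2 i 0 * (normalForm S α X).1 i 0 = 0 := by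
    intro i
    by_cases hi : i ∈ S <;> simp [normalForm, hi]
  simp only [h1, h2, h3, h4, h5, h6, h7, sum_ite_compl, Finset.sum_const_zero, add_zero, zero_add,
    Finset.sum_neg_distrib, ← Finset.mul_sum, implies_true, true_and, and_true]
  constructor
  · rintro ⟨ha, hb, hc⟩
    exact ⟨hb, hc, by linarith⟩
  · rintro ⟨hb, hc, ha⟩
    exact ⟨by linarith, hb, hc⟩

/-- The action of the nonzero scalars on the parameters of normal forms. -/
noncomputable def scale {n : ℕ} (S : Finset (Fin n)) (t : ℂ) (X : Fin n → ℂ) : Fin n → ℂ :=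
  fun i => if i ∈ S then t * X i else t⁻¹ * X i

theorem scale_scale {n : ℕ} (S : Finset (Fin n)) (s t : ℂ) (X : Fin n → ℂ) :
    scale S s (scale S t X) = scale S (s * t) X := by
  funext i
  by_cases hi : i ∈ S <;> simp [scale, hi] <;> ring

theorem scale_one {n : ℕ} (S : Finset (Fin n)) (X : Fin n → ℂ) : scale S 1 X = X := by
  funext i
  by_cases hi : i ∈ S <;> simp [scale, hi]

/-- The diagonal matrix with entries `s, s⁻¹`. -/
noncomputable def diagSU (s : Circle) : Matrix.specialUnitaryGroup (Fin 2) ℂ :=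
  ⟨!![(s : ℂ), 0; 0, conj (s : ℂ)], by
    have h : (s : ℂ) * conj (s : ℂ) = 1 := by
      rw [Complex.mul_conj, Circle.normSq_coe, Complex.ofReal_one]
    have h' : conj (s : ℂ) * (s : ℂ) = 1 := by rw [mul_comm, h]
    rw [Matrix.mem_specialUnitaryGroup_iff, Matrix.mem_unitaryGroup_iff, Matrix.det_fin_two_of]
    refine ⟨?_, by simpa using h⟩
    ext i j
    fin_cases i <;> fin_cases j <;> simp [Matrix.mul_apply, Fin.sum_univ_two, Matrix.star_apply,
      h, h']⟩

theorem coe_inv_specialUnitary (A : Matrix.specialUnitaryGroup (Fin 2) ℂ) :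
    ((A⁻¹ : Matrix.specialUnitaryGroup (Fin 2) ℂ) : Matrix (Fin 2) (Fin 2) ℂ) =
      star (A : Matrix (Fin 2) (Fin 2) ℂ) := rfl

/-- Conjugation by a diagonal matrix with entries `s, s⁻¹` multiplies the two off-diagonal entries
by opposite powers `s^{±2}`, so a square root of `t` is needed. The phases in `U(1)^n` keep the
`q_i` real and positive. -/
theorem exists_act_normalForm_scale {n : ℕ} (S : Finset (Fin n)) (α : Fin n → ℝ) (X : Fin n → ℂ)
    (t : Circle) : ∃ g : KTilde n, act (normalForm S α X) g = normalForm S α (scale S t X) := by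
  obtain ⟨s, hs⟩ : ∃ s : Circle, s * s = t := by
    refine ⟨Circle.exp (Complex.arg t / 2), ?_⟩
    rw [← Circle.exp_add, add_halves, Circle.exp_arg]
  have h : (s : ℂ) * conj (s : ℂ) = 1 := by
    rw [Complex.mul_conj, Circle.normSq_coe, Complex.ofReal_one]
  have ht : (t : ℂ) = s * s := by rw [← hs]; rfl
  have hinv : (s : ℂ)⁻¹ = conj (s : ℂ) := by rw [← Circle.coe_inv, Circle.coe_inv_eq_conj]
  have hinv' : (conj (s : ℂ))⁻¹ = s := by rw [← hinv, inv_inv]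
  refine ⟨(diagSU s⁻¹, fun i => if i ∈ S then s⁻¹ else s), ?_⟩
  have hrad : ∀ i, radius (α i) (scale S t X i) = radius (α i) (X i) := by
    intro i
    refine radius_congr _ ?_
    by_cases hi : i ∈ S <;> simp [scale, hi, Circle.norm_coe]
  refine Prod.ext ?_ ?_
  · funext i k
    by_cases hi : i ∈ S <;> fin_cases k <;>
      simp [act, normalForm, hrad, hi, diagSU]
    all_goals simp only [scale, hi, if_true, if_false, ht, mul_inv, hinv, hinv']; ring
  · funext i k
    by_cases hi : i ∈ S <;> fin_cases k <;>
      simp [act, normalForm, hrad, hi, diagSU,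
        coe_inv_specialUnitary, Matrix.star_apply, ← Circle.coe_inv_eq_conj]

/-! ### Invariance under the group -/

theorem star_mul_self_specialUnitary (A : Matrix.specialUnitaryGroup (Fin 2) ℂ) :
    star (A : Matrix (Fin 2) (Fin 2) ℂ) * (A : Matrix (Fin 2) (Fin 2) ℂ) = 1 :=
  Matrix.mem_unitaryGroup_iff'.1 (Matrix.mem_specialUnitaryGroup_iff.1 A.2).1

theorem mul_star_self_specialUnitary (A : Matrix.specialUnitaryGroup (Fin 2) ℂ) :
    (A : Matrix (Fin 2) (Fin 2) ℂ) * star (A : Matrix (Fin 2) (Fin 2) ℂ) = 1 :=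
  Matrix.mem_unitaryGroup_iff.1 (Matrix.mem_specialUnitaryGroup_iff.1 A.2).1

theorem traceFree_conj (A : Matrix.specialUnitaryGroup (Fin 2) ℂ) (N : Matrix (Fin 2) (Fin 2) ℂ) :
    traceFree (star (A : Matrix (Fin 2) (Fin 2) ℂ) * N * A) =
      star (A : Matrix (Fin 2) (Fin 2) ℂ) * traceFree N * A := by
  have h : (star (A : Matrix (Fin 2) (Fin 2) ℂ) * N * A).trace = N.trace := by
    rw [Matrix.trace_mul_comm, ← mul_assoc, mul_star_self_specialUnitary, one_mul]
  rw [traceFree, traceFree, h, mul_sub, sub_mul, mul_smul_comm, mul_one, smul_mul_assoc,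
    star_mul_self_specialUnitary]

theorem sum_traceFree_conj {n : ℕ} (A : Matrix.specialUnitaryGroup (Fin 2) ℂ)
    (N : Fin n → Matrix (Fin 2) (Fin 2) ℂ) :
    ∑ i, traceFree (star (A : Matrix (Fin 2) (Fin 2) ℂ) * N i * A) =
      star (A : Matrix (Fin 2) (Fin 2) ℂ) * (∑ i, traceFree (N i)) * A := by
  simp only [traceFree_conj, Finset.mul_sum, Finset.sum_mul]

theorem circle_mul_star (e : Circle) : (e : ℂ) * star (e : ℂ) = 1 := by
  rw [RCLike.star_def, Complex.mul_conj, Circle.normSq_coe, Complex.ofReal_one]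

theorem vecMulVec_act {n : ℕ} (x : Cotangent n) (g : KTilde n) (i : Fin n) :
    Matrix.vecMulVec ((act x g).2 i) ((act x g).1 i) =
      star (g.1 : Matrix (Fin 2) (Fin 2) ℂ) * Matrix.vecMulVec (x.2 i) (x.1 i) * g.1 := by
  simp only [act, Matrix.vecMulVec_smul, Matrix.smul_vecMulVec, smul_smul, Circle.coe_inv,
    ne_eq, Circle.coe_ne_zero, not_false_eq_true, inv_mul_cancel₀, one_smul,
    coe_inv_specialUnitary, Matrix.mul_vecMulVec, Matrix.vecMulVec_mul]

theorem vecMulVec_star_act {n : ℕ} (x : Cotangent n) (g : KTilde n) (i : Fin n) :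
    Matrix.vecMulVec ((act x g).2 i) (star ((act x g).2 i)) -
        Matrix.vecMulVec (star ((act x g).1 i)) ((act x g).1 i) =
      star (g.1 : Matrix (Fin 2) (Fin 2) ℂ) * (Matrix.vecMulVec (x.2 i) (star (x.2 i)) -
        Matrix.vecMulVec (star (x.1 i)) (x.1 i)) * g.1 := by
  have h1 : (g.2 i : ℂ) * star (g.2 i : ℂ) = 1 := circle_mul_star _
  have h2 : star (((g.2 i)⁻¹ : Circle) : ℂ) * (((g.2 i)⁻¹ : Circle) : ℂ) = 1 := by
    rw [mul_comm]; exact circle_mul_star _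
  rw [mul_sub, sub_mul]
  congr 1
  · simp only [act, star_smul, Matrix.vecMulVec_smul, Matrix.smul_vecMulVec, smul_smul,
      coe_inv_specialUnitary, Matrix.star_mulVec, Matrix.mul_vecMulVec, Matrix.vecMulVec_mul,
      ← Matrix.star_eq_conjTranspose, star_star, h1, mul_comm (star _), one_smul]
  · simp only [act, star_smul, Matrix.vecMulVec_smul, Matrix.smul_vecMulVec, smul_smul,
      Matrix.star_vecMul, Matrix.mul_vecMulVec, Matrix.vecMulVec_mul,
      ← Matrix.star_eq_conjTranspose, h2, mul_comm (((g.2 i)⁻¹ : Circle) : ℂ), one_smul]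

theorem sqNorm_eq_trace (v : Fin 2 → ℂ) : (sqNorm v : ℂ) = v ⬝ᵥ star v := by
  simp [sqNorm, dotProduct, Complex.mul_conj]

theorem sqNorm_act_snd {n : ℕ} (x : Cotangent n) (g : KTilde n) (i : Fin n) :
    sqNorm ((act x g).2 i) = sqNorm (x.2 i) := by
  have h1 : star (g.2 i : ℂ) * (g.2 i : ℂ) = 1 := (mul_comm _ _).trans (circle_mul_star _)
  apply Complex.ofReal_injective
  rw [sqNorm_eq_trace, sqNorm_eq_trace]
  simp only [act, star_smul, smul_dotProduct, dotProduct_smul, smul_smul, h1,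
    coe_inv_specialUnitary, Matrix.star_mulVec, ← Matrix.star_eq_conjTranspose, star_star, one_smul]
  rw [dotProduct_comm, ← Matrix.dotProduct_mulVec, Matrix.mulVec_mulVec,
    mul_star_self_specialUnitary, Matrix.one_mulVec, dotProduct_comm]

theorem sqNorm_act_fst {n : ℕ} (x : Cotangent n) (g : KTilde n) (i : Fin n) :
    sqNorm ((act x g).1 i) = sqNorm (x.1 i) := by
  have h2 : star (((g.2 i)⁻¹ : Circle) : ℂ) * (((g.2 i)⁻¹ : Circle) : ℂ) = 1 :=
    (mul_comm _ _).trans (circle_mul_star _)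
  apply Complex.ofReal_injective
  rw [sqNorm_eq_trace, sqNorm_eq_trace]
  simp only [act, star_smul, smul_dotProduct, dotProduct_smul, smul_smul, h2,
    Matrix.star_vecMul, ← Matrix.star_eq_conjTranspose, one_smul]
  rw [← Matrix.dotProduct_mulVec, Matrix.mulVec_mulVec,
    mul_star_self_specialUnitary, Matrix.one_mulVec]

/-- The phases cancel in `q_i p_i`, `q_i q_i^*` and `p_i^* p_i`, which are thus conjugated by a
common unitary matrix, and taking trace-free parts commutes with conjugation. -/
theorem act_mem_level {n : ℕ} {α : Fin n → ℝ} {x : Cotangent n} (hx : x ∈ level α)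
    (g : KTilde n) : act x g ∈ level α := by
  obtain ⟨h1, h2⟩ := hx
  rw [momentReal, Prod.mk.injEq, smul_eq_zero_iff_right (by simp)] at h1
  rw [momentComplex, Prod.mk.injEq, neg_eq_zero] at h2
  refine ⟨?_, ?_⟩
  · rw [momentReal, Prod.mk.injEq, smul_eq_zero_iff_right (by simp)]
    simp only [vecMulVec_star_act, sum_traceFree_conj, h1.1, sqNorm_act_snd, sqNorm_act_fst, h1.2,
      mul_zero, zero_mul, and_self]
  · rw [momentComplex, Prod.mk.injEq, neg_eq_zero]
    simp only [vecMulVec_act, sum_traceFree_conj, h2.1, mul_zero, zero_mul, true_and]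
    rw [← h2.2]
    funext i
    have : ∀ u v : Fin 2 → ℂ, u ⬝ᵥ v = (Matrix.vecMulVec v u).trace := by
      intro u v; rw [Matrix.trace_vecMulVec, dotProduct_comm]
    rw [this, this, vecMulVec_act, Matrix.trace_mul_comm, ← mul_assoc,
      mul_star_self_specialUnitary, one_mul]

theorem IsStraight.act {n : ℕ} {S : Finset (Fin n)} {x : Cotangent n} (h : IsStraight S x)
    (g : KTilde n) : IsStraight S (act x g) := by
  intro i hi j hj
  obtain ⟨c, hc⟩ := h i hi j hj
  refine ⟨(g.2 i : ℂ) * c * (g.2 j : ℂ)⁻¹, ?_⟩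
  simp only [Hyperpolygon.act, hc, Matrix.mulVec_smul, smul_smul]
  congr 1
  have : (g.2 j : ℂ) ≠ 0 := Circle.coe_ne_zero _
  field_simp

theorem snd_ne_zero {n : ℕ} {α : Fin n → ℝ} (hα : ∀ i, 0 < α i) {x : Cotangent n}
    (hx : x ∈ level α) (i : Fin n) : x.2 i ≠ 0 := by
  intro h
  have h1 := (mem_level_iff.1 hx).1 i
  have h2 : sqNorm (x.2 i) = 0 := by simp [h, sqNorm]
  have h3 : 0 ≤ sqNorm (x.1 i) := Finset.sum_nonneg fun k _ => Complex.normSq_nonneg _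
  linarith [hα i]

/-- Two vectors are proportional when their determinant vanishes. -/
theorem exists_smul_of_det {u v : Fin 2 → ℂ} (hv : v ≠ 0) (h : u 0 * v 1 - u 1 * v 0 = 0) :
    ∃ c : ℂ, u = c • v := by
  by_cases h0 : v 0 = 0
  · have h1 : v 1 ≠ 0 := fun h1 => hv (by ext k; fin_cases k <;> simp [h0, h1])
    refine ⟨u 1 / v 1, ?_⟩
    ext k
    fin_cases k
    · have : u 0 = 0 := by simpa [h0, h1] using h
      simp [this, h0]
    · simp [h1]
  · refine ⟨u 0 / v 0, ?_⟩
    ext k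
    fin_cases k
    · simp [h0]
    · simp only [Fin.mk_one, Pi.smul_apply, smul_eq_mul]
      field_simp
      linear_combination -h

/-- Since no `q_j` vanishes on the level set, proportionality is a determinantal condition. In this
form straightness is visibly closed. -/
theorem isStraight_iff {n : ℕ} {α : Fin n → ℝ} (hα : ∀ i, 0 < α i) {x : Cotangent n}
    (hx : x ∈ level α) (S : Finset (Fin n)) : IsStraight S x ↔
      ∀ i ∈ S, ∀ j ∈ S, x.2 i 0 * x.2 j 1 - x.2 i 1 * x.2 j 0 = 0 := by
  refine forall₄_congr fun i hi j hj => ⟨?_, exists_smul_of_det (snd_ne_zero hα hx j)⟩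
  rintro ⟨c, hc⟩
  simp only [hc, Pi.smul_apply, smul_eq_mul]
  ring

/-! ### Reduction to normal form -/

theorem exists_specialUnitary_rotate {u : Fin 2 → ℂ} (hu : u ≠ 0) :
    ∃ A : Matrix.specialUnitaryGroup (Fin 2) ℂ,
      star (A : Matrix (Fin 2) (Fin 2) ℂ) *ᵥ u = ![(√(sqNorm u) : ℂ), 0] := by
  have hpos : 0 < sqNorm u := by
    refine lt_of_le_of_ne (Finset.sum_nonneg fun k _ => Complex.normSq_nonneg _) fun h => hu ?_
    have := (Finset.sum_eq_zero_iff_of_nonneg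
      (fun k _ => Complex.normSq_nonneg (u k))).1 h.symm
    ext k
    exact Complex.normSq_eq_zero.1 (this k (Finset.mem_univ k))
  set r : ℝ := √(sqNorm u) with hr
  have hr0 : (r : ℂ) ≠ 0 := Complex.ofReal_ne_zero.2 (Real.sqrt_pos.2 hpos).ne'
  have hr2 : (r : ℂ) * r = u 0 * conj (u 0) + u 1 * conj (u 1) := by
    rw [← Complex.ofReal_mul, hr, Real.mul_self_sqrt hpos.le, sqNorm_eq, Complex.mul_conj,
      Complex.mul_conj]
    push_cast; rfl
  -- The columns are `u` normalized and the unit vector orthogonal to it that makes the determinant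
  -- one.
  refine ⟨⟨!![u 0 / r, - conj (u 1) / r; u 1 / r, conj (u 0) / r], ?_⟩, ?_⟩
  · rw [Matrix.mem_specialUnitaryGroup_iff, Matrix.mem_unitaryGroup_iff, Matrix.det_fin_two_of]
    constructor
    · ext i j
      fin_cases i <;> fin_cases j <;> simp [Matrix.mul_apply, Fin.sum_univ_two,
        Matrix.star_apply] <;> field_simp <;>
        first | ring1 | linear_combination (-1 : ℂ) * hr2
    · field_simp
      linear_combination (-1 : ℂ) * hr2
  · ext k
    fin_cases k <;> simp [Matrix.mulVec, dotProduct, Fin.sum_univ_two, Matrix.star_apply] <;>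
      field_simp
    · linear_combination (-1 : ℂ) * hr2
    · ring

theorem exists_circle_mul_eq_norm (z : ℂ) : ∃ e : Circle, (e : ℂ) * z = (‖z‖ : ℂ) := by
  refine ⟨Circle.exp (-Complex.arg z), ?_⟩
  rw [Circle.coe_exp]
  nth_rewrite 2 [← Complex.norm_mul_exp_arg_mul_I z]
  rw [mul_left_comm, ← Complex.exp_add]
  simp

theorem exists_eq_smul_perp {v p : Fin 2 → ℂ} (hv : v ≠ 0) (h : p 0 * v 0 + p 1 * v 1 = 0) :
    ∃ d : ℂ, p 0 = -(d * v 1) ∧ p 1 = d * v 0 := by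
  have hv' : ![-v 1, v 0] ≠ 0 := fun h' => hv (by
    have h0 := congrFun h' 0
    have h1 := congrFun h' 1
    simp only [Matrix.cons_val_zero, Pi.zero_apply, neg_eq_zero, Matrix.cons_val_one] at h0 h1
    ext k; fin_cases k <;> simp [h0, h1])
  obtain ⟨d, hd⟩ := exists_smul_of_det (u := p) hv' (by
    simp only [Matrix.cons_val_zero, Matrix.cons_val_one]; linear_combination h)
  exact ⟨d, by rw [hd]; simp, by rw [hd]; simp⟩

/-- After a rotation, the two lines spanned by the `q_i` are the coordinate axes. -/
theorem exists_act_axes {n : ℕ} {S : Finset (Fin n)} {α : Fin n → ℝ} (hα : ∀ i, 0 < α i)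
    (hS : S.Nonempty) {x : Cotangent n} (hx : x ∈ level α) (h1 : IsStraight S x)
    (h2 : IsStraight Sᶜ x) : ∃ g : KTilde n, (∀ i ∈ S, (act x g).2 i 1 = 0) ∧
      ∀ i ∈ Sᶜ, (act x g).2 i 0 = 0 := by
  obtain ⟨i₀, hi₀⟩ := hS
  obtain ⟨A, hA⟩ := exists_specialUnitary_rotate (snd_ne_zero hα hx i₀)
  refine ⟨(A, 1), ?_⟩
  have hy := act_mem_level hx (A, 1)
  have hy1 := h1.act (A, 1)
  have hy2 := h2.act (A, 1)
  have hyi₀ : (act x (A, 1)).2 i₀ 1 = 0 := by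
    simp only [act, coe_inv_specialUnitary, hA]
    simp
  set y := act x (A, 1) with hydef
  have hq1 : ∀ i ∈ S, y.2 i 1 = 0 := by
    intro i hi
    obtain ⟨c, hc⟩ := hy1 i hi i₀ hi₀
    rw [hc, Pi.smul_apply, hyi₀, smul_zero]
  have hyne := snd_ne_zero hα hy
  obtain ⟨-, hpq, hoff, hdiag, -⟩ := mem_level_iff.1 hy
  have hq0 : ∀ i ∈ S, y.2 i 0 ≠ 0 := fun i hi h => hyne i (by
    ext k; fin_cases k <;> simp [h, hq1 i hi])
  have hp0 : ∀ i ∈ S, y.1 i 0 = 0 := fun i hi => by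
    have := hpq i
    rw [hq1 i hi, mul_zero, add_zero] at this
    exact (mul_eq_zero.1 this).resolve_right (hq0 i hi)
  refine ⟨hq1, fun j₀ hj₀ => ?_⟩
  -- On `Sᶜ` all `q_j` are multiples `b_j` of one vector `(s,t)`, and all `p_j` are multiples `d_j`
  -- of its annihilator `(-t,s)`. The values for `j ∈ S` are irrelevant.
  have hex : ∀ j, ∃ b d : ℂ, j ∈ Sᶜ → b ≠ 0 ∧ y.2 j 0 = b * y.2 j₀ 0 ∧ y.2 j 1 = b * y.2 j₀ 1 ∧
      y.1 j 0 = -(d * y.2 j₀ 1) ∧ y.1 j 1 = d * y.2 j₀ 0 := by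
    intro j
    by_cases hj : j ∈ Sᶜ
    · obtain ⟨b, hb⟩ := hy2 j hj j₀ hj₀
      have hb0 : b ≠ 0 := by
        rintro rfl
        exact hyne j (by rw [hb, zero_smul])
      obtain ⟨d, hd⟩ := exists_eq_smul_perp (hyne j₀) (p := y.1 j) (by
        have := hpq j
        rw [hb] at this
        simp only [Pi.smul_apply, smul_eq_mul] at this
        refine (mul_eq_zero.1 (?_ : b * _ = 0)).resolve_left hb0
        linear_combination this)
      exact ⟨b, d, fun _ => ⟨hb0, by rw [hb]; rfl, by rw [hb]; rfl, hd⟩⟩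
    · exact ⟨0, 0, fun h => absurd h hj⟩
  choose b d hbd using hex
  set s := y.2 j₀ 0
  set t := y.2 j₀ 1
  set κ : Fin n → ℝ := fun j => Complex.normSq (b j) + Complex.normSq (d j)
  have hκ : 0 < ∑ j ∈ Sᶜ, κ j := Finset.sum_pos (fun j hj =>
    add_pos_of_pos_of_nonneg (Complex.normSq_pos.2 (hbd j hj).1) (Complex.normSq_nonneg _))
    ⟨j₀, hj₀⟩
  -- The off-diagonal equation receives nothing from `S` and a positive multiple of `s * conj t`
  -- from `Sᶜ`, so one of `s`, `t` is zero.
  rw [← Finset.sum_add_sum_compl S] at hoff hdiag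
  have hoff1 : ∑ i ∈ S, (y.2 i 0 * conj (y.2 i 1) - conj (y.1 i 0) * y.1 i 1) = 0 :=
    Finset.sum_eq_zero fun i hi => by simp [hq1 i hi, hp0 i hi]
  have hoff2 : ∑ i ∈ Sᶜ, (y.2 i 0 * conj (y.2 i 1) - conj (y.1 i 0) * y.1 i 1) =
      ((∑ j ∈ Sᶜ, κ j : ℝ) : ℂ) * (s * conj t) := by
    push_cast
    rw [Finset.sum_mul]
    refine Finset.sum_congr rfl fun j hj => ?_
    obtain ⟨-, e1, e2, e3, e4⟩ := hbd j hj
    simp only [e1, e2, e3, e4, map_mul, map_neg, κ, Complex.ofReal_add,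
      Complex.normSq_eq_conj_mul_self]
    ring
  rw [hoff1, hoff2, zero_add] at hoff
  have hst : s = 0 ∨ t = 0 := by
    rcases mul_eq_zero.1 hoff with h | h
    · exact absurd (Complex.ofReal_eq_zero.1 h) hκ.ne'
    · rcases mul_eq_zero.1 h with h | h
      · exact Or.inl h
      · exact Or.inr (by simpa using h)
  -- If `t = 0`, both lines are the first axis, and the diagonal equation would be a positive sum
  -- equal to zero.
  refine hst.resolve_right fun ht => ?_
  have hdiag1 : 0 ≤ ∑ i ∈ S, (Complex.normSq (y.2 i 0) - Complex.normSq (y.2 i 1)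
      - Complex.normSq (y.1 i 0) + Complex.normSq (y.1 i 1)) :=
    Finset.sum_nonneg fun i hi => by
      rw [hq1 i hi, hp0 i hi]
      simp only [map_zero, sub_zero]
      exact add_nonneg (Complex.normSq_nonneg _) (Complex.normSq_nonneg _)
  have hdiag2 : ∑ i ∈ Sᶜ, (Complex.normSq (y.2 i 0) - Complex.normSq (y.2 i 1)
      - Complex.normSq (y.1 i 0) + Complex.normSq (y.1 i 1)) =
      (∑ j ∈ Sᶜ, κ j) * Complex.normSq s := by
    rw [Finset.sum_mul]
    refine Finset.sum_congr rfl fun j hj => ?_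
    obtain ⟨-, e1, e2, e3, e4⟩ := hbd j hj
    simp only [e1, e2, e3, e4, ht, mul_zero, neg_zero, map_zero, map_mul, κ]
    ring
  have hs : s ≠ 0 := fun hs => hyne j₀ (by ext k; fin_cases k <;> simpa)
  have := mul_pos hκ (Complex.normSq_pos.2 hs)
  linarith

/-- A point of the level set at which `S` and its complement are straight lies on the orbit of a
point in normal form. -/
theorem exists_act_eq_normalForm {n : ℕ} {S : Finset (Fin n)} {α : Fin n → ℝ} (hα : ∀ i, 0 < α i)
    (hS : S.Nonempty) {x : Cotangent n} (hx : x ∈ level α) (h1 : IsStraight S x)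
    (h2 : IsStraight Sᶜ x) :
    ∃ (g : KTilde n) (X : Fin n → ℂ), Admissible S α X ∧ act x g = normalForm S α X := by
  obtain ⟨g, hg1, hg2⟩ := exists_act_axes hα hS hx h1 h2
  set y := act x g with hydef
  choose e he using fun z => exists_circle_mul_eq_norm z
  let k : Fin n → Fin 2 := fun i => if i ∈ S then 0 else 1
  -- These phases turn the only nonzero coordinate of each `q_i` into its absolute value.
  let h : KTilde n := (1, fun i => e (y.2 i (k i)))
  have hy := act_mem_level hx g
  rw [← hydef] at hy
  have hz := act_mem_level hy h
  set z := act y h with hzdef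
  have hz2 : ∀ i l, z.2 i l = e (y.2 i (k i)) * y.2 i l := fun i l => by
    simp [hzdef, act, h]
  have hzk : ∀ i, z.2 i (k i) = (‖y.2 i (k i)‖ : ℂ) := fun i => by rw [hz2, he]
  have hq : ∀ i, z.2 i = if i ∈ S then ![(‖y.2 i (k i)‖ : ℂ), 0] else ![0, (‖y.2 i (k i)‖ : ℂ)] := by
    intro i
    have := hzk i
    by_cases hi : i ∈ S
    · have h0 : z.2 i 1 = 0 := by rw [hz2, hg1 i hi, mul_zero]
      ext l
      fin_cases l
      · simpa [k, hi] using this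
      · simpa [hi] using h0
    · have h0 : z.2 i 0 = 0 := by rw [hz2, hg2 i (Finset.mem_compl.2 hi), mul_zero]
      ext l
      fin_cases l
      · simpa [hi] using h0
      · simpa [k, hi] using this
  have hr : ∀ i, 0 < ‖y.2 i (k i)‖ := by
    intro i
    refine norm_pos_iff.2 fun h0 => snd_ne_zero hα hz i ?_
    rw [hq i, h0]
    by_cases hi : i ∈ S <;> simp [hi]
  set r : Fin n → ℝ := fun i => ‖y.2 i (k i)‖ with hrdef
  have hr' : ∀ i, (r i : ℂ) ≠ 0 := fun i => Complex.ofReal_ne_zero.2 (hr i).ne'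
  have hq' : ∀ i, z.2 i = if i ∈ S then ![(r i : ℂ), 0] else ![0, (r i : ℂ)] := hq
  obtain ⟨hnorm, hpq, -⟩ := mem_level_iff.1 hz
  let c : Fin n → ℂ := fun i => if i ∈ S then z.1 i 1 else z.1 i 0
  have hp : ∀ i, z.1 i = if i ∈ S then ![0, c i] else ![c i, 0] := by
    intro i
    have := hpq i
    by_cases hi : i ∈ S
    · have h0 : z.1 i 0 = 0 := by simpa [hq', hi, hr' i] using this
      ext l
      fin_cases l <;> simp [hi, h0, c]
    · have h0 : z.1 i 1 = 0 := by simpa [hq', hi, hr' i] using this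
      ext l
      fin_cases l <;> simp [hi, h0, c]
  have hrc : ∀ i, r i ^ 2 - Complex.normSq (c i) = 2 * α i := by
    intro i
    rw [← hnorm i, hq', hp]
    by_cases hi : i ∈ S <;> simp [hi, sqNorm_eq, Complex.normSq_ofReal, sq]
  have hrad : ∀ i, radius (α i) (r i * c i) = r i := fun i => radius_mul (hα i) (hr i) (hrc i)
  have hnf : z = normalForm S α (fun i => r i * c i) := by
    refine Prod.ext ?_ ?_
    · funext i
      rw [hp]
      simp only [normalForm, hrad, mul_div_cancel_left₀ _ (hr' i)]
    · funext i
      rw [hq']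
      simp only [normalForm, hrad]
  refine ⟨g * h, _, ?_, by rw [← act_mul]; exact hnf⟩
  rw [← normalForm_mem_level_iff hα, ← hnf]
  exact hz

/-! ### Membership in the strata -/

theorem mk_eq_mk {n : ℕ} {α : Fin n → ℝ} {x y : level α} :
    mk α x = mk α y ↔ ∃ g : KTilde n, act x.1 g = y.1 :=
  Quotient.eq (r := orbitSetoid α)

theorem mk_surjective {n : ℕ} (α : Fin n → ℝ) : Function.Surjective (mk α) :=
  Quotient.mk_surjective

theorem mk_mem_Z_iff {n : ℕ} {α : Fin n → ℝ} {S : Finset (Fin n)} {x : level α} :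
    mk α x ∈ Z α S ↔ IsStraight S x.1 ∧ IsStraight Sᶜ x.1 := by
  refine ⟨?_, fun h => ⟨x, h, rfl⟩⟩
  rintro ⟨y, ⟨h1, h2⟩, hy⟩
  obtain ⟨g, hg⟩ := mk_eq_mk.1 hy
  rw [← hg]
  exact ⟨h1.act g, h2.act g⟩

theorem mk_mem_M_iff {n : ℕ} {α : Fin n → ℝ} {x : level α} : mk α x ∈ M α ↔ x.1.1 = 0 := by
  refine ⟨?_, fun h => ⟨x, h, rfl⟩⟩
  rintro ⟨y, hy0, hy⟩
  obtain ⟨g, hg⟩ := mk_eq_mk.1 hy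
  rw [Set.mem_ofPred_eq] at hy0
  rw [← hg]
  funext i
  simp [act, hy0]

theorem isStraight_normalForm {n : ℕ} (S : Finset (Fin n)) {α : Fin n → ℝ} (hα : ∀ i, 0 < α i)
    (X : Fin n → ℂ) : IsStraight S (normalForm S α X) ∧ IsStraight Sᶜ (normalForm S α X) := by
  constructor
  · intro i hi j hj
    refine ⟨(radius (α i) (X i) : ℂ) / radius (α j) (X j), ?_⟩
    have := radius_ne_zero (hα j) (X j)
    ext k
    fin_cases k <;> simp [normalForm, hi, hj, this]
  · intro i hi j hj
    rw [Finset.mem_compl] at hi hj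
    refine ⟨(radius (α i) (X i) : ℂ) / radius (α j) (X j), ?_⟩
    have := radius_ne_zero (hα j) (X j)
    ext k
    fin_cases k <;> simp [normalForm, hi, hj, this]

theorem mem_Z_iff_exists_normalForm {n : ℕ} {α : Fin n → ℝ} (hα : ∀ i, 0 < α i)
    {S : Finset (Fin n)} (hS : S.Nonempty) {z : X α} : z ∈ Z α S ↔
      ∃ (X : Fin n → ℂ) (hX : Admissible S α X),
        z = mk α ⟨normalForm S α X, (normalForm_mem_level_iff hα).2 hX⟩ := by
  constructor
  · obtain ⟨x, rfl⟩ := mk_surjective α z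
    intro h
    obtain ⟨h1, h2⟩ := mk_mem_Z_iff.1 h
    obtain ⟨g, X, hX, hg⟩ := exists_act_eq_normalForm hα hS x.2 h1 h2
    exact ⟨X, hX, mk_eq_mk.2 ⟨g, hg⟩⟩
  · rintro ⟨X, hX, rfl⟩
    exact mk_mem_Z_iff.2 (isStraight_normalForm S hα X)

theorem Z_compl {n : ℕ} (α : Fin n → ℝ) (S : Finset (Fin n)) : Z α Sᶜ = Z α S := by
  ext z
  obtain ⟨x, rfl⟩ := mk_surjective α z
  rw [mk_mem_Z_iff, mk_mem_Z_iff, compl_compl, and_comm]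

theorem epsilon_compl {n : ℕ} (α : Fin n → ℝ) (S : Finset (Fin n)) :
    epsilon α Sᶜ = -epsilon α S := by
  rw [epsilon, epsilon, compl_compl, neg_sub]

theorem isShort_compl_iff {n : ℕ} {α : Fin n → ℝ} (hgen : IsGeneric α) (S : Finset (Fin n)) :
    IsShort α Sᶜ ↔ ¬ IsShort α S := by
  rw [IsShort, IsShort, epsilon_compl, neg_lt_zero, not_lt]
  exact ⟨le_of_lt, fun h => lt_of_le_of_ne h (hgen S).symm⟩

theorem IsShort.compl_nonempty {n : ℕ} {α : Fin n → ℝ} (hα : ∀ i, 0 < α i) {S : Finset (Fin n)}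
    (hS : IsShort α S) : Sᶜ.Nonempty := by
  by_contra h
  rw [Finset.not_nonempty_iff_eq_empty] at h
  rw [IsShort, epsilon, h, Finset.sum_empty, sub_zero] at hS
  exact hS.not_ge (Finset.sum_nonneg fun i _ => (hα i).le)

theorem nonempty_of_mem_shortSets' {n : ℕ} {α : Fin n → ℝ} {S : Finset (Fin n)}
    (hS : S ∈ shortSets' α) : S.Nonempty :=
  Finset.card_pos.1 (by have := hS.2; omega)

theorem Admissible.compl {n : ℕ} {α : Fin n → ℝ} {S : Finset (Fin n)} {X : Fin n → ℂ}
    (h : Admissible S α X) : Admissible Sᶜ α X :=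
  ⟨h.2, by rw [compl_compl]; exact h.1, by rw [compl_compl]; exact h.3.symm⟩

/-- If `X` vanished on `S`, the energies there would be the `α_i`, while those on `Sᶜ` are at least
the `α_i`; equality of the sums would contradict shortness. -/
theorem Admissible.exists_ne_zero {n : ℕ} {α : Fin n → ℝ} (hα : ∀ i, 0 < α i)
    {S : Finset (Fin n)} {X : Fin n → ℂ} (h : Admissible S α X) (hS : IsShort α S) :
    ∃ i ∈ S, X i ≠ 0 := by
  by_contra! hX
  have h1 : ∑ i ∈ S, energy (α i) (X i) = ∑ i ∈ S, α i :=
    Finset.sum_congr rfl fun i hi => by rw [hX i hi, energy_zero (hα i)]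
  have h2 : ∑ i ∈ Sᶜ, α i ≤ ∑ i ∈ Sᶜ, energy (α i) (X i) :=
    Finset.sum_le_sum fun i _ => le_energy _ _
  have h3 := h.sum_energy
  rw [IsShort, epsilon] at hS
  linarith

/-- On a singleton the linear condition forces `X` to vanish. This is why only short sets with two
elements occur in the decomposition. -/
theorem Admissible.two_le_card {n : ℕ} {α : Fin n → ℝ} (hα : ∀ i, 0 < α i)
    {S : Finset (Fin n)} {X : Fin n → ℂ} (h : Admissible S α X) (hS : IsShort α S) :
    2 ≤ S.card := by
  obtain ⟨i, hi, hXi⟩ := h.exists_ne_zero hα hS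
  by_contra hc
  have h1 : S.card = 1 := by have := Finset.card_pos.2 ⟨i, hi⟩; omega
  obtain ⟨j, rfl⟩ := Finset.card_eq_one.1 h1
  have := h.sum_eq_zero
  rw [Finset.sum_singleton] at this
  rw [Finset.mem_singleton] at hi
  exact hXi (hi ▸ this)

theorem disjoint_M_Z {n : ℕ} {α : Fin n → ℝ} (hα : ∀ i, 0 < α i) {S : Finset (Fin n)}
    (hS : S ∈ shortSets' α) : Disjoint (M α) (Z α S) := by
  rw [Set.disjoint_left]
  intro z hM hZ
  obtain ⟨X, hX, rfl⟩ := (mem_Z_iff_exists_normalForm hα (nonempty_of_mem_shortSets' hS)).1 hZ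
  obtain ⟨i, hi, hXi⟩ := hX.exists_ne_zero hα hS.1
  have := congrFun (congrFun (mk_mem_M_iff.1 hM) i) 1
  simp [normalForm, hi, hXi, radius_ne_zero (hα i) (X i)] at this

/-- In normal form `q_i` and `q_j` are independent when `S` separates `i` from `j`. The point
therefore determines the partition into `S` and `Sᶜ`, and only one of the two is short. -/
theorem eq_of_mem_Z {n : ℕ} {α : Fin n → ℝ} (hα : ∀ i, 0 < α i) (hgen : IsGeneric α)
    {S T : Finset (Fin n)} (hS : S ∈ shortSets' α) (hT : T ∈ shortSets' α) {z : X α}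
    (hzS : z ∈ Z α S) (hzT : z ∈ Z α T) : S = T := by
  obtain ⟨X, hX, rfl⟩ := (mem_Z_iff_exists_normalForm hα (nonempty_of_mem_shortSets' hS)).1 hzS
  obtain ⟨h1, h2⟩ := mk_mem_Z_iff.1 hzT
  rw [isStraight_iff hα ((normalForm_mem_level_iff hα).2 hX)] at h1 h2
  have key : ∀ i ∈ S, ∀ j ∉ S, ¬ ((i ∈ T ∧ j ∈ T) ∨ (i ∉ T ∧ j ∉ T)) := by
    intro i hi j hj h
    have hdet : (normalForm S α X).2 i 0 * (normalForm S α X).2 j 1 -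
        (normalForm S α X).2 i 1 * (normalForm S α X).2 j 0 = 0 := by
      rcases h with ⟨hiT, hjT⟩ | ⟨hiT, hjT⟩
      · exact h1 i hiT j hjT
      · exact h2 i (Finset.mem_compl.2 hiT) j (Finset.mem_compl.2 hjT)
    simp only [normalForm, hi, hj, if_true, if_false, Matrix.cons_val_zero, Matrix.cons_val_one,
      mul_zero, sub_zero] at hdet
    exact mul_ne_zero (radius_ne_zero (hα i) _) (radius_ne_zero (hα j) _) hdet
  obtain ⟨i, hi⟩ := nonempty_of_mem_shortSets' hS
  obtain ⟨j, hj⟩ := hS.1.compl_nonempty hα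
  rw [Finset.mem_compl] at hj
  have hkij := key i hi j hj
  by_cases hiT : i ∈ T
  · have hjT : j ∉ T := fun h => hkij (Or.inl ⟨hiT, h⟩)
    ext k
    constructor
    · intro hk
      by_contra hkT
      exact key k hk j hj (Or.inr ⟨hkT, hjT⟩)
    · intro hk
      by_contra hkS
      exact key i hi k hkS (Or.inl ⟨hiT, hk⟩)
  · have hjT : j ∈ T := by
      by_contra h
      exact hkij (Or.inr ⟨hiT, h⟩)
    have hST : T = Sᶜ := by
      ext k
      rw [Finset.mem_compl]
      constructor
      · intro hk hkS
        exact key k hkS j hj (Or.inl ⟨hk, hjT⟩)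
      · intro hk
        by_contra hkT
        exact key i hi k hk (Or.inr ⟨hiT, hkT⟩)
    exact absurd hS.1 ((isShort_compl_iff hgen S).1 (hST ▸ hT.1))

theorem Z_eq_XS {n : ℕ} {α : Fin n → ℝ} (hα : ∀ i, 0 < α i) {S : Finset (Fin n)}
    (hS : S ∈ shortSets' α) (hcard : Sᶜ.card = 1) : Z α S = XS α S := by
  refine Set.Subset.antisymm (fun z hz => ?_) ?_
  · obtain ⟨X, hX, rfl⟩ := (mem_Z_iff_exists_normalForm hα (nonempty_of_mem_shortSets' hS)).1 hz
    obtain ⟨h1, h2⟩ := isStraight_normalForm S hα X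
    refine ⟨_, ⟨h1, h2, fun j hj => ?_⟩, rfl⟩
    obtain ⟨k, hk⟩ := Finset.card_eq_one.1 hcard
    have hX0 := hX.sum_compl_eq_zero
    rw [hk, Finset.sum_singleton] at hX0
    have hjk : j = k := by rwa [hk, Finset.mem_singleton] at hj
    subst hjk
    simp [normalForm, Finset.mem_compl.1 hj, hX0]
  · rintro _ ⟨x, ⟨h1, h2, -⟩, rfl⟩
    exact ⟨x, ⟨h1, h2⟩, rfl⟩

/-! ### The fixed points of the involution -/

theorem involution_mk {n : ℕ} {α : Fin n → ℝ} (x : level α) :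
    involution α (mk α x) = mk α ⟨(-x.1.1, x.1.2), neg_mem_level x.2⟩ := rfl

theorem normalForm_neg {n : ℕ} (S : Finset (Fin n)) (α : Fin n → ℝ) (X : Fin n → ℂ) :
    normalForm S α (-X) = (-(normalForm S α X).1, (normalForm S α X).2) := by
  have hr : ∀ i, radius (α i) (-X i) = radius (α i) (X i) := fun i =>
    radius_congr _ (norm_neg _)
  refine Prod.ext ?_ ?_
  · funext i k
    by_cases hi : i ∈ S <;> fin_cases k <;> simp [normalForm, hi, hr, neg_div]
  · funext i k
    by_cases hi : i ∈ S <;> fin_cases k <;> simp [normalForm, hi, hr]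

theorem scale_neg_one {n : ℕ} (S : Finset (Fin n)) (X : Fin n → ℂ) : scale S (-1) X = -X := by
  funext i
  by_cases hi : i ∈ S <;> simp [scale, hi]

/-- The hypothesis says `A q_i = e_i q_i` and `p_i A = -e_i p_i`. Fix `i` with `p_i ≠ 0` and let `S`
consist of the `j` with `q_j` proportional to `q_i`. If `q_j` and `q_k` were independent outside
`S`, then `q_i, q_j, q_k` would be pairwise independent eigenvectors of `A`, so their eigenvalues
would coincide. -/
theorem isStraight_of_act_eq_neg {n : ℕ} {α : Fin n → ℝ} (hα : ∀ i, 0 < α i) {x : Cotangent n}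
    (hx : x ∈ level α) {g : KTilde n} (hg : act x g = (-x.1, x.2)) (hp : x.1 ≠ 0) :
    ∃ S : Finset (Fin n), S.Nonempty ∧ IsStraight S x ∧ IsStraight Sᶜ x := by
  obtain ⟨A, e⟩ := g
  have hq : ∀ i, (A : Matrix (Fin 2) (Fin 2) ℂ) *ᵥ x.2 i = (e i : ℂ) • x.2 i := by
    intro i
    have h := congrFun (congrArg Prod.snd hg) i
    simp only [act, coe_inv_specialUnitary] at h
    nth_rewrite 1 [← h]
    rw [Matrix.mulVec_smul, Matrix.mulVec_mulVec, mul_star_self_specialUnitary, Matrix.one_mulVec]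
  have hpA : ∀ i, x.1 i ᵥ* (A : Matrix (Fin 2) (Fin 2) ℂ) = -((e i : ℂ) • x.1 i) := by
    intro i
    have h := congrFun (congrArg Prod.fst hg) i
    simp only [act, Pi.neg_apply] at h
    rw [← smul_neg, ← h, smul_smul, Circle.coe_inv, mul_inv_cancel₀ (Circle.coe_ne_zero _),
      one_smul]
  have hdet := (Matrix.mem_specialUnitaryGroup_iff.1 A.2).2
  rw [Matrix.det_fin_two] at hdet
  set a := (A : Matrix (Fin 2) (Fin 2) ℂ) 0 0
  set b := (A : Matrix (Fin 2) (Fin 2) ℂ) 0 1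
  set c := (A : Matrix (Fin 2) (Fin 2) ℂ) 1 0
  set d := (A : Matrix (Fin 2) (Fin 2) ℂ) 1 1
  have hq0 : ∀ i, a * x.2 i 0 + b * x.2 i 1 = e i * x.2 i 0 := fun i => by
    have := congrFun (hq i) 0
    simpa [Matrix.mulVec, dotProduct, Fin.sum_univ_two] using this
  have hq1 : ∀ i, c * x.2 i 0 + d * x.2 i 1 = e i * x.2 i 1 := fun i => by
    have := congrFun (hq i) 1
    simpa [Matrix.mulVec, dotProduct, Fin.sum_univ_two] using this
  have hp0 : ∀ i, x.1 i 0 * a + x.1 i 1 * c = -(e i * x.1 i 0) := fun i => by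
    have := congrFun (hpA i) 0
    simpa [Matrix.vecMul, dotProduct, Fin.sum_univ_two] using this
  have hp1 : ∀ i, x.1 i 0 * b + x.1 i 1 * d = -(e i * x.1 i 1) := fun i => by
    have := congrFun (hpA i) 1
    simpa [Matrix.vecMul, dotProduct, Fin.sum_univ_two] using this
  have hpq := (mem_level_iff.1 hx).2.1
  -- Two independent eigenvectors have eigenvalues with product `det A = 1`.
  have hD : ∀ j k, x.2 j 0 * x.2 k 1 - x.2 j 1 * x.2 k 0 ≠ 0 → (e j : ℂ) * e k = 1 := by
    intro j k h
    have : ((e j : ℂ) * e k - 1) * (x.2 j 0 * x.2 k 1 - x.2 j 1 * x.2 k 0) = 0 := by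
      linear_combination (x.2 j 0 * x.2 k 1 - x.2 j 1 * x.2 k 0) * hdet
        - (c * x.2 k 0 + d * x.2 k 1) * hq0 j - (e j * x.2 j 0) * hq1 k
        + (a * x.2 k 0 + b * x.2 k 1) * hq1 j + (e j * x.2 j 1) * hq0 k
    exact sub_eq_zero.1 ((mul_eq_zero.1 this).resolve_right h)
  obtain ⟨i, hi⟩ : ∃ i, x.1 i ≠ 0 := by
    by_contra! h
    exact hp (funext h)
  have hqi := snd_ne_zero hα hx
  refine ⟨Finset.univ.filter fun j => x.2 j 0 * x.2 i 1 - x.2 j 1 * x.2 i 0 = 0, ⟨i, ?_⟩, ?_, ?_⟩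
  · simp only [Finset.mem_filter, Finset.mem_univ, true_and]
    ring
  · intro j hj k hk
    simp only [Finset.mem_filter, Finset.mem_univ, true_and] at hj hk
    obtain ⟨s, hs⟩ := exists_smul_of_det (hqi i) hj
    obtain ⟨t, ht⟩ := exists_smul_of_det (hqi k) (u := x.2 i) (by linear_combination -hk)
    exact ⟨s * t, by rw [hs, ht, smul_smul]⟩
  · rw [isStraight_iff hα hx]
    intro j hj k hk
    simp only [Finset.mem_compl, Finset.mem_filter, Finset.mem_univ, true_and] at hj hk
    by_contra hjk
    have e1 := hD j i hj
    have e2 := hD k i hk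
    have e3 := hD j k hjk
    have hei : (e i : ℂ) ≠ 0 := Circle.coe_ne_zero _
    have e4 : (e j : ℂ) = e k := mul_right_cancel₀ hei (e1.trans e2.symm)
    have hej : (e j : ℂ) ≠ 0 := Circle.coe_ne_zero _
    have e5 : (e k : ℂ) = e i := mul_left_cancel₀ hej (e3.trans e1.symm)
    -- With a common eigenvalue `e_i`, evaluating `p_i A q_j` in two ways gives `p_i q_j = -p_i
    -- q_j`. As `p_i` also annihilates the independent vector `q_i`, it is zero.
    have hz : x.1 i 0 * x.2 j 0 + x.1 i 1 * x.2 j 1 = 0 := by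
      have : (2 * (e i : ℂ)) * (x.1 i 0 * x.2 j 0 + x.1 i 1 * x.2 j 1) = 0 := by
        have h0 := hq0 j
        have h1 := hq1 j
        rw [e4, e5] at h0 h1
        linear_combination (-x.1 i 0) * h0 - x.1 i 1 * h1 + x.2 j 0 * hp0 i + x.2 j 1 * hp1 i
      exact (mul_eq_zero.1 this).resolve_left (mul_ne_zero two_ne_zero hei)
    refine hi ?_
    ext l
    fin_cases l
    · refine (mul_eq_zero.1 (?_ : x.1 i 0 * _ = 0)).resolve_right hj
      linear_combination x.2 i 1 * hz - x.2 j 1 * hpq i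
    · refine (mul_eq_zero.1 (?_ : x.1 i 1 * _ = 0)).resolve_right hj
      linear_combination x.2 j 0 * hpq i - x.2 i 0 * hz

theorem fixedPoints_involution {n : ℕ} {α : Fin n → ℝ} (hα : ∀ i, 0 < α i) (hgen : IsGeneric α) :
    Function.fixedPoints (involution α) = M α ∪ ⋃ S ∈ shortSets' α, Z α S := by
  ext z
  rw [Function.mem_fixedPoints, Function.IsFixedPt, Set.mem_union, Set.mem_iUnion₂]
  constructor
  · obtain ⟨x, rfl⟩ := mk_surjective α z
    intro h
    rw [involution_mk] at h
    obtain ⟨g, hg⟩ := mk_eq_mk.1 h.symm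
    by_cases hp : x.1.1 = 0
    · exact Or.inl (mk_mem_M_iff.2 hp)
    · obtain ⟨S, hSne, h1, h2⟩ := isStraight_of_act_eq_neg hα x.2 hg hp
      obtain ⟨-, X, hX, -⟩ := exists_act_eq_normalForm hα hSne x.2 h1 h2
      have hz : mk α x ∈ Z α S := mk_mem_Z_iff.2 ⟨h1, h2⟩
      -- The set found above need not be short; if it is not, its complement defines the same
      -- stratum.
      by_cases hS : IsShort α S
      · exact Or.inr ⟨S, ⟨hS, hX.two_le_card hα hS⟩, hz⟩
      · have hSc := (isShort_compl_iff hgen S).2 hS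
        exact Or.inr ⟨Sᶜ, ⟨hSc, hX.compl.two_le_card hα hSc⟩, by rwa [Z_compl]⟩
  · rintro (⟨x, hx, rfl⟩ | ⟨S, hS, hz⟩)
    · rw [involution_mk]
      congr 1
      rw [Set.mem_ofPred_eq] at hx
      refine Subtype.ext (Prod.ext ?_ rfl)
      change -x.1.1 = x.1.1
      rw [hx, neg_zero]
    · obtain ⟨X, hX, rfl⟩ := (mem_Z_iff_exists_normalForm hα (nonempty_of_mem_shortSets' hS)).1 hz
      rw [involution_mk, eq_comm, mk_eq_mk]
      -- Both weights send `-1` to `-1`, so this circle element negates all of `X`, that is, all of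
      -- `p`.
      obtain ⟨g, hg⟩ := exists_act_normalForm_scale S α X (-1)
      refine ⟨g, hg.trans (Eq.trans ?_ (normalForm_neg S α X))⟩
      rw [← scale_neg_one S X]
      rfl

/-! ### The quotient topology -/

theorem continuous_act {n : ℕ} : Continuous fun y : Cotangent n × KTilde n => act y.1 y.2 := by
  have hA : Continuous fun y : Cotangent n × KTilde n => (y.2.1 : Matrix (Fin 2) (Fin 2) ℂ) :=
    continuous_subtype_val.comp (continuous_fst.comp continuous_snd)
  have he : ∀ i, Continuous fun y : Cotangent n × KTilde n => (y.2.2 i : ℂ) := fun i =>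
    continuous_subtype_val.comp ((continuous_apply i).comp (continuous_snd.comp continuous_snd))
  have he' : ∀ i, Continuous fun y : Cotangent n × KTilde n => (((y.2.2 i)⁻¹ : Circle) : ℂ) := by
    intro i
    simp only [Circle.coe_inv_eq_conj]
    exact Complex.continuous_conj.comp (he i)
  refine Continuous.prodMk (continuous_pi fun i => ?_) (continuous_pi fun i => ?_)
  · exact (he' i).smul (Continuous.matrix_vecMul
      ((continuous_apply i).comp (continuous_fst.comp continuous_fst)) hA)
  · simp only [coe_inv_specialUnitary]
    exact (he i).smul (Continuous.matrix_mulVec hA.star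
      ((continuous_apply i).comp (continuous_snd.comp continuous_fst)))

instance : CompactSpace (Matrix.specialUnitaryGroup (Fin 2) ℂ) := by
  refine (isCompact_iff_compactSpace (s := (Matrix.specialUnitaryGroup (Fin 2) ℂ :
    Set (Matrix (Fin 2) (Fin 2) ℂ)))).1 ?_
  have hcomp : IsCompact (Set.pi Set.univ fun _ : Fin 2 => Set.pi Set.univ fun _ : Fin 2 =>
      Metric.closedBall (0 : ℂ) 1) :=
    isCompact_univ_pi fun _ => isCompact_univ_pi fun _ => isCompact_closedBall 0 1
  refine IsCompact.of_isClosed_subset hcomp ?_ ?_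
  · have : (Matrix.specialUnitaryGroup (Fin 2) ℂ : Set (Matrix (Fin 2) (Fin 2) ℂ)) =
        {A | A * star A = 1} ∩ {A | A.det = 1} := by
      ext A
      simp only [SetLike.mem_coe, Matrix.mem_specialUnitaryGroup_iff, Matrix.mem_unitaryGroup_iff]
      rfl
    rw [this]
    exact (isClosed_eq (continuous_id.mul continuous_id.star) continuous_const).inter
      (isClosed_eq continuous_id.matrix_det continuous_const)
  · intro A hA i _ j _
    rw [mem_closedBall_zero_iff]
    exact entry_norm_bound_of_unitary (Matrix.mem_specialUnitaryGroup_iff.1 hA).1 i j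

theorem continuous_mk {n : ℕ} (α : Fin n → ℝ) : Continuous (mk α) := continuous_quot_mk

/-- The action of a group element on the level set. -/
noncomputable def actLevel {n : ℕ} {α : Fin n → ℝ} (g : KTilde n) (x : level α) : level α :=
  ⟨act x.1 g, act_mem_level x.2 g⟩

theorem continuous_actLevel {n : ℕ} {α : Fin n → ℝ} (g : KTilde n) :
    Continuous (actLevel (α := α) g) :=
  (continuous_act.comp (continuous_subtype_val.prodMk continuous_const)).subtype_mk _

/-- The saturation of an open set is the union of its translates. -/
theorem isOpenQuotientMap_mk {n : ℕ} (α : Fin n → ℝ) : IsOpenQuotientMap (mk α) := by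
  refine ⟨mk_surjective α, continuous_mk α, fun U hU => ?_⟩
  have hquot : Topology.IsQuotientMap (mk α) := isQuotientMap_quot_mk
  rw [← hquot.isOpen_preimage]
  have : mk α ⁻¹' (mk α '' U) = ⋃ g : KTilde n, actLevel g ⁻¹' U := by
    ext x
    simp only [Set.mem_preimage, Set.mem_image, Set.mem_iUnion]
    constructor
    · rintro ⟨y, hy, hyx⟩
      obtain ⟨g, hg⟩ := mk_eq_mk.1 hyx.symm
      exact ⟨g, by rwa [show actLevel g x = y from Subtype.ext hg]⟩
    · rintro ⟨g, hg⟩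
      exact ⟨_, hg, (mk_eq_mk.2 ⟨g, rfl⟩).symm⟩
  rw [this]
  exact isOpen_iUnion fun g => hU.preimage (continuous_actLevel g)

instance {n : ℕ} (α : Fin n → ℝ) : T2Space (X α) := by
  -- For an open quotient map it suffices that the orbit relation is closed. It is the projection of
  -- a closed set along the compact group.
  rw [t2Space_iff_of_isOpenQuotientMap (isOpenQuotientMap_mk α)]
  have hcl : IsClosed {y : (level α × level α) × KTilde n | act y.1.1.1 y.2 = y.1.2.1} :=
    isClosed_eq (continuous_act.comp ((continuous_subtype_val.comp
      (continuous_fst.comp continuous_fst)).prodMk continuous_snd))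
      (continuous_subtype_val.comp (continuous_snd.comp continuous_fst))
  have himg : {q : level α × level α | mk α q.1 = mk α q.2} =
      Prod.fst '' {y : (level α × level α) × KTilde n | act y.1.1.1 y.2 = y.1.2.1} := by
    refine Set.ext fun y => ⟨fun hy => ?_, ?_⟩
    · obtain ⟨g, hg⟩ := mk_eq_mk.1 hy
      exact ⟨(y, g), hg, rfl⟩
    · rintro ⟨⟨z, g⟩, hg, rfl⟩
      exact mk_eq_mk.2 ⟨g, hg⟩
  rw [himg]
  exact isClosedMap_fst_of_compactSpace _ hcl

instance {n : ℕ} (α : Fin n → ℝ) : SecondCountableTopology (X α) :=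
  (isOpenQuotientMap_mk α).isQuotientMap.secondCountableTopology (isOpenQuotientMap_mk α).isOpenMap

theorem isOpenQuotientMap_overProj {n : ℕ} {α : Fin n → ℝ} (Y : Set (X α)) :
    IsOpenQuotientMap (overProj Y) := by
  let H : overSet Y ≃ₜ mk α ⁻¹' Y :=
    { toFun := fun x => ⟨⟨x.1, x.2.1⟩, x.2.2⟩
      invFun := fun x => ⟨x.1.1, x.1.2, x.2⟩
      left_inv := fun x => rfl
      right_inv := fun x => rfl
      continuous_toFun := (continuous_subtype_val.subtype_mk _).subtype_mk _
      continuous_invFun := (continuous_subtype_val.comp continuous_subtype_val).subtype_mk _ }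
  exact ((isOpenQuotientMap_mk α).restrictPreimage Y).comp H.isOpenQuotientMap

theorem isOpenQuotientMap_selfProj (V : Type*) [TopologicalSpace V] :
    IsOpenQuotientMap (selfProj V) :=
  (Homeomorph.Set.univ V).isOpenQuotientMap

/-! ### Smooth charts of presented spaces -/

section Presented

variable {V W N₁ N₂ : Type*} [NormedAddCommGroup V] [NormedSpace ℝ V] [NormedAddCommGroup W]
  [NormedSpace ℝ W] {A : Set V} {B : Set W} {π₁ : A → N₁} {π₂ : B → N₂}

theorem SmoothOn.continuousOn [TopologicalSpace N₁] [TopologicalSpace N₂] {f : N₁ → N₂}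
    {s : Set N₁} (h : SmoothOn π₁ π₂ f s) (hπ₁ : IsOpenQuotientMap π₁) (hπ₂ : Continuous π₂)
    (hs : IsOpen s) : ContinuousOn f s := by
  intro z hz
  obtain ⟨x, rfl⟩ := hπ₁.surjective z
  refine ContinuousAt.continuousWithinAt ?_
  rw [← hπ₁.continuousAt_comp_iff]
  obtain ⟨U, hU, hxU, F, hF, hFf⟩ := h x hz
  let O : Set A := {y | (y : V) ∈ U} ∩ π₁ ⁻¹' s
  have hO : IsOpen O := (hU.preimage continuous_subtype_val).inter (hs.preimage hπ₁.continuous)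
  refine ContinuousOn.continuousAt (s := O) ?_ (hO.mem_nhds ⟨hxU, hz⟩)
  rw [continuousOn_iff_continuous_domRestrict]
  have hFc : Continuous fun y : O => F y.1 := by
    have := hF.continuousOn.comp_continuous (f := fun y : O => (y.1 : V))
      (continuous_subtype_val.comp continuous_subtype_val) (fun y => y.2.1)
    exact this
  have hB : ∀ y : O, F y.1 ∈ B := fun y => (hFf y.1 y.2.1 y.2.2).1
  have : O.domRestrict (f ∘ π₁) = fun y => π₂ ⟨F y.1, hB y⟩ := by
    funext y
    exact (hFf y.1 y.2.1 y.2.2).2.symm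
  rw [this]
  exact hπ₂.comp (hFc.subtype_mk _)

/-- Composing the two local lifts shows that transition maps between charts are smooth in the
ordinary sense, whatever representatives the lifts choose in between. -/
theorem SmoothOn.contDiffOn_comp {E E' : Type*} [NormedAddCommGroup E] [NormedSpace ℝ E]
    [NormedAddCommGroup E'] [NormedSpace ℝ E'] {f : E → N₁} {g : N₁ → E'} {s : Set E} {t : Set N₁}
    (hf : SmoothOn (selfProj E) π₁ f s) (hg : SmoothOn π₁ (selfProj E') g t) :
    ContDiffOn ℝ ∞ (g ∘ f) (s ∩ f ⁻¹' t) := by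
  rintro v ⟨hvs, hvt⟩
  obtain ⟨U, hU, hvU, F, hF, hFf⟩ := hf ⟨v, trivial⟩ hvs
  obtain ⟨hFA, hFv⟩ := hFf ⟨v, trivial⟩ hvU hvs
  obtain ⟨U', hU', hvU', G, hG, hGg⟩ := hg ⟨F v, hFA⟩ (by rw [hFv]; exact hvt)
  have hFat : ContDiffAt ℝ ∞ F v := hF.contDiffAt (hU.mem_nhds hvU)
  have hGat : ContDiffAt ℝ ∞ G (F v) := hG.contDiffAt (hU'.mem_nhds hvU')
  refine ContDiffWithinAt.congr_of_eventuallyEq (f := G ∘ F)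
    (hGat.comp v hFat).contDiffWithinAt ?_ ?_
  · have h1 : ∀ᶠ w in 𝓝[s ∩ f ⁻¹' t] v, w ∈ U := nhdsWithin_le_nhds (hU.mem_nhds hvU)
    have h2 : ∀ᶠ w in 𝓝[s ∩ f ⁻¹' t] v, F w ∈ U' :=
      nhdsWithin_le_nhds (hFat.continuousAt.preimage_mem_nhds (hU'.mem_nhds hvU'))
    filter_upwards [h1, h2, self_mem_nhdsWithin] with w hw1 hw2 hw3
    obtain ⟨hFw, hFw'⟩ := hFf ⟨w, trivial⟩ hw1 hw3.1
    obtain ⟨_, h⟩ := hGg ⟨F w, hFw⟩ hw2 (by rw [hFw']; exact hw3.2)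
    change g (f w) = G (F w)
    rw [show f w = π₁ ⟨F w, hFw⟩ from hFw'.symm, ← h]
    rfl
  · obtain ⟨_, h⟩ := hGg ⟨F v, hFA⟩ hvU' (by rw [hFv]; exact hvt)
    change g (f v) = G (F v)
    rw [show f v = π₁ ⟨F v, hFA⟩ from hFv.symm, ← h]
    rfl

end Presented

/-- A subset of `X(α)` covered by smooth charts is a smooth manifold. -/
theorem isSmoothManifold_of_charts {n : ℕ} {α : Fin n → ℝ} {Y : Set (X α)} {d : ℕ}
    (h : ∀ y : Y, ∃ e : PartialEquiv Y (EuclideanSpace ℝ (Fin d)), y ∈ e.source ∧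
      IsOpen e.source ∧ IsOpen e.target ∧
      SmoothOn (overProj Y) (selfProj (EuclideanSpace ℝ (Fin d))) e e.source ∧
      SmoothOn (selfProj (EuclideanSpace ℝ (Fin d))) (overProj Y) e.symm e.target) :
    IsSmoothManifold Y d := by
  refine ⟨inferInstance, inferInstance, ?_⟩
  have h' : ∀ y : Y, ∃ e : OpenPartialHomeomorph Y (EuclideanSpace ℝ (Fin d)), y ∈ e.source ∧
      SmoothOn (overProj Y) (selfProj (EuclideanSpace ℝ (Fin d))) e e.source ∧
      SmoothOn (selfProj (EuclideanSpace ℝ (Fin d))) (overProj Y) e.symm e.target := by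
    intro y
    obtain ⟨e, hy, ho, ht, h1, h2⟩ := h y
    have hc1 := h1.continuousOn (isOpenQuotientMap_overProj Y)
      (isOpenQuotientMap_selfProj _).continuous ho
    have hc2 := h2.continuousOn (isOpenQuotientMap_selfProj _)
      (isOpenQuotientMap_overProj Y).continuous ht
    exact ⟨⟨⟨e, hc1, hc2⟩, ho, ht⟩, hy, h1, h2⟩
  choose c hc1 hc2 hc3 using h'
  -- The atlas consists of all charts smooth in both directions, so the condition on its members
  -- holds by definition.
  let cs : ChartedSpace (EuclideanSpace ℝ (Fin d)) Y :=
    { atlas := {e | SmoothOn (overProj Y) (selfProj (EuclideanSpace ℝ (Fin d))) e e.source ∧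
        SmoothOn (selfProj (EuclideanSpace ℝ (Fin d))) (overProj Y) e.symm e.target}
      chartAt := c
      mem_chart_source := hc1
      chart_mem_atlas := fun y => ⟨hc2 y, hc3 y⟩ }
  refine ⟨cs, ?_, fun e he => he⟩
  refine isManifold_of_contDiffOn _ _ _ fun e e' he he' => ?_
  have := SmoothOn.contDiffOn_comp he.2 he'.1
  simpa [Set.range_id] using this

/-! ### Rescaling to an admissible vector -/

theorem contDiff_energy {a : ℝ} (ha : 0 < a) : ContDiff ℝ ∞ (energy a) := by
  have h : (fun z : ℂ => a ^ 2 + Complex.normSq z) = fun z : ℂ => a ^ 2 + ‖z‖ ^ 2 := by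
    funext z
    rw [Complex.normSq_eq_norm_sq]
  have h1 : ContDiff ℝ ∞ fun z : ℂ => a ^ 2 + Complex.normSq z := by
    rw [h]
    exact contDiff_const.add (contDiff_norm_sq ℝ)
  exact h1.sqrt fun z => by have := Complex.normSq_nonneg z; positivity

theorem contDiff_radius {a : ℝ} (ha : 0 < a) : ContDiff ℝ ∞ (radius a) :=
  (contDiff_const.add (contDiff_energy ha)).sqrt fun z => (add_pos ha (energy_pos ha z)).ne'

theorem energy_exp_mul (a s : ℝ) (z : ℂ) :
    energy a ((Real.exp s : ℂ) * z) = √(a ^ 2 + Real.exp (2 * s) * Complex.normSq z) := by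
  rw [energy, Complex.normSq_mul, Complex.normSq_ofReal, ← Real.exp_add, two_mul]

theorem energy_exp_mul_mono (a : ℝ) (z : ℂ) :
    Monotone fun s : ℝ => energy a ((Real.exp s : ℂ) * z) := by
  intro s t hst
  simp only [energy_exp_mul]
  have := Complex.normSq_nonneg z
  gcongr

theorem energy_exp_mul_strictMono (a : ℝ) {z : ℂ} (hz : z ≠ 0) :
    StrictMono fun s : ℝ => energy a ((Real.exp s : ℂ) * z) := by
  intro s t hst
  simp only [energy_exp_mul]
  have := Complex.normSq_pos.2 hz
  refine Real.sqrt_lt_sqrt (by positivity) ?_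
  gcongr

theorem hasDerivAt_energy_exp {a : ℝ} (ha : 0 < a) (z : ℂ) (s : ℝ) :
    HasDerivAt (fun s : ℝ => energy a ((Real.exp s : ℂ) * z))
      (Real.exp (2 * s) * Complex.normSq z / energy a ((Real.exp s : ℂ) * z)) s := by
  simp only [energy_exp_mul]
  have h0 : a ^ 2 + Real.exp (2 * s) * Complex.normSq z ≠ 0 := by
    have := Complex.normSq_nonneg z
    positivity
  have h1 : HasDerivAt (fun s : ℝ => a ^ 2 + Real.exp (2 * s) * Complex.normSq z)
      (Real.exp (2 * s) * (2 * 1) * Complex.normSq z) s :=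
    (((hasDerivAt_id s).const_mul 2).exp.mul_const _).const_add _
  convert h1.sqrt h0 using 1
  field_simp

theorem hasDerivAt_energy_exp_neg {a : ℝ} (ha : 0 < a) (z : ℂ) (s : ℝ) :
    HasDerivAt (fun s : ℝ => energy a ((Real.exp (-s) : ℂ) * z))
      (Real.exp (2 * -s) * Complex.normSq z / energy a ((Real.exp (-s) : ℂ) * z) * (-1)) s :=
  HasDerivAt.comp s (h₂ := fun s : ℝ => energy a ((Real.exp s : ℂ) * z))
    (hasDerivAt_energy_exp ha z (-s)) (hasDerivAt_neg s)

/-- The difference of the two sides of the energy equation after rescaling by `exp s`. -/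
noncomputable def imbalance {n : ℕ} (S : Finset (Fin n)) (α : Fin n → ℝ) (X : Fin n → ℂ) (s : ℝ) :
    ℝ :=
  ∑ i ∈ S, energy (α i) ((Real.exp s : ℂ) * X i) -
    ∑ i ∈ Sᶜ, energy (α i) ((Real.exp (-s) : ℂ) * X i)

section Imbalance

variable {n : ℕ} {S : Finset (Fin n)} {α : Fin n → ℝ}

theorem contDiff_imbalance (hα : ∀ i, 0 < α i) :
    ContDiff ℝ ∞ fun u : (Fin n → ℂ) × ℝ => imbalance S α u.1 u.2 := by
  have hX : ∀ i, ContDiff ℝ ∞ fun u : (Fin n → ℂ) × ℝ => u.1 i := fun i =>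
    (contDiff_apply ℝ ℂ i).comp contDiff_fst
  have hexp : ContDiff ℝ ∞ fun u : (Fin n → ℂ) × ℝ => (Real.exp u.2 : ℂ) :=
    Complex.ofRealCLM.contDiff.comp (Real.contDiff_exp.comp contDiff_snd)
  have hexp' : ContDiff ℝ ∞ fun u : (Fin n → ℂ) × ℝ => (Real.exp (-u.2) : ℂ) :=
    Complex.ofRealCLM.contDiff.comp (Real.contDiff_exp.comp contDiff_snd.neg)
  exact (ContDiff.sum fun i _ => (contDiff_energy (hα i)).comp (hexp.mul (hX i))).sub
    (ContDiff.sum fun i _ => (contDiff_energy (hα i)).comp (hexp'.mul (hX i)))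

/-- Rescaling enlarges the energies on `S` and shrinks those on `Sᶜ`; a nonzero entry in `S` makes
the change strict. -/
theorem imbalance_strictMono {X : Fin n → ℂ} (hX : ∃ i ∈ S, X i ≠ 0) :
    StrictMono (imbalance S α X) := by
  intro s t hst
  obtain ⟨i, hi, hXi⟩ := hX
  have h1 := Finset.sum_lt_sum (s := S) (fun j _ => energy_exp_mul_mono (α j) (X j) hst.le)
    ⟨i, hi, energy_exp_mul_strictMono _ hXi hst⟩
  have h2 := Finset.sum_le_sum fun j (_ : j ∈ Sᶜ) =>
    energy_exp_mul_mono (α j) (X j) (neg_le_neg hst.le)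
  exact (sub_le_sub_left h2 _).trans_lt (sub_lt_sub_right h1 _)

theorem energyDeriv_nonneg {a : ℝ} (ha : 0 < a) (z : ℂ) (s : ℝ) :
    0 ≤ Real.exp (2 * s) * Complex.normSq z / energy a ((Real.exp s : ℂ) * z) :=
  div_nonneg (mul_nonneg (Real.exp_pos _).le (Complex.normSq_nonneg z)) (energy_pos ha _).le

theorem energyDeriv_pos {a : ℝ} (ha : 0 < a) {z : ℂ} (hz : z ≠ 0) (s : ℝ) :
    0 < Real.exp (2 * s) * Complex.normSq z / energy a ((Real.exp s : ℂ) * z) :=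
  div_pos (mul_pos (Real.exp_pos _) (Complex.normSq_pos.2 hz)) (energy_pos ha _)

theorem hasDerivAt_imbalance (hα : ∀ i, 0 < α i) (X : Fin n → ℂ) (s : ℝ) :
    HasDerivAt (imbalance S α X)
      (∑ i ∈ S, Real.exp (2 * s) * Complex.normSq (X i) / energy (α i) ((Real.exp s : ℂ) * X i) -
        ∑ i ∈ Sᶜ, Real.exp (2 * -s) * Complex.normSq (X i) /
          energy (α i) ((Real.exp (-s) : ℂ) * X i) * (-1)) s := by
  have h3 := HasDerivAt.fun_sum (u := S) fun i _ => hasDerivAt_energy_exp (hα i) (X i) s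
  have h4 := HasDerivAt.fun_sum (u := Sᶜ) fun i _ => hasDerivAt_energy_exp_neg (hα i) (X i) s
  exact h3.fun_sub h4

theorem exists_hasDerivAt_imbalance (hα : ∀ i, 0 < α i) {X : Fin n → ℂ} (hX : ∃ i ∈ S, X i ≠ 0)
    (s : ℝ) : ∃ c : ℝ, c ≠ 0 ∧ HasDerivAt (imbalance S α X) c s := by
  refine ⟨_, ne_of_gt ?_, hasDerivAt_imbalance hα X s⟩
  obtain ⟨i, hi, hXi⟩ := hX
  have h1 := Finset.sum_pos' (fun j (_ : j ∈ S) => energyDeriv_nonneg (hα j) (X j) s)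
    ⟨i, hi, energyDeriv_pos (hα i) hXi s⟩
  have h2 := Finset.sum_nonneg fun j (_ : j ∈ Sᶜ) => energyDeriv_nonneg (hα j) (X j) (-s)
  rw [← Finset.sum_mul]
  linarith

/-- As `s → -∞` the energies on `S` tend to the `α_i`, whose sum is below that of the `α_i` on `Sᶜ`
by shortness. For large positive `s` a nonzero entry in `S` dominates. -/
theorem exists_imbalance_eq_zero (hα : ∀ i, 0 < α i) (hS : IsShort α S) {X : Fin n → ℂ}
    (hX : ∃ i ∈ S, X i ≠ 0) : ∃ s, imbalance S α X s = 0 := by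
  have hcont : Continuous (imbalance S α X) :=
    continuous_iff_continuousAt.2 fun s => (hasDerivAt_imbalance hα X s).continuousAt
  obtain ⟨s₀, hs₀⟩ : ∃ s, imbalance S α X s ≤ 0 := by
    have hlim : Filter.Tendsto (fun s : ℝ => ∑ i ∈ S, energy (α i) ((Real.exp s : ℂ) * X i))
        Filter.atBot (𝓝 (∑ i ∈ S, α i)) := by
      refine tendsto_finsetSum _ fun i _ => ?_
      have h0 : Filter.Tendsto (fun s : ℝ => (Real.exp s : ℂ) * X i) Filter.atBot (𝓝 0) := by
        have := (Complex.continuous_ofReal.tendsto 0).comp Real.tendsto_exp_atBot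
        simpa using this.mul_const (X i)
      have := ((contDiff_energy (hα i)).continuous.tendsto 0).comp h0
      rwa [energy_zero (hα i)] at this
    have hlt : ∑ i ∈ S, α i < ∑ i ∈ Sᶜ, α i := by
      rw [IsShort, epsilon] at hS
      linarith
    obtain ⟨s, hs⟩ := (hlim.eventually (gt_mem_nhds hlt)).exists
    refine ⟨s, ?_⟩
    have : ∑ i ∈ Sᶜ, α i ≤ ∑ i ∈ Sᶜ, energy (α i) ((Real.exp (-s) : ℂ) * X i) :=
      Finset.sum_le_sum fun i _ => le_energy _ _
    rw [imbalance]
    linarith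
  obtain ⟨s₁, hs₁⟩ : ∃ s, 0 ≤ imbalance S α X s := by
    obtain ⟨i, hi, hXi⟩ := hX
    have hXi' := norm_pos_iff.2 hXi
    set C := ∑ i ∈ Sᶜ, energy (α i) (X i) with hC
    have hC0 : 0 ≤ C := Finset.sum_nonneg fun j _ => (energy_pos (hα j) _).le
    have hs0 : 0 ≤ C / ‖X i‖ := by positivity
    -- For `s ≥ 0` the sum over `Sᶜ` is at most its value `C` at `s = 0`, and `exp s ≥ s` makes the
    -- single entry `X_i` contribute at least `s * ‖X i‖ = C`.
    refine ⟨C / ‖X i‖, ?_⟩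
    set s := C / ‖X i‖ with hs
    have h1 : ∑ j ∈ Sᶜ, energy (α j) ((Real.exp (-s) : ℂ) * X j) ≤ C := by
      refine Finset.sum_le_sum fun j _ => ?_
      have := energy_exp_mul_mono (α j) (X j) (neg_nonpos.2 hs0)
      simpa using this
    have h2 : C ≤ energy (α i) ((Real.exp s : ℂ) * X i) := by
      refine Real.le_sqrt_of_sq_le ?_
      have h3 : C ≤ ‖(Real.exp s : ℂ) * X i‖ := by
        rw [norm_mul, Complex.norm_real, Real.norm_eq_abs, Real.abs_exp]
        have := Real.add_one_le_exp s
        calc C = s * ‖X i‖ := by rw [hs]; field_simp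
          _ ≤ Real.exp s * ‖X i‖ := by gcongr; linarith
      rw [Complex.normSq_eq_norm_sq]
      nlinarith [sq_nonneg (α i)]
    have h3 : energy (α i) ((Real.exp s : ℂ) * X i) ≤
        ∑ j ∈ S, energy (α j) ((Real.exp s : ℂ) * X j) :=
      Finset.single_le_sum (f := fun j => energy (α j) ((Real.exp s : ℂ) * X j))
        (fun j _ => (energy_pos (hα j) _).le) hi
    rw [imbalance]
    linarith
  exact mem_range_of_exists_le_of_exists_ge hcont ⟨s₀, hs₀⟩ ⟨s₁, hs₁⟩

open Classical in
/-- The logarithm of the positive factor that makes a vector satisfy the energy equation. -/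
noncomputable def logScale (S : Finset (Fin n)) (α : Fin n → ℝ) (X : Fin n → ℂ) : ℝ :=
  if h : ∃ s, imbalance S α X s = 0 then h.choose else 0

theorem imbalance_logScale (hα : ∀ i, 0 < α i) (hS : IsShort α S) {X : Fin n → ℂ}
    (hX : ∃ i ∈ S, X i ≠ 0) : imbalance S α X (logScale S α X) = 0 := by
  have h := exists_imbalance_eq_zero hα hS hX
  rw [logScale, dif_pos h]
  exact h.choose_spec

theorem eq_logScale (hα : ∀ i, 0 < α i) (hS : IsShort α S) {X : Fin n → ℂ}
    (hX : ∃ i ∈ S, X i ≠ 0) {s : ℝ} (hs : imbalance S α X s = 0) : s = logScale S α X :=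
  (imbalance_strictMono hX).injective (hs.trans (imbalance_logScale hα hS hX).symm)

theorem isOpen_exists_ne_zero (S : Finset (Fin n)) : IsOpen {X : Fin n → ℂ | ∃ i ∈ S, X i ≠ 0} := by
  have : {X : Fin n → ℂ | ∃ i ∈ S, X i ≠ 0} = ⋃ i ∈ S, {X | X i ≠ 0} := by
    ext X; simp
  rw [this]
  exact isOpen_biUnion fun i _ => isOpen_ne_fun (continuous_apply i) continuous_const

/-- The derivative of the imbalance in `s` is nonzero, so the implicit function theorem gives a
smooth local solution. It agrees with `logScale` because the solution is unique. -/
theorem contDiffAt_logScale (hα : ∀ i, 0 < α i) (hS : IsShort α S) {X : Fin n → ℂ}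
    (hX : ∃ i ∈ S, X i ≠ 0) : ContDiffAt ℝ ∞ (logScale S α) X := by
  set u : (Fin n → ℂ) × ℝ := (X, logScale S α X) with hu
  set f : (Fin n → ℂ) × ℝ → ℝ := fun u => imbalance S α u.1 u.2 with hf
  have hfu : f u = 0 := imbalance_logScale hα hS hX
  have cdf : ContDiffAt ℝ ∞ f u := (contDiff_imbalance hα).contDiffAt
  have pn : (∞ : WithTop ℕ∞) ≠ 0 := by simp
  obtain ⟨c, hc, hder⟩ := exists_hasDerivAt_imbalance hα hX (logScale S α X)
  have hinv : (fderiv ℝ f u ∘L .inr ℝ (Fin n → ℂ) ℝ).IsInvertible := by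
    refine ⟨ContinuousLinearEquiv.unitsEquivAut ℝ (Units.mk0 c hc), ?_⟩
    have h1 : HasFDerivAt f (fderiv ℝ f u) u := (cdf.differentiableAt pn).hasFDerivAt
    have h2 : HasDerivAt (imbalance S α X)
        ((fderiv ℝ f u ∘L .inr ℝ (Fin n → ℂ) ℝ) 1) (logScale S α X) := by
      have h3 : HasFDerivAt (fun s : ℝ => (X, s)) (.inr ℝ (Fin n → ℂ) ℝ) (logScale S α X) :=
        hasFDerivAt_prodMk_right _ _
      exact (h1.comp (logScale S α X) h3).hasDerivAt
    ext
    rw [h2.unique hder]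
    simp [ContinuousLinearEquiv.unitsEquivAut]
  refine (cdf.contDiffAt_implicitFunction pn hinv).congr_of_eventuallyEq ?_
  filter_upwards [cdf.eventually_apply_implicitFunction pn hinv,
    (isOpen_exists_ne_zero S).mem_nhds hX] with Y hY1 hY2
  exact (eq_logScale hα hS hY2 (hY1.trans hfu)).symm

/-- The positive multiple (in the sense of `scale`) of a vector satisfying the energy equation. -/
noncomputable def normalize (S : Finset (Fin n)) (α : Fin n → ℝ) (X : Fin n → ℂ) : Fin n → ℂ :=
  scale S (Real.exp (logScale S α X) : ℂ) X

/-- The linear part of the admissibility conditions. -/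
structure SumsVanish (S : Finset (Fin n)) (X : Fin n → ℂ) : Prop where
  sum_eq_zero : ∑ i ∈ S, X i = 0
  sum_compl_eq_zero : ∑ i ∈ Sᶜ, X i = 0

theorem SumsVanish.scale {X : Fin n → ℂ} (h : SumsVanish S X) (t : ℂ) :
    SumsVanish S (scale S t X) := by
  constructor
  · rw [← mul_zero t, ← h.1, Finset.mul_sum]
    exact Finset.sum_congr rfl fun i hi => by simp [Hyperpolygon.scale, hi]
  · rw [← mul_zero t⁻¹, ← h.2, Finset.mul_sum]
    exact Finset.sum_congr rfl fun i hi => by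
      simp [Hyperpolygon.scale, Finset.mem_compl.1 hi]

theorem Admissible.sumsVanish {X : Fin n → ℂ} (h : Admissible S α X) : SumsVanish S X :=
  ⟨h.1, h.2⟩

theorem imbalance_eq (X : Fin n → ℂ) (s : ℝ) : imbalance S α X s =
    ∑ i ∈ S, energy (α i) (scale S (Real.exp s : ℂ) X i) -
      ∑ i ∈ Sᶜ, energy (α i) (scale S (Real.exp s : ℂ) X i) := by
  rw [imbalance]
  congr 1
  · exact Finset.sum_congr rfl fun i hi => by simp [scale, hi]
  · exact Finset.sum_congr rfl fun i hi => by
      simp [scale, Finset.mem_compl.1 hi, Real.exp_neg]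

theorem admissible_normalize (hα : ∀ i, 0 < α i) (hS : IsShort α S) {X : Fin n → ℂ}
    (hX : ∃ i ∈ S, X i ≠ 0) (h : SumsVanish S X) : Admissible S α (normalize S α X) := by
  obtain ⟨h1, h2⟩ := h.scale (Real.exp (logScale S α X) : ℂ)
  refine ⟨h1, h2, ?_⟩
  have h3 := imbalance_logScale hα hS hX
  rw [imbalance_eq] at h3
  exact sub_eq_zero.1 h3

theorem normalize_of_admissible (hα : ∀ i, 0 < α i) (hS : IsShort α S) {X : Fin n → ℂ}
    (h : Admissible S α X) : normalize S α X = X := by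
  have h0 : imbalance S α X 0 = 0 := by
    rw [imbalance_eq, Real.exp_zero, Complex.ofReal_one, scale_one, h.sum_energy, sub_self]
  rw [normalize, ← eq_logScale hα hS (h.exists_ne_zero hα hS) h0, Real.exp_zero,
    Complex.ofReal_one, scale_one]

theorem exists_ne_zero_scale {X : Fin n → ℂ} (hX : ∃ i ∈ S, X i ≠ 0) {t : ℂ} (ht : t ≠ 0) :
    ∃ i ∈ S, scale S t X i ≠ 0 := by
  obtain ⟨i, hi, hXi⟩ := hX
  exact ⟨i, hi, by simp [scale, hi, ht, hXi]⟩

/-- The modulus of `t` is absorbed by the choice of the positive factor, so only the phase `t / ‖t‖`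
survives. -/
theorem normalize_scale (hα : ∀ i, 0 < α i) (hS : IsShort α S) {X : Fin n → ℂ}
    (hX : ∃ i ∈ S, X i ≠ 0) {t : ℂ} (ht : t ≠ 0) :
    ∃ e : Circle, normalize S α (scale S t X) = scale S e (normalize S α X) := by
  have htn : (‖t‖ : ℂ) ≠ 0 := Complex.ofReal_ne_zero.2 (norm_ne_zero_iff.2 ht)
  have hexp : ((Real.exp (logScale S α X - Real.log ‖t‖) : ℝ) : ℂ) =
      (Real.exp (logScale S α X) : ℂ) / ‖t‖ := by
    rw [Real.exp_sub, Real.exp_log (norm_pos_iff.2 ht), Complex.ofReal_div]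
  have hnorm : ‖t / (‖t‖ : ℂ)‖ = 1 := by
    rw [norm_div, Complex.norm_real, norm_norm, div_self (norm_ne_zero_iff.2 ht)]
  have hsc : scale S (Real.exp (logScale S α X - Real.log ‖t‖) : ℂ) (scale S t X) =
      scale S (t / (‖t‖ : ℂ)) (normalize S α X) := by
    rw [normalize, scale_scale, scale_scale, hexp]
    congr 1
    ring
  have hzero : imbalance S α (scale S t X) (logScale S α X - Real.log ‖t‖) = 0 := by
    have h0 := imbalance_logScale hα hS hX
    rw [imbalance_eq] at h0 ⊢
    rw [hsc, ← h0]
    have hn : ∀ i, energy (α i) (scale S (t / (‖t‖ : ℂ)) (normalize S α X) i) =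
        energy (α i) (scale S (Real.exp (logScale S α X) : ℂ) X i) := by
      intro i
      refine energy_congr _ ?_
      rw [scale]
      split_ifs
      · rw [norm_mul, hnorm, one_mul, normalize]
      · rw [norm_mul, norm_inv, hnorm, inv_one, one_mul, normalize]
    simp only [hn]
  refine ⟨⟨t / (‖t‖ : ℂ), mem_sphere_zero_iff_norm.2 hnorm⟩, ?_⟩
  rw [normalize, ← eq_logScale hα hS (exists_ne_zero_scale hX ht) hzero, hsc]

/-! ### The parametrization of the strata -/

/-- The point of the level set with parameter `X`. -/
noncomputable def param (S : Finset (Fin n)) (α : Fin n → ℝ) (X : Fin n → ℂ) : Cotangent n :=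
  normalForm S α (normalize S α X)

theorem contDiff_normalForm (hα : ∀ i, 0 < α i) : ContDiff ℝ ∞ (normalForm S α) := by
  have hr : ∀ i, ContDiff ℝ ∞ fun X : Fin n → ℂ => radius (α i) (X i) := fun i =>
    (contDiff_radius (hα i)).comp (contDiff_apply ℝ ℂ i)
  have hrc : ∀ i, ContDiff ℝ ∞ fun X : Fin n → ℂ => (radius (α i) (X i) : ℂ) := fun i =>
    Complex.ofRealCLM.contDiff.comp (hr i)
  have hd : ∀ i, ContDiff ℝ ∞ fun X : Fin n → ℂ => X i / (radius (α i) (X i) : ℂ) := fun i => by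
    have : ContDiff ℝ ∞ fun X : Fin n → ℂ => (radius (α i) (X i))⁻¹ • X i :=
      ((hr i).inv fun X => (radius_pos (hα i) _).ne').smul (contDiff_apply ℝ ℂ i)
    convert this using 2 with X
    rw [Complex.real_smul, Complex.ofReal_inv, div_eq_inv_mul]
  refine ContDiff.prodMk (contDiff_pi.2 fun i => contDiff_pi.2 fun k => ?_)
    (contDiff_pi.2 fun i => contDiff_pi.2 fun k => ?_)
  · by_cases hi : i ∈ S <;> fin_cases k <;> simp only [hi, if_true, if_false, Fin.zero_eta,
      Fin.mk_one, Matrix.cons_val_zero, Matrix.cons_val_one]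
    exacts [contDiff_const, hd i, hd i, contDiff_const]
  · by_cases hi : i ∈ S <;> fin_cases k <;> simp only [hi, if_true, if_false, Fin.zero_eta,
      Fin.mk_one, Matrix.cons_val_zero, Matrix.cons_val_one]
    exacts [hrc i, contDiff_const, contDiff_const, hrc i]

theorem contDiffAt_param (hα : ∀ i, 0 < α i) (hS : IsShort α S) {X : Fin n → ℂ}
    (hX : ∃ i ∈ S, X i ≠ 0) : ContDiffAt ℝ ∞ (param S α) X := by
  refine (contDiff_normalForm hα).contDiffAt.comp X ?_
  have hl := contDiffAt_logScale hα hS hX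
  have h1 : ContDiffAt ℝ ∞ (fun X => (Real.exp (logScale S α X) : ℂ)) X :=
    Complex.ofRealCLM.contDiff.contDiffAt.comp X (Real.contDiff_exp.contDiffAt.comp X hl)
  have h2 : ContDiffAt ℝ ∞ (fun X => ((Real.exp (logScale S α X) : ℂ))⁻¹) X :=
    h1.inv (Complex.ofReal_ne_zero.2 (Real.exp_pos _).ne')
  refine contDiffAt_pi.2 fun i => ?_
  have h3 : ContDiffAt ℝ ∞ (fun X : Fin n → ℂ => X i) X := (contDiff_apply ℝ ℂ i).contDiffAt
  by_cases hi : i ∈ S <;> simp only [normalize, scale, hi, if_true, if_false]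
  exacts [h1.mul h3, h2.mul h3]

theorem param_mem_level (hα : ∀ i, 0 < α i) (hS : IsShort α S) {X : Fin n → ℂ}
    (hX : ∃ i ∈ S, X i ≠ 0) (h : SumsVanish S X) : param S α X ∈ level α :=
  (normalForm_mem_level_iff hα).2 (admissible_normalize hα hS hX h)

theorem param_mem_overSet (hα : ∀ i, 0 < α i) (hS : IsShort α S) {X : Fin n → ℂ}
    (hX : ∃ i ∈ S, X i ≠ 0) (h : SumsVanish S X) : param S α X ∈ overSet (Z α S) :=
  ⟨param_mem_level hα hS hX h, mk_mem_Z_iff.2 (isStraight_normalForm S hα _)⟩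

/-- The surviving phase is realized by an element of `K`, so the parametrization descends to the
quotient by `ℂ^*`. -/
theorem mk_param_scale (hα : ∀ i, 0 < α i) (hS : IsShort α S) {X : Fin n → ℂ}
    (hX : ∃ i ∈ S, X i ≠ 0) (h : SumsVanish S X) {t : ℂ} (ht : t ≠ 0) :
    mk α ⟨param S α (scale S t X),
      param_mem_level hα hS (exists_ne_zero_scale hX ht) (h.scale t)⟩ =
    mk α ⟨param S α X, param_mem_level hα hS hX h⟩ := by
  obtain ⟨e, he⟩ := normalize_scale hα hS hX ht
  obtain ⟨g, hg⟩ := exists_act_normalForm_scale S α (normalize S α X) e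
  refine (mk_eq_mk.2 ⟨g, ?_⟩).symm
  rw [← he] at hg
  exact hg

theorem mem_Z_iff_exists_param (hα : ∀ i, 0 < α i) (hS : S ∈ shortSets' α) {z : X α} :
    z ∈ Z α S ↔ ∃ (X : Fin n → ℂ) (hX : ∃ i ∈ S, X i ≠ 0) (h : SumsVanish S X),
      Admissible S α X ∧ z = mk α ⟨param S α X, param_mem_level hα hS.1 hX h⟩ := by
  rw [mem_Z_iff_exists_normalForm hα (nonempty_of_mem_shortSets' hS)]
  constructor
  · rintro ⟨X, hX, rfl⟩
    refine ⟨X, hX.exists_ne_zero hα hS.1, hX.sumsVanish, hX, ?_⟩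
    congr 2
    rw [param, normalize_of_admissible hα hS.1 hX]
  · rintro ⟨X, hX, h, hadm, rfl⟩
    refine ⟨X, hadm, ?_⟩
    congr 2
    rw [param, normalize_of_admissible hα hS.1 hadm]

end Imbalance

/-! ### Invariant functions -/

/-- The trace of `q_i p_i q_j p_j`. -/
noncomputable def pairing {n : ℕ} (x : Cotangent n) (i j : Fin n) : ℂ :=
  (Matrix.vecMulVec (x.2 i) (x.1 i) * Matrix.vecMulVec (x.2 j) (x.1 j)).trace

/-- The Hermitian product of `q_i p_i` and `q_j p_j`. -/
noncomputable def hermPairing {n : ℕ} (x : Cotangent n) (i j : Fin n) : ℂ :=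
  (Matrix.vecMulVec (x.2 i) (x.1 i) * star (Matrix.vecMulVec (x.2 j) (x.1 j))).trace

section Invariants

variable {n : ℕ} {S : Finset (Fin n)} {α : Fin n → ℝ}

theorem pairing_act (x : Cotangent n) (g : KTilde n) (i j : Fin n) :
    pairing (act x g) i j = pairing x i j := by
  have h := mul_star_self_specialUnitary g.1
  rw [pairing, pairing, vecMulVec_act, vecMulVec_act]
  set A : Matrix (Fin 2) (Fin 2) ℂ := g.1.1
  set P := Matrix.vecMulVec (x.2 i) (x.1 i)
  set Q := Matrix.vecMulVec (x.2 j) (x.1 j)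
  calc (star A * P * A * (star A * Q * A)).trace = (star A * (P * (A * star A) * Q) * A).trace := by
        simp only [mul_assoc]
    _ = (P * Q).trace := by
        rw [h, mul_one, Matrix.trace_mul_comm, ← mul_assoc, h, one_mul]

theorem hermPairing_act (x : Cotangent n) (g : KTilde n) (i j : Fin n) :
    hermPairing (act x g) i j = hermPairing x i j := by
  have h := mul_star_self_specialUnitary g.1
  rw [hermPairing, hermPairing, vecMulVec_act, vecMulVec_act]
  set A : Matrix (Fin 2) (Fin 2) ℂ := g.1.1
  set P := Matrix.vecMulVec (x.2 i) (x.1 i)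
  set Q := Matrix.vecMulVec (x.2 j) (x.1 j)
  calc (star A * P * A * star (star A * Q * A)).trace =
        (star A * (P * (A * star A) * star Q) * A).trace := by
        simp only [star_mul, star_star, mul_assoc]
    _ = (P * star Q).trace := by
        rw [h, mul_one, Matrix.trace_mul_comm, ← mul_assoc, h, one_mul]

theorem contDiff_fst_apply (i : Fin n) (k : Fin 2) : ContDiff ℝ ∞ fun x : Cotangent n => x.1 i k :=
  (contDiff_apply ℝ ℂ k).comp ((contDiff_apply ℝ (Fin 2 → ℂ) i).comp contDiff_fst)

theorem contDiff_snd_apply (i : Fin n) (k : Fin 2) : ContDiff ℝ ∞ fun x : Cotangent n => x.2 i k :=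
  (contDiff_apply ℝ ℂ k).comp ((contDiff_apply ℝ (Fin 2 → ℂ) i).comp contDiff_snd)

theorem contDiff_pairing (i j : Fin n) : ContDiff ℝ ∞ fun x : Cotangent n => pairing x i j := by
  simp only [pairing, Matrix.trace, Matrix.diag, Matrix.mul_apply, Matrix.vecMulVec_apply]
  exact ContDiff.sum fun k _ => ContDiff.sum fun l _ =>
    ((contDiff_snd_apply i _).mul (contDiff_fst_apply i _)).mul
      ((contDiff_snd_apply j _).mul (contDiff_fst_apply j _))

theorem contDiff_hermPairing (i j : Fin n) :
    ContDiff ℝ ∞ fun x : Cotangent n => hermPairing x i j := by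
  simp only [hermPairing, Matrix.trace, Matrix.diag, Matrix.mul_apply, Matrix.vecMulVec_apply,
    Matrix.star_apply]
  exact ContDiff.sum fun k _ => ContDiff.sum fun l _ =>
    ((contDiff_snd_apply i _).mul (contDiff_fst_apply i _)).mul
      (Complex.conjCLE.contDiff.comp ((contDiff_snd_apply j _).mul (contDiff_fst_apply j _)))

theorem pairing_normalForm (hα : ∀ i, 0 < α i) (X : Fin n → ℂ) {i j : Fin n} (hi : i ∉ S)
    (hj : j ∈ S) : pairing (normalForm S α X) i j = X i * X j := by
  have h1 := radius_ne_zero (hα i) (X i)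
  have h2 := radius_ne_zero (hα j) (X j)
  simp [pairing, normalForm, hi, hj, Matrix.trace, Fin.sum_univ_two, Matrix.mul_apply]
  field_simp

theorem hermPairing_normalForm (hα : ∀ i, 0 < α i) (X : Fin n → ℂ) {i j : Fin n} (hi : i ∈ S)
    (hj : j ∈ S) : hermPairing (normalForm S α X) i j = X i * conj (X j) := by
  have h1 := radius_ne_zero (hα i) (X i)
  have h2 := radius_ne_zero (hα j) (X j)
  simp [hermPairing, normalForm, hi, hj, Matrix.trace, Fin.sum_univ_two, Matrix.mul_apply,
    Matrix.star_apply]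
  field_simp

/-- The coordinates of a parameter normalized by `X_i = 1`, as a function on the level set. -/
noncomputable def coordMap (S : Finset (Fin n)) (i : Fin n) (x : Cotangent n) : Fin n → ℂ :=
  fun l => if l ∈ S then hermPairing x l i * (hermPairing x i i)⁻¹ else pairing x l i

theorem coordMap_act (i : Fin n) (x : Cotangent n) (g : KTilde n) :
    coordMap S i (act x g) = coordMap S i x := by
  funext l
  simp only [coordMap, hermPairing_act, pairing_act]

theorem contDiffAt_coordMap {i : Fin n} {x : Cotangent n} (hx : hermPairing x i i ≠ 0) :
    ContDiffAt ℝ ∞ (coordMap S i) x := by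
  refine contDiffAt_pi.2 fun l => ?_
  by_cases hl : l ∈ S <;> simp only [coordMap, hl, if_true, if_false]
  · exact (contDiff_hermPairing l i).contDiffAt.mul ((contDiff_hermPairing i i).contDiffAt.inv hx)
  · exact (contDiff_pairing l i).contDiffAt

/-- For `l ∈ S` the quotient of Hermitian pairings is `X_l / X_i`, and for `l ∉ S` the trace pairing
is `X_l X_i`. These are exactly the combinations invariant under the weights `1` and `-1`, namely
the entries of the representative with `X_i = 1`. -/
theorem coordMap_normalForm (hα : ∀ i, 0 < α i) {X : Fin n → ℂ} {i : Fin n} (hi : i ∈ S)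
    (hXi : X i ≠ 0) : coordMap S i (normalForm S α X) = scale S (X i)⁻¹ X := by
  funext l
  have hc : conj (X i) ≠ 0 := (map_ne_zero _).2 hXi
  by_cases hl : l ∈ S
  · simp only [coordMap, hl, if_true, hermPairing_normalForm hα X hl hi,
      hermPairing_normalForm hα X hi hi, scale]
    field_simp
  · simp only [coordMap, hl, if_false, pairing_normalForm hα X hl hi, scale, inv_inv]
    ring

theorem coordMap_param (hα : ∀ i, 0 < α i) {X : Fin n → ℂ} {i : Fin n} (hi : i ∈ S)
    (hXi : X i ≠ 0) : coordMap S i (param S α X) = scale S (X i)⁻¹ X := by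
  have he : (Real.exp (logScale S α X) : ℂ) ≠ 0 :=
    Complex.ofReal_ne_zero.2 (Real.exp_pos _).ne'
  have hi' : normalize S α X i = Real.exp (logScale S α X) * X i := by
    simp [normalize, scale, hi]
  rw [param, coordMap_normalForm hα hi (by rw [hi']; exact mul_ne_zero he hXi), hi', normalize,
    scale_scale]
  congr 1
  field_simp

theorem hermPairing_param_self_ne_zero (hα : ∀ i, 0 < α i) {X : Fin n → ℂ} {i : Fin n}
    (hi : i ∈ S) : hermPairing (param S α X) i i ≠ 0 ↔ X i ≠ 0 := by
  have he : (Real.exp (logScale S α X) : ℂ) ≠ 0 :=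
    Complex.ofReal_ne_zero.2 (Real.exp_pos _).ne'
  have hi' : normalize S α X i = Real.exp (logScale S α X) * X i := by
    simp [normalize, scale, hi]
  rw [param, hermPairing_normalForm hα _ hi hi, hi', not_iff_not]
  simp only [mul_eq_zero, map_eq_zero, he, false_or, or_self]

/-! ### Solving the linear conditions -/

/-- Replace the entries at `s` and `j` so that the sums over `S` and its complement vanish. -/
noncomputable def complete (S : Finset (Fin n)) (s j : Fin n) (Y : Fin n → ℂ) : Fin n → ℂ :=
  fun l => if l = s then -∑ k ∈ S.erase s, Y k else if l = j then -∑ k ∈ Sᶜ.erase j, Y k else Y l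

theorem complete_apply {s j l : Fin n} (hs : l ≠ s) (hj : l ≠ j) (Y : Fin n → ℂ) :
    complete S s j Y l = Y l := by
  simp [complete, hs, hj]

theorem sumsVanish_complete {s j : Fin n} (hs : s ∈ S) (hj : j ∈ Sᶜ) (Y : Fin n → ℂ) :
    SumsVanish S (complete S s j Y) := by
  have hjS := Finset.mem_compl.1 hj
  have hjs : j ≠ s := fun h => hjS (h ▸ hs)
  constructor
  · rw [← Finset.add_sum_erase _ _ hs]
    have h1 : complete S s j Y s = -∑ k ∈ S.erase s, Y k := by simp [complete]
    have h2 : ∑ k ∈ S.erase s, complete S s j Y k = ∑ k ∈ S.erase s, Y k :=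
      Finset.sum_congr rfl fun k hk => complete_apply (Finset.ne_of_mem_erase hk)
        (ne_of_mem_of_not_mem (Finset.mem_of_mem_erase hk) hjS) Y
    rw [h1, h2, neg_add_cancel]
  · rw [← Finset.add_sum_erase _ _ hj]
    have h1 : complete S s j Y j = -∑ k ∈ Sᶜ.erase j, Y k := by simp [complete, hjs]
    have h2 : ∑ k ∈ Sᶜ.erase j, complete S s j Y k = ∑ k ∈ Sᶜ.erase j, Y k :=
      Finset.sum_congr rfl fun k hk => complete_apply
        (ne_of_mem_of_not_mem hs (Finset.mem_compl.1 (Finset.mem_of_mem_erase hk))).symm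
        (Finset.ne_of_mem_erase hk) Y
    rw [h1, h2, neg_add_cancel]

theorem complete_eq_self {s j : Fin n} (hs : s ∈ S) (hj : j ∈ Sᶜ) {X Y : Fin n → ℂ}
    (hX : SumsVanish S X) (hXY : ∀ l, l ≠ s → l ≠ j → Y l = X l) : complete S s j Y = X := by
  have hjS := Finset.mem_compl.1 hj
  have hjs : j ≠ s := fun h => hjS (h ▸ hs)
  funext l
  rcases eq_or_ne l s with rfl | hls
  · have h2 : ∑ k ∈ S.erase l, Y k = ∑ k ∈ S.erase l, X k :=
      Finset.sum_congr rfl fun k hk => hXY k (Finset.ne_of_mem_erase hk)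
        (ne_of_mem_of_not_mem (Finset.mem_of_mem_erase hk) hjS)
    have h1 := hX.sum_eq_zero
    rw [← Finset.add_sum_erase _ _ hs] at h1
    simp only [complete, if_true, h2]
    exact (eq_neg_of_add_eq_zero_left h1).symm
  rcases eq_or_ne l j with rfl | hlj
  · have h2 : ∑ k ∈ Sᶜ.erase l, Y k = ∑ k ∈ Sᶜ.erase l, X k :=
      Finset.sum_congr rfl fun k hk => hXY k
        (ne_of_mem_of_not_mem hs (Finset.mem_compl.1 (Finset.mem_of_mem_erase hk))).symm
        (Finset.ne_of_mem_erase hk)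
    have h1 := hX.sum_compl_eq_zero
    rw [← Finset.add_sum_erase _ _ hj] at h1
    simp only [complete, hls, if_true, if_false, h2]
    exact (eq_neg_of_add_eq_zero_left h1).symm
  · rw [complete_apply hls hlj, hXY l hls hlj]

theorem contDiff_complete (s j : Fin n) : ContDiff ℝ ∞ (complete S s j) := by
  refine contDiff_pi.2 fun l => ?_
  by_cases hs : l = s
  · simp only [complete, hs, if_true]
    exact (ContDiff.sum fun k _ => contDiff_apply ℝ ℂ k).neg
  by_cases hj : l = j
  · simp only [complete, hj, if_true]
    split_ifs
    · exact (ContDiff.sum fun k _ => contDiff_apply ℝ ℂ k).neg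
    · exact (ContDiff.sum fun k _ => contDiff_apply ℝ ℂ k).neg
  · simp only [complete, hs, hj, if_false]
    exact contDiff_apply ℝ ℂ l

/-- A vanishing sum cannot have exactly one nonzero term. Hence the dependent index `s` can be fixed
once for all charts, with the normalized index chosen different from it. -/
theorem SumsVanish.exists_ne_zero {X : Fin n → ℂ} (h : SumsVanish S X) (hX : ∃ i ∈ S, X i ≠ 0)
    (s : Fin n) : ∃ i ∈ S, i ≠ s ∧ X i ≠ 0 := by
  by_contra! h0
  obtain ⟨i, hi, hXi⟩ := hX
  have his : i = s := by
    by_contra his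
    exact hXi (h0 i hi his)
  subst his
  refine hXi ?_
  have := h.sum_eq_zero
  rwa [Finset.sum_eq_single_of_mem i hi fun k hk hki => h0 k hk hki] at this

/-! ### The charts -/

/-- The indices of the free coordinates in the chart `X_i = 1`. -/
abbrev ChartIndex (s j i : Fin n) : Type := {l : Fin n // l ≠ s ∧ l ≠ j ∧ l ≠ i}

theorem card_chartIndex {s j i : Fin n} (hsj : s ≠ j) (hsi : s ≠ i) (hji : j ≠ i) :
    Fintype.card (ChartIndex s j i) = n - 3 := by
  have h : (Finset.univ.filter fun l : Fin n => l ≠ s ∧ l ≠ j ∧ l ≠ i) = ({s, j, i} : Finset _)ᶜ := by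
    ext l
    simp
  rw [Fintype.card_subtype, h, Finset.card_compl, Fintype.card_fin, Finset.card_eq_three.2
    ⟨s, j, i, hsj, hsi, hji, rfl⟩]

/-- The parameter with `X_i = 1` and given free coordinates. -/
noncomputable def chartParam (S : Finset (Fin n)) (s j i : Fin n) (w : ChartIndex s j i → ℂ) :
    Fin n → ℂ :=
  complete S s j fun l => if h : l ≠ s ∧ l ≠ j ∧ l ≠ i then w ⟨l, h⟩ else 1

theorem contDiff_chartParam (s j i : Fin n) : ContDiff ℝ ∞ (chartParam S s j i) := by
  refine (contDiff_complete s j).comp (contDiff_pi.2 fun l => ?_)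
  by_cases h : l ≠ s ∧ l ≠ j ∧ l ≠ i
  · simp only [h, dif_pos, ne_eq, not_false_eq_true, and_self]
    exact contDiff_apply ℝ ℂ _
  · simp only [h, dif_neg, not_false_eq_true]
    exact contDiff_const

theorem chartParam_self {s j i : Fin n} (hsi : i ≠ s) (hji : i ≠ j) (w : ChartIndex s j i → ℂ) :
    chartParam S s j i w i = 1 := by
  rw [chartParam, complete_apply hsi hji]
  simp

theorem chartParam_coe {s j i : Fin n} (w : ChartIndex s j i → ℂ) (l : ChartIndex s j i) :
    chartParam S s j i w l = w l := by
  rw [chartParam, complete_apply l.2.1 l.2.2.1, dif_pos l.2]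

theorem chartParam_restrict {s j i : Fin n} (hs : s ∈ S) (hj : j ∈ Sᶜ) {X : Fin n → ℂ}
    (hX : SumsVanish S X) (hXi : X i = 1) :
    chartParam S s j i (fun l => X l) = X := by
  refine complete_eq_self hs hj hX fun l hls hlj => ?_
  by_cases hli : l = i
  · subst hli
    simp [hXi]
  · simp [hls, hlj, hli]

/-- A representative of a point of `X(α)`. -/
noncomputable def rep (z : X α) : Cotangent n := (Function.surjInv (mk_surjective α) z).1

/-- Invariant functions do not see the arbitrary choice made by `rep`; this allows charts on the
quotient to be written with representatives. -/
theorem apply_rep_mk {E : Type*} {f : Cotangent n → E} (hf : ∀ x g, f (act x g) = f x)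
    (x : level α) : f (rep (mk α x)) = f x.1 := by
  obtain ⟨g, hg⟩ := mk_eq_mk.1 (Function.surjInv_eq (mk_surjective α) (mk α x)).symm
  rw [rep, ← hg, hf]

theorem mk_param_congr {X Y : Fin n → ℂ} (h : X = Y) (hX : param S α X ∈ level α)
    (hY : param S α Y ∈ level α) : mk α ⟨param S α X, hX⟩ = mk α ⟨param S α Y, hY⟩ := by
  subst h; rfl

/-- The hypotheses under which the chart `X_i = 1` exists. -/
structure IsChartTriple (S : Finset (Fin n)) (s j i : Fin n) : Prop where
  left_mem : s ∈ S
  right_mem : j ∈ Sᶜ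
  mem : i ∈ S
  ne_left : i ≠ s

namespace IsChartTriple

variable {s j i : Fin n}

theorem ne_right (h : IsChartTriple S s j i) : i ≠ j := fun e =>
  Finset.mem_compl.1 h.right_mem (e ▸ h.mem)

theorem exists_ne_zero (h : IsChartTriple S s j i) (w : ChartIndex s j i → ℂ) :
    ∃ i' ∈ S, chartParam S s j i w i' ≠ 0 :=
  ⟨i, h.mem, by rw [chartParam_self h.ne_left h.ne_right]; exact one_ne_zero⟩

theorem sumsVanish (h : IsChartTriple S s j i) (w : ChartIndex s j i → ℂ) :
    SumsVanish S (chartParam S s j i w) :=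
  sumsVanish_complete h.left_mem h.right_mem _

theorem contDiff_param (h : IsChartTriple S s j i) (hα : ∀ i, 0 < α i) (hS : IsShort α S) :
    ContDiff ℝ ∞ fun w => param S α (chartParam S s j i w) :=
  contDiff_iff_contDiffAt.2 fun w => (contDiffAt_param hα hS (h.exists_ne_zero w)).comp w
    (contDiff_chartParam s j i).contDiffAt

theorem mem_level (h : IsChartTriple S s j i) (hα : ∀ i, 0 < α i) (hS : IsShort α S)
    (w : ChartIndex s j i → ℂ) : param S α (chartParam S s j i w) ∈ level α :=
  param_mem_level hα hS (h.exists_ne_zero w) (h.sumsVanish w)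

theorem mem_overSet (h : IsChartTriple S s j i) (hα : ∀ i, 0 < α i) (hS : IsShort α S)
    (w : ChartIndex s j i → ℂ) : param S α (chartParam S s j i w) ∈ overSet (Z α S) :=
  param_mem_overSet hα hS (h.exists_ne_zero w) (h.sumsVanish w)

theorem coordMap_param_chartParam (h : IsChartTriple S s j i) (hα : ∀ i, 0 < α i)
    (w : ChartIndex s j i → ℂ) :
    coordMap S i (param S α (chartParam S s j i w)) = chartParam S s j i w := by
  have h1 : chartParam S s j i w i = 1 := chartParam_self h.ne_left h.ne_right w
  rw [coordMap_param hα h.mem (by rw [h1]; exact one_ne_zero), h1, inv_one, scale_one]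

/-- A point with nonvanishing `X_i` lies in the image of the inverse of the chart. -/
theorem mk_param_coordMap (h : IsChartTriple S s j i) (hα : ∀ i, 0 < α i) (hS : IsShort α S)
    {X : Fin n → ℂ} (hX : SumsVanish S X) (hXi : X i ≠ 0) :
    Hyperpolygon.mk α ⟨_, h.mem_level hα hS fun l => coordMap S i (param S α X) l⟩ =
      Hyperpolygon.mk α ⟨param S α X, param_mem_level hα hS ⟨i, h.mem, hXi⟩ hX⟩ := by
  refine Eq.trans (mk_param_congr ?_ _ _)
    (mk_param_scale hα hS ⟨i, h.mem, hXi⟩ hX (inv_ne_zero hXi))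
  rw [coordMap_param hα h.mem hXi]
  exact chartParam_restrict h.left_mem h.right_mem (hX.scale _) (by simp [scale, h.mem, hXi])

theorem card_compl (h : IsChartTriple S s j i) : Fintype.card (ChartIndex s j i) = n - 3 :=
  card_chartIndex (fun e => Finset.mem_compl.1 h.right_mem (e ▸ h.left_mem)) h.ne_left.symm
    h.ne_right.symm

/-- Of the `n` complex entries, two are fixed by the linear conditions and one by the normalization
`X_i = 1`. -/
theorem finrank_eq (h : IsChartTriple S s j i) : Module.finrank ℝ (ChartIndex s j i → ℂ) =
    Module.finrank ℝ (EuclideanSpace ℝ (Fin (2 * (n - 3)))) := by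
  rw [finrank_euclideanSpace_fin, Module.finrank_pi_fintype]
  simp [Complex.finrank_real_complex, h.card_compl, mul_comm]

/-- The chart `X_i = 1` of the stratum of `S`. -/
noncomputable def chart (h : IsChartTriple S s j i) (hα : ∀ i, 0 < α i) (hS : S ∈ shortSets' α) :
    PartialEquiv (Z α S) (EuclideanSpace ℝ (Fin (2 * (n - 3)))) where
  toFun z := ContinuousLinearEquiv.ofFinrankEq h.finrank_eq fun l => coordMap S i (rep z.1) l
  invFun w := overProj (Z α S)
    ⟨_, h.mem_overSet hα hS.1 ((ContinuousLinearEquiv.ofFinrankEq h.finrank_eq).symm w)⟩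
  source := {z | hermPairing (rep z.1) i i ≠ 0}
  target := Set.univ
  map_source' _ _ := trivial
  map_target' w _ := by
    rw [Set.mem_ofPred_eq]
    change hermPairing (rep (Hyperpolygon.mk α _)) i i ≠ 0
    rw [apply_rep_mk (f := fun x => hermPairing x i i) fun x g => hermPairing_act x g i i]
    refine (hermPairing_param_self_ne_zero hα h.mem).2 ?_
    rw [chartParam_self h.ne_left h.ne_right]
    exact one_ne_zero
  left_inv' := by
    rintro ⟨z, hz⟩ hzi
    obtain ⟨X, hX, hsum, hadm, rfl⟩ := (mem_Z_iff_exists_param hα hS).1 hz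
    rw [Set.mem_ofPred_eq] at hzi
    rw [apply_rep_mk (f := fun x => hermPairing x i i) fun x g => hermPairing_act x g i i] at hzi
    have hXi := (hermPairing_param_self_ne_zero hα h.mem).1 hzi
    refine Subtype.ext ?_
    refine Eq.trans ?_ (h.mk_param_coordMap hα hS.1 hsum hXi)
    refine mk_param_congr ?_ _ _
    rw [ContinuousLinearEquiv.symm_apply_apply,
      apply_rep_mk (f := coordMap S i) fun x g => coordMap_act i x g]
  right_inv' := by
    intro w _
    change ContinuousLinearEquiv.ofFinrankEq h.finrank_eq
      (fun l => coordMap S i (rep (Hyperpolygon.mk α _)) l) = w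
    rw [apply_rep_mk (f := coordMap S i) fun x g => coordMap_act i x g,
      h.coordMap_param_chartParam hα]
    simp only [chartParam_coe, ContinuousLinearEquiv.apply_symm_apply]

theorem isOpen_chart_source (h : IsChartTriple S s j i) (hα : ∀ i, 0 < α i)
    (hS : S ∈ shortSets' α) : IsOpen (h.chart hα hS).source := by
  rw [← (isOpenQuotientMap_overProj (Z α S)).isQuotientMap.isOpen_preimage]
  have : overProj (Z α S) ⁻¹' (h.chart hα hS).source = {x | hermPairing x.1 i i ≠ 0} := by
    ext x
    change hermPairing (rep (Hyperpolygon.mk α _)) i i ≠ 0 ↔ _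
    rw [apply_rep_mk (f := fun x => hermPairing x i i) fun x g => hermPairing_act x g i i]
    rfl
  rw [this]
  exact isOpen_ne_fun ((contDiff_hermPairing i i).continuous.comp continuous_subtype_val)
    continuous_const

theorem smoothOn_chart (h : IsChartTriple S s j i) (hα : ∀ i, 0 < α i) (hS : S ∈ shortSets' α) :
    SmoothOn (overProj (Z α S)) (selfProj (EuclideanSpace ℝ (Fin (2 * (n - 3)))))
      (h.chart hα hS) (h.chart hα hS).source := by
  have hinv : ∀ x : overSet (Z α S), hermPairing (rep (overProj (Z α S) x).1) i i =
      hermPairing x.1 i i := fun x =>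
    apply_rep_mk (f := fun x => hermPairing x i i) (fun x g => hermPairing_act x g i i) _
  intro x hx
  refine ⟨{x | hermPairing x i i ≠ 0},
    isOpen_ne_fun (contDiff_hermPairing i i).continuous continuous_const, ?_,
    fun x => ContinuousLinearEquiv.ofFinrankEq h.finrank_eq fun l => coordMap S i x l, ?_, ?_⟩
  · rw [Set.mem_ofPred_eq, ← hinv]
    exact hx
  · intro y hy
    refine ((ContinuousLinearEquiv.ofFinrankEq h.finrank_eq).contDiff.contDiffAt.comp y
      (contDiffAt_pi.2 fun l => ?_)).contDiffWithinAt
    exact (contDiffAt_pi.1 (contDiffAt_coordMap (S := S) hy)) l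
  · intro y _ _
    refine ⟨trivial, ?_⟩
    change ContinuousLinearEquiv.ofFinrankEq h.finrank_eq (fun l => coordMap S i y.1 l) =
      ContinuousLinearEquiv.ofFinrankEq h.finrank_eq (fun l => coordMap S i (rep (Hyperpolygon.mk α _)) l)
    rw [apply_rep_mk (f := coordMap S i) fun x g => coordMap_act i x g]

theorem smoothOn_chart_symm (h : IsChartTriple S s j i) (hα : ∀ i, 0 < α i)
    (hS : S ∈ shortSets' α) :
    SmoothOn (selfProj (EuclideanSpace ℝ (Fin (2 * (n - 3))))) (overProj (Z α S))
      (h.chart hα hS).symm (h.chart hα hS).target := by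
  intro x _
  refine ⟨Set.univ, isOpen_univ, trivial, fun w => param S α (chartParam S s j i
    ((ContinuousLinearEquiv.ofFinrankEq h.finrank_eq).symm w)), ?_, ?_⟩
  · exact ((h.contDiff_param hα hS.1).comp
      (ContinuousLinearEquiv.ofFinrankEq h.finrank_eq).symm.contDiff).contDiffOn
  · intro y _ _
    exact ⟨h.mem_overSet hα hS.1 _, rfl⟩

end IsChartTriple

theorem exists_isChartTriple (hα : ∀ i, 0 < α i) (hS : S ∈ shortSets' α) :
    ∃ s j i, IsChartTriple S s j i := by
  obtain ⟨s, hs⟩ := nonempty_of_mem_shortSets' hS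
  obtain ⟨j, hj⟩ := hS.1.compl_nonempty hα
  obtain ⟨i, hi, his⟩ := Finset.exists_mem_ne hS.2 s
  exact ⟨s, j, i, hs, hj, hi, his⟩

theorem isSmoothManifold_Z (hα : ∀ i, 0 < α i) (hS : S ∈ shortSets' α) :
    IsSmoothManifold (Z α S) (2 * (n - 3)) := by
  obtain ⟨s, j, -, hs, hj, -, -⟩ := exists_isChartTriple hα hS
  refine isSmoothManifold_of_charts fun y => ?_
  obtain ⟨z, hz⟩ := y
  obtain ⟨X, hX, hsum, -, rfl⟩ := (mem_Z_iff_exists_param hα hS).1 hz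
  obtain ⟨i, hi, his, hXi⟩ := hsum.exists_ne_zero hX s
  have h : IsChartTriple S s j i := ⟨hs, hj, hi, his⟩
  refine ⟨h.chart hα hS, ?_, h.isOpen_chart_source hα hS, isOpen_univ, h.smoothOn_chart hα hS,
    h.smoothOn_chart_symm hα hS⟩
  change hermPairing (rep (mk α _)) i i ≠ 0
  rw [apply_rep_mk (f := fun x => hermPairing x i i) fun x g => hermPairing_act x g i i]
  exact (hermPairing_param_self_ne_zero hα h.mem).2 hXi

/-! ### Connectedness and non-compactness of the strata -/

/-- Each chart image is the continuous image of a vector space. All of them contain the point `P`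
whose entries on `S`, apart from `s`, equal one, so it lies in every chart `X_i = 1` with `i ≠ s`.
-/
theorem isPreconnected_Z (hα : ∀ i, 0 < α i) (hS : S ∈ shortSets' α) :
    IsPreconnected (Z α S) := by
  obtain ⟨s, j, i₀, hs, hj, hi₀, hi₀s⟩ := exists_isChartTriple hα hS
  let P : Fin n → ℂ := complete S s j 1
  have hPsum : SumsVanish S P := sumsVanish_complete hs hj _
  have hP : ∀ i ∈ S, i ≠ s → P i = 1 := fun i hi his =>
    complete_apply his (ne_of_mem_of_not_mem hi (Finset.mem_compl.1 hj)) _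
  have hP0 : ∃ i ∈ S, P i ≠ 0 := ⟨i₀, hi₀, by rw [hP i₀ hi₀ hi₀s]; exact one_ne_zero⟩
  have key : ∀ z ∈ Z α S, ∃ t ⊆ Z α S,
      mk α ⟨param S α P, param_mem_level hα hS.1 hP0 hPsum⟩ ∈ t ∧ z ∈ t ∧ IsPreconnected t := by
    intro z hz
    obtain ⟨X, hX, hsum, -, rfl⟩ := (mem_Z_iff_exists_param hα hS).1 hz
    obtain ⟨i, hi, his, hXi⟩ := hsum.exists_ne_zero hX s
    have h : IsChartTriple S s j i := ⟨hs, hj, hi, his⟩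
    refine ⟨Set.range fun w => mk α ⟨_, h.mem_level hα hS.1 w⟩, ?_, ⟨fun l => P l, ?_⟩,
      ⟨_, h.mk_param_coordMap hα hS.1 hsum hXi⟩, ?_⟩
    · rintro _ ⟨w, rfl⟩
      exact (h.mem_overSet hα hS.1 w).2
    · exact mk_param_congr (chartParam_restrict hs hj hPsum (hP i hi his)) _ _
    · exact isPreconnected_range ((continuous_mk α).comp
        ((h.contDiff_param hα hS.1).continuous.subtype_mk _))
  refine isPreconnected_of_forall _ fun z hz => key z hz

theorem nonempty_Z (hα : ∀ i, 0 < α i) (hS : S ∈ shortSets' α) : (Z α S).Nonempty := by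
  obtain ⟨s, j, i, h⟩ := exists_isChartTriple hα hS
  exact ⟨_, (h.mem_overSet hα hS.1 0).2⟩

/-- If `Sᶜ` has an element `k` besides the dependent index `j`, then `X_k` is a free coordinate. The
continuous invariant `X_k X_i` then takes every complex value on the stratum. -/
theorem not_isCompact_Z (hα : ∀ i, 0 < α i) (hS : S ∈ shortSets' α) (hcard : 2 ≤ Sᶜ.card) :
    ¬ IsCompact (Z α S) := by
  intro hc
  obtain ⟨s, j, i, h⟩ := exists_isChartTriple hα hS
  obtain ⟨k, hk, hkj⟩ := Finset.exists_mem_ne hcard j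
  have hkS := Finset.mem_compl.1 hk
  have hk' : k ≠ s ∧ k ≠ j ∧ k ≠ i :=
    ⟨fun e => hkS (e ▸ h.left_mem), hkj, fun e => hkS (e ▸ h.mem)⟩
  have hcont : Continuous fun z : X α => pairing (rep z) k i := by
    rw [← (isOpenQuotientMap_mk α).continuous_comp_iff]
    have : ((fun z : X α => pairing (rep z) k i) ∘ mk α) = fun x => pairing x.1 k i := by
      funext x
      exact apply_rep_mk (f := fun x => pairing x k i) (fun x g => pairing_act x g k i) x
    rw [this]
    exact (contDiff_pairing k i).continuous.comp continuous_subtype_val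
  have himg : (fun z : X α => pairing (rep z) k i) '' Z α S = Set.univ := by
    refine Set.eq_univ_of_forall fun c => ?_
    refine ⟨_, (h.mem_overSet hα hS.1 fun _ => c).2, ?_⟩
    change pairing (rep (mk α _)) k i = c
    rw [apply_rep_mk (f := fun x => pairing x k i) fun x g => pairing_act x g k i]
    have h1 := congrFun (h.coordMap_param_chartParam hα fun _ => c) k
    rw [coordMap, if_neg hkS] at h1
    exact h1.trans (chartParam_coe (fun _ => c) ⟨k, hk'⟩)
  have := hc.image hcont
  rw [himg] at this
  exact noncompact_univ ℂ this

end Invariants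

/-! ### The compact strata are projective spaces -/

section Projective

variable {n : ℕ} {S : Finset (Fin n)} {α : Fin n → ℝ} {s j : Fin n} {m : ℕ}

/-- The free indices when the complement of `S` is a singleton. -/
abbrev FreeIndex (S : Finset (Fin n)) (s : Fin n) : Type := {l : Fin n // l ∈ S ∧ l ≠ s}

theorem card_freeIndex (hs : s ∈ S) : Fintype.card (FreeIndex S s) = S.card - 1 := by
  have h : (Finset.univ.filter fun l : Fin n => l ∈ S ∧ l ≠ s) = S.erase s := by
    ext l
    simp [and_comm]
  rw [Fintype.card_subtype, h, Finset.card_erase_of_mem hs]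

/-- The parameter with given homogeneous coordinates. -/
noncomputable def homogParam (S : Finset (Fin n)) (s j : Fin n) (e : FreeIndex S s ≃ Fin m)
    (v : Fin m → ℂ) : Fin n → ℂ :=
  complete S s j fun l => if h : l ∈ S ∧ l ≠ s then v (e ⟨l, h⟩) else 0

theorem contDiff_homogParam (e : FreeIndex S s ≃ Fin m) : ContDiff ℝ ∞ (homogParam S s j e) := by
  refine (contDiff_complete s j).comp (contDiff_pi.2 fun l => ?_)
  by_cases h : l ∈ S ∧ l ≠ s
  · simp only [h, dif_pos, ne_eq, not_false_eq_true, and_self]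
    exact contDiff_apply ℝ ℂ _
  · simp only [h, dif_neg, not_false_eq_true]
    exact contDiff_const

theorem homogParam_symm (hj : j ∈ Sᶜ) (e : FreeIndex S s ≃ Fin m) (v : Fin m → ℂ) (k : Fin m) :
    homogParam S s j e v (e.symm k) = v k := by
  have h := (e.symm k).2
  rw [homogParam, complete_apply h.2 (ne_of_mem_of_not_mem h.1 (Finset.mem_compl.1 hj)), dif_pos h]
  exact congrArg v (e.apply_symm_apply k)

theorem exists_ne_zero_homogParam (hj : j ∈ Sᶜ) (e : FreeIndex S s ≃ Fin m) {v : Fin m → ℂ}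
    (hv : v ≠ 0) : ∃ i ∈ S, homogParam S s j e v i ≠ 0 := by
  obtain ⟨k, hk⟩ := Function.ne_iff.1 hv
  exact ⟨e.symm k, (e.symm k).2.1, by rw [homogParam_symm hj]; exact hk⟩

theorem homogParam_eq (hs : s ∈ S) (hj : Sᶜ = {j}) (e : FreeIndex S s ≃ Fin m) {v : Fin m → ℂ}
    {X : Fin n → ℂ} (hX : SumsVanish S X) (h : ∀ k, v k = X (e.symm k)) :
    homogParam S s j e v = X := by
  have hjS : j ∈ Sᶜ := by rw [hj]; exact Finset.mem_singleton_self j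
  refine complete_eq_self hs hjS hX fun l hls hlj => ?_
  have hl : l ∈ S := by
    by_contra hl
    rw [← Finset.mem_compl, hj, Finset.mem_singleton] at hl
    exact hlj hl
  rw [dif_pos ⟨hl, hls⟩, h, Equiv.symm_apply_apply]

theorem sumsVanish_homogParam (hs : s ∈ S) (hj : j ∈ Sᶜ) (e : FreeIndex S s ≃ Fin m)
    (v : Fin m → ℂ) : SumsVanish S (homogParam S s j e v) :=
  sumsVanish_complete hs hj _

theorem homogParam_smul (hs : s ∈ S) (hj : Sᶜ = {j}) (e : FreeIndex S s ≃ Fin m) (v : Fin m → ℂ)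
    (t : ℂ) : homogParam S s j e (t • v) = scale S t (homogParam S s j e v) := by
  have hjS : j ∈ Sᶜ := by rw [hj]; exact Finset.mem_singleton_self j
  refine homogParam_eq hs hj e ((sumsVanish_homogParam hs hjS e v).scale t) fun k => ?_
  simp only [scale, (e.symm k).2.1, if_true, homogParam_symm hjS, Pi.smul_apply, smul_eq_mul]

/-- The point of the stratum with given homogeneous coordinates. -/
noncomputable def homogPoint (hα : ∀ i, 0 < α i) (hS : IsShort α S) (hs : s ∈ S) (hj : Sᶜ = {j})
    (e : FreeIndex S s ≃ Fin m) (v : {v : Fin m → ℂ // v ≠ 0}) : Z α S :=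
  have hjS : j ∈ Sᶜ := by rw [hj]; exact Finset.mem_singleton_self j
  overProj (Z α S) ⟨_, param_mem_overSet hα hS (exists_ne_zero_homogParam hjS e v.2)
    (sumsVanish_homogParam hs hjS e v.1)⟩

theorem homogPoint_smul (hα : ∀ i, 0 < α i) (hS : IsShort α S) (hs : s ∈ S) (hj : Sᶜ = {j})
    (e : FreeIndex S s ≃ Fin m) (a b : {v : Fin m → ℂ // v ≠ 0}) (t : ℂ)
    (h : (a : Fin m → ℂ) = t • (b : Fin m → ℂ)) :
    homogPoint hα hS hs hj e a = homogPoint hα hS hs hj e b := by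
  have hjS : j ∈ Sᶜ := by rw [hj]; exact Finset.mem_singleton_self j
  have ht : t ≠ 0 := by
    rintro rfl
    exact a.2 (by rw [h, zero_smul])
  refine Subtype.ext (Eq.trans (mk_param_congr ?_ _ _)
    (mk_param_scale hα hS (exists_ne_zero_homogParam hjS e b.2)
      (sumsVanish_homogParam hs hjS e b.1) ht))
  rw [h, homogParam_smul hs hj]

/-- The Hermitian pairings recover the matrix `v v^*` up to a nonzero factor, hence the line of `v`.
This yields injectivity of the map from projective space. -/
theorem hermPairing_rep_homogPoint (hα : ∀ i, 0 < α i) (hS : IsShort α S) (hs : s ∈ S)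
    (hj : Sᶜ = {j}) (e : FreeIndex S s ≃ Fin m) (v : {v : Fin m → ℂ // v ≠ 0}) :
    ∃ c : ℂ, c ≠ 0 ∧ ∀ k l, hermPairing (rep (homogPoint hα hS hs hj e v).1) (e.symm k) (e.symm l) =
      c * (v.1 k * conj (v.1 l)) := by
  have hjS : j ∈ Sᶜ := by rw [hj]; exact Finset.mem_singleton_self j
  have hrep : ∀ k l, hermPairing (rep (homogPoint hα hS hs hj e v).1) k l =
      hermPairing (param S α (homogParam S s j e v.1)) k l := fun k l =>
    apply_rep_mk (f := fun x => hermPairing x k l) (fun x g => hermPairing_act x g _ _) _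
  obtain ⟨r, hr⟩ : ∃ r : ℝ, r = Real.exp (logScale S α (homogParam S s j e v.1)) := ⟨_, rfl⟩
  have hr0 : (r : ℂ) ≠ 0 := by
    rw [hr]
    exact Complex.ofReal_ne_zero.2 (Real.exp_pos _).ne'
  have hn : ∀ k, normalize S α (homogParam S s j e v.1) (e.symm k) = r * v.1 k := fun k => by
    rw [normalize, ← hr, scale, if_pos (e.symm k).2.1, homogParam_symm hjS]
  refine ⟨r * r, mul_ne_zero hr0 hr0, fun k l => ?_⟩
  rw [hrep, param, hermPairing_normalForm hα _ (e.symm k).2.1 (e.symm l).2.1, hn, hn, map_mul,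
    Complex.conj_ofReal]
  ring

/-- The pairings with a fixed index `i` equal `X_k * conj (X_i)`, so they are homogeneous
coordinates of the point whenever `X_i ≠ 0`. Being smooth in `x`, they provide the local lifts of
the inverse map. -/
theorem exists_homogPoint_eq (hα : ∀ i, 0 < α i) (hS : S ∈ shortSets' α) (hs : s ∈ S)
    (hj : Sᶜ = {j}) (e : FreeIndex S s ≃ Fin m) (x : overSet (Z α S)) {i : Fin m} (c : ℂ)
    (hc : c ≠ 0) (hi : hermPairing x.1 (e.symm i) (e.symm i) ≠ 0) :
    ∃ h : (fun k => c * hermPairing x.1 (e.symm k) (e.symm i)) ≠ 0,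
      homogPoint hα hS.1 hs hj e ⟨_, h⟩ = overProj (Z α S) x := by
  have hjS : j ∈ Sᶜ := by rw [hj]; exact Finset.mem_singleton_self j
  have hv : (fun k => c * hermPairing x.1 (e.symm k) (e.symm i)) ≠ 0 :=
    Function.ne_iff.2 ⟨i, mul_ne_zero hc hi⟩
  refine ⟨hv, ?_⟩
  obtain ⟨x, hxl, hxZ⟩ := x
  obtain ⟨X, hX, hsum, hadm, hxX⟩ := (mem_Z_iff_exists_param hα hS).1 hxZ
  obtain ⟨g, hg⟩ := mk_eq_mk.1 hxX.symm
  have hherm : ∀ k l, hermPairing x (e.symm k) (e.symm l) =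
      X (e.symm k) * conj (X (e.symm l)) := by
    intro k l
    change act (param S α X) g = x at hg
    rw [← hg, hermPairing_act, param, normalize_of_admissible hα hS.1 hadm,
      hermPairing_normalForm hα X (e.symm k).2.1 (e.symm l).2.1]
  have ht : c * conj (X (e.symm i)) ≠ 0 := by
    refine mul_ne_zero hc fun h0 => hi ?_
    change hermPairing x (e.symm i) (e.symm i) = 0
    rw [hherm, h0, mul_zero]
  refine Subtype.ext ?_
  change _ = mk α _
  rw [hxX]
  refine Eq.trans (mk_param_congr ?_ _ _) (mk_param_scale hα hS.1 hX hsum ht)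
  refine homogParam_eq hs hj e (hsum.scale _) fun k => ?_
  simp only [scale, (e.symm k).2.1, if_true, hherm]
  ring

theorem exists_hermPairing_ne_zero (hα : ∀ i, 0 < α i) (hS : S ∈ shortSets' α)
    (e : FreeIndex S s ≃ Fin m) (x : overSet (Z α S)) :
    ∃ i, hermPairing x.1 (e.symm i) (e.symm i) ≠ 0 := by
  obtain ⟨x, hxl, hxZ⟩ := x
  obtain ⟨X, hX, hsum, -, hxX⟩ := (mem_Z_iff_exists_param hα hS).1 hxZ
  obtain ⟨i, hi, his, hXi⟩ := hsum.exists_ne_zero hX s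
  obtain ⟨g, hg⟩ := mk_eq_mk.1 hxX.symm
  refine ⟨e ⟨i, hi, his⟩, ?_⟩
  change act (param S α X) g = x at hg
  rw [Equiv.symm_apply_apply]
  change hermPairing x i i ≠ 0
  rw [← hg, hermPairing_act]
  exact (hermPairing_param_self_ne_zero hα hi).2 hXi

theorem homogPoint_surjective (hα : ∀ i, 0 < α i) (hS : S ∈ shortSets' α) (hs : s ∈ S)
    (hj : Sᶜ = {j}) (e : FreeIndex S s ≃ Fin m) :
    Function.Surjective (homogPoint hα hS.1 hs hj e) := by
  intro z
  obtain ⟨x, rfl⟩ := (isOpenQuotientMap_overProj (Z α S)).surjective z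
  obtain ⟨i, hi⟩ := exists_hermPairing_ne_zero hα hS e x
  obtain ⟨h, hx⟩ := exists_homogPoint_eq hα hS hs hj e x 1 one_ne_zero hi
  exact ⟨_, hx⟩

/-- When `Sᶜ` is a single index the corresponding entry of `X` is zero. The stratum is then the
image of the unit sphere of homogeneous coordinates. -/
theorem isCompact_Z (hα : ∀ i, 0 < α i) (hS : S ∈ shortSets' α) (hcard : Sᶜ.card = 1) :
    IsCompact (Z α S) := by
  obtain ⟨j, hj⟩ := Finset.card_eq_one.1 hcard
  obtain ⟨s, hs⟩ := nonempty_of_mem_shortSets' hS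
  have hjS : j ∈ Sᶜ := by rw [hj]; exact Finset.mem_singleton_self j
  let e := Fintype.equivFin (FreeIndex S s)
  have hne : ∀ v : Metric.sphere (0 : Fin (Fintype.card (FreeIndex S s)) → ℂ) 1, v.1 ≠ 0 :=
    fun v h0 => by
      have := mem_sphere_zero_iff_norm.1 v.2
      rw [h0, norm_zero] at this
      exact zero_ne_one this
  have hcont : Continuous fun v : Metric.sphere (0 : Fin (Fintype.card (FreeIndex S s)) → ℂ) 1 =>
      (homogPoint hα hS.1 hs hj e ⟨v.1, hne v⟩).1 := by
    refine (continuous_mk α).comp (Continuous.subtype_mk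
      (f := fun v : Metric.sphere (0 : Fin (Fintype.card (FreeIndex S s)) → ℂ) 1 =>
        param S α (homogParam S s j e v.1)) ?_ _)
    refine continuous_iff_continuousAt.2 fun v => ?_
    refine ContinuousAt.comp (g := fun v => param S α (homogParam S s j e v))
      (f := Subtype.val) ?_ continuous_subtype_val.continuousAt
    exact ((contDiffAt_param hα hS.1 (exists_ne_zero_homogParam hjS e (hne v))).continuousAt.comp
      (contDiff_homogParam e).continuous.continuousAt)
  have hrange : Set.range (fun v : Metric.sphere
      (0 : Fin (Fintype.card (FreeIndex S s)) → ℂ) 1 =>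
      (homogPoint hα hS.1 hs hj e ⟨v.1, hne v⟩).1) = Z α S := by
    refine Set.Subset.antisymm ?_ fun z hz => ?_
    · rintro _ ⟨v, rfl⟩
      exact (homogPoint hα hS.1 hs hj e ⟨v.1, hne v⟩).2
    · obtain ⟨v, hv⟩ := homogPoint_surjective hα hS hs hj e ⟨z, hz⟩
      have hvn : ‖v.1‖ ≠ 0 := norm_ne_zero_iff.2 v.2
      refine ⟨⟨((‖v.1‖ : ℂ)⁻¹) • v.1, ?_⟩, ?_⟩
      · rw [mem_sphere_zero_iff_norm, norm_smul, norm_inv, Complex.norm_real, norm_norm,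
          inv_mul_cancel₀ hvn]
      · exact (congrArg Subtype.val (homogPoint_smul hα hS.1 hs hj e _ v _ rfl)).trans
          (congrArg Subtype.val hv)
  rw [← hrange]
  exact isCompact_range hcont

theorem areDiffeomorphic_Z_CP (hα : ∀ i, 0 < α i) (hS : S ∈ shortSets' α) (hn : 3 ≤ n)
    (hcard : Sᶜ.card = 1) : AreDiffeomorphic (overProj (Z α S)) (cpProj (n - 3)) := by
  obtain ⟨j, hj⟩ := Finset.card_eq_one.1 hcard
  obtain ⟨s, hs⟩ := nonempty_of_mem_shortSets' hS
  have hjS : j ∈ Sᶜ := by rw [hj]; exact Finset.mem_singleton_self j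
  -- Here `|S| = n - 1` and one entry is dependent, which leaves `n - 2` homogeneous coordinates.
  have hc : Fintype.card (FreeIndex S s) = n - 3 + 1 := by
    rw [card_freeIndex hs]
    have := Finset.card_add_card_compl S
    rw [hcard, Fintype.card_fin] at this
    omega
  let e : FreeIndex S s ≃ Fin (n - 3 + 1) := Fintype.equivFinOfCardEq hc
  let G : CP (n - 3) → Z α S := Projectivization.lift (homogPoint hα hS.1 hs hj e)
    (homogPoint_smul hα hS.1 hs hj e)
  have hG : ∀ v : {v : Fin (n - 3 + 1) → ℂ // v ≠ 0},
      G (Projectivization.mk ℂ v.1 v.2) = homogPoint hα hS.1 hs hj e v := fun v => rfl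
  have hinj : Function.Injective G := by
    intro a b hab
    induction a using Projectivization.ind with | h v hv =>
    induction b using Projectivization.ind with | h w hw =>
    rw [hG ⟨v, hv⟩, hG ⟨w, hw⟩] at hab
    obtain ⟨c, hc, hcv⟩ := hermPairing_rep_homogPoint hα hS.1 hs hj e ⟨v, hv⟩
    obtain ⟨d, hd, hdw⟩ := hermPairing_rep_homogPoint hα hS.1 hs hj e ⟨w, hw⟩
    rw [hab] at hcv
    obtain ⟨i, hi⟩ := Function.ne_iff.1 hv
    have hi' : conj (v i) ≠ 0 := (map_ne_zero _).2 hi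
    rw [Projectivization.mk_eq_mk_iff']
    refine ⟨d * conj (w i) / (c * conj (v i)), ?_⟩
    funext k
    have := (hcv k i).symm.trans (hdw k i)
    simp only [Pi.smul_apply, smul_eq_mul]
    simp only at this
    field_simp
    linear_combination -this
  have hsurj : Function.Surjective G := by
    intro z
    obtain ⟨v, hv⟩ := homogPoint_surjective hα hS hs hj e z
    exact ⟨Projectivization.mk ℂ v.1 v.2, hv⟩
  let E : CP (n - 3) ≃ Z α S := Equiv.ofBijective G ⟨hinj, hsurj⟩
  refine ⟨E.symm, ?_, ?_⟩
  · intro x _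
    obtain ⟨i, hi⟩ := exists_hermPairing_ne_zero hα hS e x
    refine ⟨{x | hermPairing x (e.symm i) (e.symm i) ≠ 0},
      isOpen_ne_fun (contDiff_hermPairing _ _).continuous continuous_const, hi,
      fun x k => 1 * hermPairing x (e.symm k) (e.symm i), ?_, ?_⟩
    · exact (contDiff_pi.2 fun k =>
        contDiff_const.mul (contDiff_hermPairing (e.symm k).1 (e.symm i).1)).contDiffOn
    · intro y hy _
      obtain ⟨h, hyv⟩ := exists_homogPoint_eq hα hS hs hj e y 1 one_ne_zero hy
      exact ⟨h, E.eq_symm_apply.2 hyv⟩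
  · intro v _
    refine ⟨{v | v ≠ 0}, isOpen_ne, v.2, fun v => param S α (homogParam S s j e v), ?_, ?_⟩
    · intro w hw
      exact ((contDiffAt_param hα hS.1 (exists_ne_zero_homogParam hjS e hw)).comp w
        (contDiff_homogParam e).contDiffAt).contDiffWithinAt
    · intro w _ _
      exact ⟨param_mem_overSet hα hS.1 (exists_ne_zero_homogParam hjS e w.2)
        (sumsVanish_homogParam hs hjS e w.1), rfl⟩

end Projective

/-! ### Connectedness through a map with connected fibres -/

/-- Compactness makes the images of the two closed pieces closed. By connectedness of `f '' K` these
images share a point, and the connected fibre over it meets both pieces, so the pieces themselves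
meet. -/
theorem isPreconnected_of_isCompact_fiber {E F : Type*} [TopologicalSpace E] [TopologicalSpace F]
    [T2Space F] {K : Set E} (hK : IsCompact K) {f : E → F} (hf : Continuous f)
    (himg : IsPreconnected (f '' K)) (hfib : ∀ y, IsPreconnected (K ∩ f ⁻¹' {y})) :
    IsPreconnected K := by
  rw [isPreconnected_closed_iff]
  intro u v hu hv hKuv ⟨a, haK, hau⟩ ⟨b, hbK, hbv⟩
  have hcu : IsClosed (f '' (K ∩ u)) := ((hK.inter_right hu).image hf).isClosed
  have hcv : IsClosed (f '' (K ∩ v)) := ((hK.inter_right hv).image hf).isClosed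
  have hcov : f '' K ⊆ f '' (K ∩ u) ∪ f '' (K ∩ v) := by
    rintro _ ⟨x, hx, rfl⟩
    exact (hKuv hx).imp (fun h => ⟨x, ⟨hx, h⟩, rfl⟩) (fun h => ⟨x, ⟨hx, h⟩, rfl⟩)
  obtain ⟨y, -, ⟨x₁, ⟨hx₁K, hx₁u⟩, hx₁⟩, ⟨x₂, ⟨hx₂K, hx₂v⟩, hx₂⟩⟩ :=
    isPreconnected_closed_iff.1 himg _ _ hcu hcv hcov ⟨f a, ⟨a, haK, rfl⟩, ⟨a, ⟨haK, hau⟩, rfl⟩⟩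
      ⟨f b, ⟨b, hbK, rfl⟩, ⟨b, ⟨hbK, hbv⟩, rfl⟩⟩
  obtain ⟨z, ⟨hzK, -⟩, hz⟩ := isPreconnected_closed_iff.1 (hfib y) u v hu hv
    (fun w hw => hKuv hw.1) ⟨x₁, ⟨hx₁K, hx₁⟩, hx₁u⟩ ⟨x₂, ⟨hx₂K, hx₂⟩, hx₂v⟩
  exact ⟨z, hzK, hz⟩

/-! ### Gram matrices of systems of spinors -/

/-- The sum of the rank one matrices `q_i q_i^*`. -/
noncomputable def gram {n : ℕ} (q : Fin n → Fin 2 → ℂ) : Matrix (Fin 2) (Fin 2) ℂ :=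
  ∑ i, Matrix.vecMulVec (q i) (star (q i))

theorem gram_apply {n : ℕ} (q : Fin n → Fin 2 → ℂ) (k l : Fin 2) :
    gram q k l = ∑ i, q i k * conj (q i l) := by
  simp [gram, Matrix.sum_apply, Matrix.vecMulVec_apply]

theorem isHermitian_vecMulVec (u : Fin 2 → ℂ) :
    (Matrix.vecMulVec u (star u)).IsHermitian := by
  ext k l
  simp [Matrix.vecMulVec_apply, mul_comm]

theorem isHermitian_gram {n : ℕ} (q : Fin n → Fin 2 → ℂ) : (gram q).IsHermitian := by
  ext k l
  simp [gram_apply, mul_comm]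

theorem trace_vecMulVec_star (u : Fin 2 → ℂ) :
    (Matrix.vecMulVec u (star u)).trace = (sqNorm u : ℂ) := by
  rw [Matrix.trace_vecMulVec, sqNorm_eq_trace]

theorem trace_gram {n : ℕ} (q : Fin n → Fin 2 → ℂ) : (gram q).trace = (∑ i, sqNorm (q i) : ℝ) := by
  rw [gram, Matrix.trace_sum]
  push_cast
  exact Finset.sum_congr rfl fun i _ => trace_vecMulVec_star _

theorem vecMulVec_mulVec_star (A : Matrix (Fin 2) (Fin 2) ℂ) (u : Fin 2 → ℂ) :
    Matrix.vecMulVec (A *ᵥ u) (star (A *ᵥ u)) = A * Matrix.vecMulVec u (star u) * star A := by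
  rw [Matrix.star_mulVec, Matrix.mul_vecMulVec, Matrix.vecMulVec_mul, Matrix.star_eq_conjTranspose]

theorem gram_mulVec {n : ℕ} (A : Matrix (Fin 2) (Fin 2) ℂ) (q : Fin n → Fin 2 → ℂ) :
    gram (fun i => A *ᵥ q i) = A * gram q * star A := by
  simp only [gram, vecMulVec_mulVec_star, Finset.mul_sum, Finset.sum_mul]

theorem sqNorm_mulVec (A : Matrix.specialUnitaryGroup (Fin 2) ℂ) (u : Fin 2 → ℂ) :
    sqNorm ((A : Matrix (Fin 2) (Fin 2) ℂ) *ᵥ u) = sqNorm u := by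
  apply Complex.ofReal_injective
  rw [← trace_vecMulVec_star, ← trace_vecMulVec_star, vecMulVec_mulVec_star, Matrix.trace_mul_comm,
    ← mul_assoc, star_mul_self_specialUnitary, one_mul]

theorem isHermitian_iff_entries {H : Matrix (Fin 2) (Fin 2) ℂ} : H.IsHermitian ↔
    ∃ (a d : ℝ) (b : ℂ), H = !![(a : ℂ), b; conj b, (d : ℂ)] := by
  constructor
  · intro h
    have h00 := h.apply 0 0
    have h11 := h.apply 1 1
    have h10 := h.apply 1 0
    refine ⟨(H 0 0).re, (H 1 1).re, H 0 1, ?_⟩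
    ext k l
    fin_cases k <;> fin_cases l
    · exact (Complex.conj_eq_iff_re.1 h00).symm
    · rfl
    · exact h10.symm
    · exact (Complex.conj_eq_iff_re.1 h11).symm
  · rintro ⟨a, d, b, rfl⟩
    ext k l
    fin_cases k <;> fin_cases l <;> simp

/-- A Hermitian matrix of nonnegative trace and zero determinant has rank at most one. -/
theorem exists_eq_vecMulVec {H : Matrix (Fin 2) (Fin 2) ℂ} (hH : H.IsHermitian)
    {t : ℝ} (ht : 0 ≤ t) (htr : H.trace = t) (hdet : H.det = 0) :
    ∃ u : Fin 2 → ℂ, H = Matrix.vecMulVec u (star u) := by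
  obtain ⟨a, d, b, rfl⟩ := isHermitian_iff_entries.1 hH
  have hb : b * conj b = (Complex.normSq b : ℂ) := Complex.mul_conj b
  rw [Matrix.det_fin_two_of, hb] at hdet
  have hdet' : a * d = Complex.normSq b := by
    have := sub_eq_zero.1 hdet
    exact_mod_cast this
  have htr' : a + d = t := by
    simp only [Matrix.trace_fin_two_of] at htr
    exact_mod_cast htr
  have hbn := Complex.normSq_nonneg b
  rcases lt_trichotomy a 0 with ha | rfl | ha
  · nlinarith
  · rw [zero_mul] at hdet'
    have hb0 : b = 0 := Complex.normSq_eq_zero.1 hdet'.symm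
    have hd : (√d : ℂ) * √d = d := by
      rw [← Complex.ofReal_mul, Real.mul_self_sqrt (by linarith)]
    refine ⟨![0, (√d : ℂ)], ?_⟩
    ext k l
    fin_cases k <;> fin_cases l <;> simp [Matrix.vecMulVec_apply, hb0, hd]
  · have hs : (√a : ℂ) * √a = a := by
      rw [← Complex.ofReal_mul, Real.mul_self_sqrt ha.le]
    have hs0 : (√a : ℂ) ≠ 0 := Complex.ofReal_ne_zero.2 (Real.sqrt_pos.2 ha).ne'
    have ha0 : (a : ℂ) ≠ 0 := Complex.ofReal_ne_zero.2 ha.ne'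
    have hdetc : (a : ℂ) * d = b * conj b := by
      rw [hb, ← hdet']
      push_cast
      rfl
    refine ⟨![(√a : ℂ), conj b / √a], ?_⟩
    ext k l
    fin_cases k <;> fin_cases l <;> simp [Matrix.vecMulVec_apply]
    · exact hs.symm
    · field_simp
    · field_simp
    · field_simp
      rw [sq, hs]
      linear_combination hdetc

theorem star_mul_smul_one_mul (A : Matrix.specialUnitaryGroup (Fin 2) ℂ) (c : ℂ) :
    star (A : Matrix (Fin 2) (Fin 2) ℂ) * (c • 1) * A = c • 1 := by
  rw [mul_smul_comm, mul_one, smul_mul_assoc, star_mul_self_specialUnitary]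

/-- A Hermitian matrix is conjugate to a diagonal matrix that only depends on its trace and
determinant. -/
theorem exists_conj_eq_diagonal {a b : ℂ} : ∃ x y : ℝ, ∀ H : Matrix (Fin 2) (Fin 2) ℂ,
    H.IsHermitian → H.trace = a → H.det = b →
    ∃ A : Matrix.specialUnitaryGroup (Fin 2) ℂ,
      star (A : Matrix (Fin 2) (Fin 2) ℂ) * H * A = !![(x : ℂ), 0; 0, (y : ℂ)] := by
  -- `t` is the gap between the roots of the characteristic polynomial and `y` is the smaller root.
  -- Subtracting `y` leaves a matrix `u u^*` of trace `t`, and rotating `u` to the first axis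
  -- diagonalizes `H`.
  set t : ℝ := √(a.re ^ 2 - 4 * b.re) with ht
  set y : ℝ := (a.re - t) / 2 with hy
  refine ⟨t + y, y, fun H hH htr hdet => ?_⟩
  obtain ⟨a', d', b', hHe⟩ := isHermitian_iff_entries.1 hH
  have htr' : a = ((a' + d' : ℝ) : ℂ) := by
    rw [← htr, hHe, Matrix.trace_fin_two_of]; push_cast; rfl
  have hdet' : b = ((a' * d' - Complex.normSq b' : ℝ) : ℂ) := by
    rw [← hdet, hHe, Matrix.det_fin_two_of, Complex.mul_conj]; push_cast; rfl
  have hare : a.re = a' + d' := by rw [htr', Complex.ofReal_re]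
  have hbre : b.re = a' * d' - Complex.normSq b' := by rw [hdet', Complex.ofReal_re]
  have hdisc : t ^ 2 = a.re ^ 2 - 4 * b.re := by
    rw [ht, Real.sq_sqrt]
    have := Complex.normSq_nonneg b'
    rw [hare, hbre]
    nlinarith [sq_nonneg (a' - d')]
  obtain ⟨u, hu⟩ := exists_eq_vecMulVec (H := H - (y : ℂ) • (1 : Matrix (Fin 2) (Fin 2) ℂ))
    (t := t) (by
      refine hH.sub ?_
      ext k l
      fin_cases k <;> fin_cases l <;> simp) (Real.sqrt_nonneg _)
    (by
      rw [Matrix.trace_sub, Matrix.trace_smul, Matrix.trace_one, htr, Fintype.card_fin, htr',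
        ← hare, hy, smul_eq_mul]
      push_cast
      ring)
    (by
      have h1 : (a' - y) * (d' - y) - Complex.normSq b' = 0 := by
        rw [hare] at hy hdisc
        rw [hbre] at hdisc
        rw [hy]
        nlinarith
      have h2 : (H - (y : ℂ) • (1 : Matrix (Fin 2) (Fin 2) ℂ)).det =
          (((a' - y) * (d' - y) - Complex.normSq b' : ℝ) : ℂ) := by
        rw [hHe, Matrix.det_fin_two]
        simp [Complex.mul_conj]
      rw [h2, h1, Complex.ofReal_zero])
  have hH' : H = Matrix.vecMulVec u (star u) + (y : ℂ) • 1 := by rw [← hu, sub_add_cancel]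
  have hun : sqNorm u = t := by
    apply Complex.ofReal_injective
    rw [← trace_vecMulVec_star, ← hu, Matrix.trace_sub, Matrix.trace_smul, Matrix.trace_one, htr,
      Fintype.card_fin, htr', ← hare, hy, smul_eq_mul]
    push_cast
    ring
  obtain ⟨A, hA⟩ : ∃ A : Matrix.specialUnitaryGroup (Fin 2) ℂ,
      star (A : Matrix (Fin 2) (Fin 2) ℂ) *ᵥ u = ![(√(sqNorm u) : ℂ), 0] := by
    by_cases hu0 : u = 0
    · refine ⟨1, ?_⟩
      ext k
      fin_cases k <;> simp [hu0, sqNorm]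
    · exact exists_specialUnitary_rotate hu0
  refine ⟨A, ?_⟩
  have h1 := vecMulVec_mulVec_star (star (A : Matrix (Fin 2) (Fin 2) ℂ)) u
  rw [star_star] at h1
  have hs : (√t : ℂ) * √t = t := by
    rw [← Complex.ofReal_mul, Real.mul_self_sqrt (Real.sqrt_nonneg _)]
  rw [hH', mul_add, add_mul, ← h1, star_mul_smul_one_mul, hA, hun]
  ext k l
  rw [Matrix.add_apply, Matrix.vecMulVec_apply, Matrix.smul_apply, Pi.star_apply]
  fin_cases k <;> fin_cases l <;> simp [hs]

/-- Both matrices are conjugate to the same diagonal matrix. -/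
theorem exists_conj_eq {H H' : Matrix (Fin 2) (Fin 2) ℂ} (hH : H.IsHermitian)
    (hH' : H'.IsHermitian) (htr : H.trace = H'.trace) (hdet : H.det = H'.det) :
    ∃ A : Matrix.specialUnitaryGroup (Fin 2) ℂ,
      (A : Matrix (Fin 2) (Fin 2) ℂ) * H * star (A : Matrix (Fin 2) (Fin 2) ℂ) = H' := by
  obtain ⟨x, y, h⟩ := exists_conj_eq_diagonal (a := H'.trace) (b := H'.det)
  obtain ⟨A, hA⟩ := h H hH htr hdet
  obtain ⟨B, hB⟩ := h H' hH' rfl rfl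
  refine ⟨B * star A, ?_⟩
  have hAB := hA.trans hB.symm
  rw [Submonoid.coe_mul, Matrix.specialUnitaryGroup.coe_star, star_mul, star_star]
  have h1 := mul_star_self_specialUnitary B
  set a : Matrix (Fin 2) (Fin 2) ℂ := A.1
  set b : Matrix (Fin 2) (Fin 2) ℂ := B.1
  calc b * star a * H * (a * star b) = b * (star a * H * a) * star b := by simp only [mul_assoc]
    _ = (b * star b) * H' * (b * star b) := by rw [hAB]; simp only [mul_assoc]
    _ = H' := by rw [h1, one_mul, mul_one]

/-! ### Systems of spinors with given lengths and Gram matrix -/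

/-- The systems of spinors with given squared lengths. -/
def spinorSpheres {n : ℕ} (r : Fin n → ℝ) : Set (Fin n → Fin 2 → ℂ) := {q | ∀ i, sqNorm (q i) = r i}

/-- The systems of spinors with given squared lengths and Gram matrix. -/
def spinorPolygons {n : ℕ} (r : Fin n → ℝ) (H : Matrix (Fin 2) (Fin 2) ℂ) :
    Set (Fin n → Fin 2 → ℂ) :=
  {q | (∀ i, sqNorm (q i) = r i) ∧ gram q = H}

theorem continuous_sqNorm : Continuous sqNorm :=
  continuous_finsetSum _ fun k _ => Complex.continuous_normSq.comp (continuous_apply k)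

theorem continuous_gram {n : ℕ} : Continuous (gram (n := n)) :=
  continuous_finsetSum _ fun i _ =>
    Continuous.matrix_vecMulVec (continuous_apply i) (continuous_apply i).star

theorem isClosed_spinorPolygons {n : ℕ} (r : Fin n → ℝ) (H : Matrix (Fin 2) (Fin 2) ℂ) :
    IsClosed (spinorPolygons r H) := by
  have : spinorPolygons r H = (⋂ i, {q | sqNorm (q i) = r i}) ∩ {q | gram q = H} := by
    ext q; simp [spinorPolygons]
  rw [this]
  exact (isClosed_iInter fun i => isClosed_eq (continuous_sqNorm.comp (continuous_apply i))
    continuous_const).inter (isClosed_eq continuous_gram continuous_const)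

theorem isCompact_spinorPolygons {n : ℕ} (r : Fin n → ℝ) (H : Matrix (Fin 2) (Fin 2) ℂ) :
    IsCompact (spinorPolygons r H) := by
  have hcomp : IsCompact (Set.pi Set.univ fun i : Fin n => Set.pi Set.univ fun _ : Fin 2 =>
      Metric.closedBall (0 : ℂ) √(r i)) :=
    isCompact_univ_pi fun _ => isCompact_univ_pi fun _ => isCompact_closedBall 0 _
  refine hcomp.of_isClosed_subset (isClosed_spinorPolygons r H) ?_
  intro q hq i _ k _
  rw [mem_closedBall_zero_iff]
  refine Real.le_sqrt_of_sq_le ?_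
  rw [← hq.1 i, ← Complex.normSq_eq_norm_sq]
  exact Finset.single_le_sum (f := fun k => Complex.normSq (q i k))
    (fun k _ => Complex.normSq_nonneg _) (Finset.mem_univ k)

/-- Zones of the 3-sphere are connected. -/
theorem isPreconnected_zone (r : ℝ) {I : Set ℝ} (hI : I.OrdConnected) :
    IsPreconnected {u : Fin 2 → ℂ | sqNorm u = r ∧ Complex.normSq (u 0) ∈ I} := by
  -- With `|u_0|²` and the two arguments as parameters, the zone is an image of an interval times a
  -- plane.
  have hset : {u : Fin 2 → ℂ | sqNorm u = r ∧ Complex.normSq (u 0) ∈ I} =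
      (fun v : ℝ × ℝ × ℝ => ![(√v.1 : ℂ) * Complex.exp (v.2.1 * Complex.I),
        (√(r - v.1) : ℂ) * Complex.exp (v.2.2 * Complex.I)]) ''
        ((I ∩ Set.Icc 0 r) ×ˢ Set.univ) := by
    ext u
    constructor
    · rintro ⟨hu, huI⟩
      rw [sqNorm_eq] at hu
      have h0 := Complex.normSq_nonneg (u 0)
      have h1 := Complex.normSq_nonneg (u 1)
      refine ⟨(Complex.normSq (u 0), Complex.arg (u 0), Complex.arg (u 1)),
        ⟨⟨huI, h0, by linarith⟩, trivial⟩, ?_⟩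
      have h2 : r - Complex.normSq (u 0) = Complex.normSq (u 1) := by linarith
      ext k
      fin_cases k
      · simp [Complex.normSq_eq_norm_sq]
      · simp [h2, Complex.normSq_eq_norm_sq (u 1)]
    · rintro ⟨⟨s, θ, φ⟩, ⟨⟨hsI, hs0, hsr⟩, -⟩, rfl⟩
      have hn : ∀ t ψ : ℝ, 0 ≤ t →
          Complex.normSq ((√t : ℂ) * Complex.exp (ψ * Complex.I)) = t := by
        intro t ψ ht
        rw [Complex.normSq_mul, Complex.normSq_ofReal, Real.mul_self_sqrt ht,
          Complex.normSq_eq_norm_sq, Complex.norm_exp_ofReal_mul_I, one_pow, mul_one]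
      have h0 := hn s θ hs0
      have h1 := hn (r - s) φ (by linarith)
      simp only [Set.mem_ofPred_eq, sqNorm_eq, Matrix.cons_val_zero, Matrix.cons_val_one, h0, h1]
      exact ⟨by ring, hsI⟩
  rw [hset]
  refine IsPreconnected.image ?_ _ ?_
  · exact (hI.inter Set.ordConnected_Icc).isPreconnected.prod isPreconnected_univ
  · refine Continuous.continuousOn (continuous_pi fun k => ?_)
    fin_cases k <;> simp only [Fin.zero_eta, Fin.mk_one, Matrix.cons_val_zero, Matrix.cons_val_one]
      <;> fun_prop

theorem isPreconnected_spinorSpheres {n : ℕ} (r : Fin n → ℝ) : IsPreconnected (spinorSpheres r) := by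
  have : spinorSpheres r = Set.pi Set.univ fun i =>
      {u : Fin 2 → ℂ | sqNorm u = r i ∧ Complex.normSq (u 0) ∈ (Set.univ : Set ℝ)} := by
    ext q
    simp [spinorSpheres, Set.mem_pi]
  rw [this]
  exact isPreconnected_univ_pi fun i => isPreconnected_zone (r i) Set.ordConnected_univ

theorem det_ofReal_re_of_isHermitian {H : Matrix (Fin 2) (Fin 2) ℂ} (hH : H.IsHermitian) :
    (H.det.re : ℂ) = H.det := by
  obtain ⟨a, d, b, rfl⟩ := isHermitian_iff_entries.1 hH
  rw [Matrix.det_fin_two_of, Complex.mul_conj]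
  simp

/-- The determinants of Gram matrices of systems with given squared lengths. -/
def gramDets {n : ℕ} (r : Fin n → ℝ) : Set ℝ := (fun q => (gram q).det.re) '' spinorSpheres r

/-- The determinant is continuous on a product of spheres, which is connected, so its values form an
interval. -/
theorem ordConnected_gramDets {n : ℕ} (r : Fin n → ℝ) : (gramDets r).OrdConnected :=
  ((isPreconnected_spinorSpheres r).image _ (Complex.continuous_re.comp
    continuous_gram.matrix_det).continuousOn).ordConnected

theorem spinorPolygons_conj {n : ℕ} {r : Fin n → ℝ} {H : Matrix (Fin 2) (Fin 2) ℂ}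
    (A : Matrix.specialUnitaryGroup (Fin 2) ℂ) {q : Fin n → Fin 2 → ℂ}
    (hq : q ∈ spinorPolygons r H) :
    (fun i => (A : Matrix (Fin 2) (Fin 2) ℂ) *ᵥ q i) ∈ spinorPolygons r
      ((A : Matrix (Fin 2) (Fin 2) ℂ) * H * star (A : Matrix (Fin 2) (Fin 2) ℂ)) :=
  ⟨fun i => by rw [sqNorm_mulVec, hq.1 i], by rw [gram_mulVec, hq.2]⟩

/-- Rotating a system conjugates its Gram matrix. The trace is fixed by the lengths, so whether `H`
is attained depends on its determinant alone. -/
theorem nonempty_spinorPolygons_iff {n : ℕ} {r : Fin n → ℝ} {H : Matrix (Fin 2) (Fin 2) ℂ}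
    (hH : H.IsHermitian) (htr : H.trace = (∑ i, r i : ℝ)) :
    (spinorPolygons r H).Nonempty ↔ H.det.re ∈ gramDets r := by
  constructor
  · rintro ⟨q, hq, rfl⟩
    exact ⟨q, hq, rfl⟩
  · rintro ⟨q, hq, hdet⟩
    obtain ⟨A, hA⟩ := exists_conj_eq (isHermitian_gram q) hH
      (by rw [trace_gram, htr]; congr 1; exact Finset.sum_congr rfl fun i _ => hq i)
      (by
        rw [← det_ofReal_re_of_isHermitian (isHermitian_gram q), ← det_ofReal_re_of_isHermitian hH]
        exact congrArg _ hdet)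
    have := spinorPolygons_conj A (r := r) (q := q) ⟨hq, rfl⟩
    rw [hA] at this
    exact ⟨_, this⟩

theorem gram_succ {n : ℕ} (q : Fin (n + 1) → Fin 2 → ℂ) :
    gram q = Matrix.vecMulVec (q 0) (star (q 0)) + gram (fun i => q i.succ) := by
  rw [gram, Fin.sum_univ_succ]
  rfl

theorem mem_spinorPolygons_succ {n : ℕ} {r : Fin (n + 1) → ℝ} {H : Matrix (Fin 2) (Fin 2) ℂ}
    {q : Fin (n + 1) → Fin 2 → ℂ} : q ∈ spinorPolygons r H ↔ sqNorm (q 0) = r 0 ∧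
      (fun i => q i.succ) ∈ spinorPolygons (fun i => r i.succ)
        (H - Matrix.vecMulVec (q 0) (star (q 0))) := by
  rw [spinorPolygons, Set.mem_ofPred_eq, Fin.forall_fin_succ, gram_succ, and_assoc,
    spinorPolygons, Set.mem_ofPred_eq, eq_sub_iff_add_eq, add_comm (gram _)]

/-- Project a system to its first spinor `u`. The fibre is a set of systems with one spinor fewer
and Gram matrix `H - u u^*`, connected by the induction hypothesis. For diagonal `H` the determinant
of `H - u u^*` is affine in `|u_0|²`, so the image is a zone of the 3-sphere. -/
theorem isPreconnected_spinorPolygons_diagonal {n : ℕ} {r : Fin (n + 1) → ℝ}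
    (ih : ∀ H, IsPreconnected (spinorPolygons (fun i => r i.succ) H)) (x y : ℝ) :
    IsPreconnected (spinorPolygons r !![(x : ℂ), 0; 0, (y : ℂ)]) := by
  set H : Matrix (Fin 2) (Fin 2) ℂ := !![(x : ℂ), 0; 0, (y : ℂ)] with hHdef
  have hH : H.IsHermitian := isHermitian_iff_entries.2 ⟨x, y, 0, by simp [hHdef]⟩
  have htrH : H.trace = ((x + y : ℝ) : ℂ) := by
    rw [hHdef, Matrix.trace_fin_two_of]; push_cast; rfl
  refine isPreconnected_of_isCompact_fiber (isCompact_spinorPolygons r H)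
    (continuous_apply 0) ?_ fun u => ?_
  -- If the trace of `H` is not the sum of the squared lengths, there are no systems at all.
  · by_cases hxy : x + y = ∑ i, r i
    · have himg : (fun q : Fin (n + 1) → Fin 2 → ℂ => q 0) '' spinorPolygons r H =
          {u : Fin 2 → ℂ | sqNorm u = r 0 ∧ Complex.normSq (u 0) ∈
            (fun s : ℝ => x * y - x * r 0 + (x - y) * s) ⁻¹' gramDets fun i => r i.succ} := by
        have hnon : ∀ u : Fin 2 → ℂ, sqNorm u = r 0 →
            ((spinorPolygons (fun i => r i.succ) (H - Matrix.vecMulVec u (star u))).Nonempty ↔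
              x * y - x * r 0 + (x - y) * Complex.normSq (u 0) ∈ gramDets fun i => r i.succ) := by
          intro u hu
          rw [nonempty_spinorPolygons_iff (hH.sub (isHermitian_vecMulVec u))]
          · have hdet : (H - Matrix.vecMulVec u (star u)).det =
                ((x * y - x * r 0 + (x - y) * Complex.normSq (u 0) : ℝ) : ℂ) := by
              have h1 : r 0 = Complex.normSq (u 0) + Complex.normSq (u 1) := by
                rw [← hu, sqNorm_eq]
              rw [h1, Matrix.det_fin_two]
              simp only [hHdef, Matrix.sub_apply, Matrix.vecMulVec_apply, Matrix.of_apply,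
                Matrix.cons_val', Matrix.cons_val_zero, Matrix.cons_val_one, Pi.star_apply,
                Matrix.cons_val_fin_one, RCLike.star_def]
              push_cast
              simp only [Complex.normSq_eq_conj_mul_self]
              ring
            rw [hdet, Complex.ofReal_re]
          · rw [Matrix.trace_sub, htrH, trace_vecMulVec_star, hu, ← Complex.ofReal_sub, hxy,
              Fin.sum_univ_succ, add_sub_cancel_left]
        ext u
        constructor
        · rintro ⟨q, hq, rfl⟩
          obtain ⟨h1, h2⟩ := mem_spinorPolygons_succ.1 hq
          exact ⟨h1, (hnon _ h1).1 ⟨_, h2⟩⟩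
        · rintro ⟨h1, h2⟩
          obtain ⟨q, hq⟩ := (hnon u h1).2 h2
          refine ⟨Fin.cons u q, mem_spinorPolygons_succ.2 ?_, rfl⟩
          simpa using ⟨h1, hq⟩
      rw [himg]
      refine isPreconnected_zone (r 0) ?_
      -- The affine function of `|u_0|²` has slope `x - y`, hence is monotone or antitone, and
      -- preimages of intervals are intervals.
      rcases le_total y x with h | h
      · refine (ordConnected_gramDets _).preimage_mono fun s t hst => ?_
        have := mul_le_mul_of_nonneg_left hst (sub_nonneg.2 h)
        linarith
      · refine (ordConnected_gramDets _).preimage_anti fun s t hst => ?_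
        have := mul_le_mul_of_nonneg_left hst (sub_nonneg.2 h)
        linarith
    · have : spinorPolygons r H = ∅ := by
        refine Set.eq_empty_of_forall_notMem ?_
        rintro q ⟨hq, hqH⟩
        refine hxy (Complex.ofReal_injective ?_)
        rw [← htrH, ← hqH, trace_gram]
        congr 1
        exact Finset.sum_congr rfl fun i _ => hq i
      rw [this, Set.image_empty]
      exact isPreconnected_empty
  · by_cases hu : sqNorm u = r 0
    · have : spinorPolygons r H ∩ (fun q : Fin (n + 1) → Fin 2 → ℂ => q 0) ⁻¹' {u} =
          (fun q : Fin n → Fin 2 → ℂ => (Fin.cons u q : Fin (n + 1) → Fin 2 → ℂ)) ''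
            spinorPolygons (fun i => r i.succ) (H - Matrix.vecMulVec u (star u)) := by
        ext q
        constructor
        · rintro ⟨hq, hqu⟩
          rw [Set.mem_preimage, Set.mem_singleton_iff] at hqu
          subst hqu
          exact ⟨_, (mem_spinorPolygons_succ.1 hq).2, Fin.cons_self_tail q⟩
        · rintro ⟨q, hq, rfl⟩
          refine ⟨mem_spinorPolygons_succ.2 ?_, rfl⟩
          simpa using ⟨hu, hq⟩
      rw [this]
      refine (ih _).image _ (Continuous.continuousOn ?_)
      exact continuous_pi fun i => by
        refine Fin.cases ?_ (fun i => ?_) i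
        · exact continuous_const
        · exact continuous_apply i
    · have : spinorPolygons r H ∩ (fun q : Fin (n + 1) → Fin 2 → ℂ => q 0) ⁻¹' {u} = ∅ := by
        refine Set.eq_empty_of_forall_notMem ?_
        rintro q ⟨hq, rfl⟩
        exact hu (hq.1 0)
      rw [this]
      exact isPreconnected_empty

theorem isPreconnected_spinorPolygons {n : ℕ} (r : Fin n → ℝ) (H : Matrix (Fin 2) (Fin 2) ℂ) :
    IsPreconnected (spinorPolygons r H) := by
  induction n generalizing H with
  | zero => exact Set.subsingleton_of_subsingleton.isPreconnected
  | succ n ih =>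
    rcases (spinorPolygons r H).eq_empty_or_nonempty with h | ⟨q₀, hq₀⟩
    · rw [h]
      exact isPreconnected_empty
    · have hH : H.IsHermitian := hq₀.2 ▸ isHermitian_gram q₀
      obtain ⟨x, y, hxy⟩ := exists_conj_eq_diagonal (a := H.trace) (b := H.det)
      obtain ⟨A, hA⟩ := hxy H hH rfl rfl
      have h1 := mul_star_self_specialUnitary A
      have himg : spinorPolygons r H =
          (fun (q : Fin (n + 1) → Fin 2 → ℂ) i => (A : Matrix (Fin 2) (Fin 2) ℂ) *ᵥ q i) ''
            spinorPolygons r !![(x : ℂ), 0; 0, (y : ℂ)] := by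
        refine Set.Subset.antisymm (fun q hq => ?_) ?_
        · have h2 := spinorPolygons_conj (star A) hq
          rw [Matrix.specialUnitaryGroup.coe_star, star_star, hA] at h2
          refine ⟨_, h2, ?_⟩
          funext i
          simp only [Matrix.mulVec_mulVec, h1, Matrix.one_mulVec]
        · rintro _ ⟨q, hq, rfl⟩
          have h2 := spinorPolygons_conj A hq
          rw [← hA] at h2
          have h3 : (A : Matrix (Fin 2) (Fin 2) ℂ) * (star (A : Matrix (Fin 2) (Fin 2) ℂ) * H * A) *
              star (A : Matrix (Fin 2) (Fin 2) ℂ) = H := by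
            set a : Matrix (Fin 2) (Fin 2) ℂ := A.1
            calc a * (star a * H * a) * star a = (a * star a) * H * (a * star a) := by
                  simp only [mul_assoc]
              _ = H := by rw [h1, one_mul, mul_one]
          rwa [h3] at h2
      rw [himg]
      refine (isPreconnected_spinorPolygons_diagonal (fun H => ih _ H) x y).image _
        (Continuous.continuousOn ?_)
      exact continuous_pi fun i => Continuous.matrix_mulVec continuous_const (continuous_apply i)

/-! ### The polygon space -/

section Polygons

variable {n : ℕ} {α : Fin n → ℝ}

/-- With `p = 0` the real moment map equation says that the Gram matrix is scalar; its trace `2 ∑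
α_i` determines the scalar. -/
theorem zero_mk_mem_level_iff {q : Fin n → Fin 2 → ℂ} : ((0, q) : Cotangent n) ∈ level α ↔
    q ∈ spinorPolygons (fun i => 2 * α i) (((∑ i, α i : ℝ) : ℂ) • 1) := by
  have h0 : sqNorm (0 : Fin 2 → ℂ) = 0 := by simp [sqNorm]
  rw [mem_level_iff]
  simp only [Pi.zero_apply, h0, sub_zero, zero_mul, add_zero, map_zero, mul_zero,
    Finset.sum_const_zero, implies_true, and_true, true_and, spinorPolygons, Set.mem_ofPred_eq]
  refine and_congr_right fun hq => ?_
  have hsum : ∑ i, Complex.normSq (q i 0) + ∑ i, Complex.normSq (q i 1) = 2 * ∑ i, α i := by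
    rw [← Finset.sum_add_distrib, Finset.mul_sum]
    exact Finset.sum_congr rfl fun i _ => by rw [← sqNorm_eq, hq i]
  have hkk : ∀ k, gram q k k = ((∑ i, Complex.normSq (q i k) : ℝ) : ℂ) := fun k => by
    rw [gram_apply]
    push_cast
    exact Finset.sum_congr rfl fun i _ => Complex.mul_conj _
  rw [Finset.sum_sub_distrib]
  constructor
  · rintro ⟨h1, h2⟩
    have h00 : ∑ i, Complex.normSq (q i 0) = ∑ i, α i := by linarith
    have h11 : ∑ i, Complex.normSq (q i 1) = ∑ i, α i := by linarith
    have h01 : gram q 0 1 = 0 := by rw [gram_apply, h1]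
    have h10 : gram q 1 0 = 0 := by rw [← (isHermitian_gram q).apply 1 0, h01, star_zero]
    ext k l
    fin_cases k <;> fin_cases l
    · simp [hkk, h00]
    · simp [h01]
    · simp [h10]
    · simp [hkk, h11]
  · intro h
    have h01 := congrFun (congrFun h 0) 1
    have h00 := congrFun (congrFun h 0) 0
    have h11 := congrFun (congrFun h 1) 1
    rw [hkk, Matrix.smul_apply, Matrix.one_apply_eq, smul_eq_mul, mul_one] at h00 h11
    rw [gram_apply] at h01
    refine ⟨by simpa using h01, ?_⟩
    rw [Complex.ofReal_injective h00, Complex.ofReal_injective h11, sub_self]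

/-- The polygon with given spinors. -/
noncomputable def polygon (q : spinorPolygons (fun i => 2 * α i) (((∑ i, α i : ℝ) : ℂ) • 1)) :
    X α :=
  mk α ⟨(0, q.1), zero_mk_mem_level_iff.2 q.2⟩

theorem continuous_polygon : Continuous (polygon (α := α)) :=
  (continuous_mk α).comp ((continuous_const.prodMk continuous_subtype_val).subtype_mk _)

theorem range_polygon : Set.range (polygon (α := α)) = M α := by
  ext z
  constructor
  · rintro ⟨q, rfl⟩
    exact ⟨_, rfl, rfl⟩
  · rintro ⟨⟨⟨p, q⟩, hx⟩, hp, rfl⟩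
    change p = 0 at hp
    subst hp
    exact ⟨⟨q, zero_mk_mem_level_iff.1 hx⟩, rfl⟩

theorem isPreconnected_M : IsPreconnected (M α) := by
  rw [← range_polygon]
  have := Subtype.preconnectedSpace (isPreconnected_spinorPolygons (fun i => 2 * α i)
    (((∑ i, α i : ℝ) : ℂ) • 1))
  exact isPreconnected_range continuous_polygon

theorem isCompact_M : IsCompact (M α) := by
  rw [← range_polygon]
  have := isCompact_iff_compactSpace.1 (isCompact_spinorPolygons (fun i => 2 * α i)
    (((∑ i, α i : ℝ) : ℂ) • 1))
  exact isCompact_range continuous_polygon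

/-! ### When the polygon space is empty -/

theorem epsilon_singleton (m : Fin n) : epsilon α {m} = 2 * α m - ∑ i, α i := by
  have := Finset.sum_add_sum_compl {m} α
  rw [Finset.sum_singleton] at this
  rw [epsilon, Finset.sum_singleton]
  linarith

theorem isShort_singleton_iff (m : Fin n) : IsShort α {m} ↔ 2 * α m < ∑ i, α i := by
  rw [IsShort, epsilon_singleton, sub_neg]

/-- For a polygon with Gram matrix `s • 1`, the sum over `i` of `|⟨q_m, q_i⟩|²` is `s |q_m|² = 2 s
α_m`. The term `i = m` alone is `(2 α_m)²`, so `2 α_m ≤ s`. -/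
theorem M_eq_empty (hα : ∀ i, 0 < α i) {m : Fin n} (hm : ∑ i, α i < 2 * α m) : M α = ∅ := by
  rw [← range_polygon, Set.range_eq_empty_iff]
  refine ⟨fun q => ?_⟩
  obtain ⟨q, hq, hgram⟩ := q
  set s : ℝ := ∑ i, α i with hs
  set a := q m 0
  set b := q m 1
  have h00 : ∑ i, q i 0 * conj (q i 0) = s := by
    have := congrFun (congrFun hgram 0) 0
    rw [gram_apply] at this
    simpa using this
  have h11 : ∑ i, q i 1 * conj (q i 1) = s := by
    have := congrFun (congrFun hgram 1) 1
    rw [gram_apply] at this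
    simpa using this
  have h01 : ∑ i, q i 0 * conj (q i 1) = 0 := by
    have := congrFun (congrFun hgram 0) 1
    rw [gram_apply] at this
    simpa using this
  have h10 : ∑ i, q i 1 * conj (q i 0) = 0 := by
    have := congrFun (congrFun hgram 1) 0
    rw [gram_apply] at this
    simpa using this
  have hab : Complex.normSq a + Complex.normSq b = 2 * α m := by
    have h := hq m
    rw [sqNorm_eq] at h
    exact h
  have key : ∑ i, Complex.normSq (conj a * q i 0 + conj b * q i 1) = s * (2 * α m) := by
    apply Complex.ofReal_injective
    rw [← hab]
    push_cast
    have hterm : ∀ i, (Complex.normSq (conj a * q i 0 + conj b * q i 1) : ℂ) =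
        conj a * a * (q i 0 * conj (q i 0)) + conj b * b * (q i 1 * conj (q i 1)) +
          conj a * b * (q i 0 * conj (q i 1)) + conj b * a * (q i 1 * conj (q i 0)) := by
      intro i
      rw [Complex.normSq_eq_conj_mul_self]
      simp only [map_add, map_mul, Complex.conj_conj]
      ring
    simp only [hterm, Finset.sum_add_distrib, ← Finset.mul_sum, h00, h11, h01, h10,
      Complex.normSq_eq_conj_mul_self]
    ring
  have hle : Complex.normSq (conj a * q m 0 + conj b * q m 1) ≤ s * (2 * α m) := by
    rw [← key]
    exact Finset.single_le_sum (f := fun i => Complex.normSq (conj a * q i 0 + conj b * q i 1))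
      (fun i _ => Complex.normSq_nonneg _) (Finset.mem_univ m)
  have hval : Complex.normSq (conj a * q m 0 + conj b * q m 1) = (2 * α m) ^ 2 := by
    have : conj a * q m 0 + conj b * q m 1 = ((2 * α m : ℝ) : ℂ) := by
      rw [← hab]
      push_cast
      rw [Complex.normSq_eq_conj_mul_self, Complex.normSq_eq_conj_mul_self]
    rw [this, Complex.normSq_ofReal, sq]
  have := hα m
  nlinarith

/-- Signs can be chosen so that a signed sum of bounded numbers obeys the same bound. -/
theorem exists_abs_sum_sub_sum_compl_le {r : Fin n → ℝ} {B : ℝ} (hB : 0 ≤ B)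
    (hr : ∀ i, 0 ≤ r i ∧ r i ≤ B) :
    ∃ T : Finset (Fin n), |∑ i ∈ T, r i - ∑ i ∈ Tᶜ, r i| ≤ B := by
  have key : ∀ s : Finset (Fin n), ∃ T : Finset (Fin n),
      |∑ i ∈ s, if i ∈ T then r i else -r i| ≤ B := by
    intro s
    induction s using Finset.induction_on with
    | empty => exact ⟨∅, by simpa using hB⟩
    | insert i s his ih =>
      obtain ⟨T, hT⟩ := ih
      rw [abs_le] at hT
      obtain ⟨h1, h2⟩ := hr i
      -- The new term receives the sign opposite to that of the partial sum.
      rcases le_total 0 (∑ i ∈ s, if i ∈ T then r i else -r i) with h | h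
      · refine ⟨T.erase i, ?_⟩
        have hs : (∑ k ∈ s, if k ∈ T.erase i then r k else -r k) =
            ∑ k ∈ s, if k ∈ T then r k else -r k :=
          Finset.sum_congr rfl fun k hk => by
            have : k ≠ i := ne_of_mem_of_not_mem hk his
            simp [this]
        rw [Finset.sum_insert his, if_neg (Finset.notMem_erase i T), hs, abs_le]
        constructor <;> linarith
      · refine ⟨insert i T, ?_⟩
        have hs : (∑ k ∈ s, if k ∈ insert i T then r k else -r k) =
            ∑ k ∈ s, if k ∈ T then r k else -r k :=
          Finset.sum_congr rfl fun k hk => by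
            have : k ≠ i := ne_of_mem_of_not_mem hk his
            simp [this]
        rw [Finset.sum_insert his, if_pos (Finset.mem_insert_self i T), hs, abs_le]
        constructor <;> linarith
  obtain ⟨T, hT⟩ := key Finset.univ
  refine ⟨T, ?_⟩
  rwa [sum_ite_compl, Finset.sum_neg_distrib, ← sub_eq_add_neg] at hT

/-- Place the spinors of `T` on the first axis and the others on the second; the Gram matrix is then
diagonal. -/
theorem mul_mem_gramDets {r : Fin n → ℝ} (hr : ∀ i, 0 ≤ r i) (T : Finset (Fin n)) :
    (∑ i ∈ T, r i) * ∑ i ∈ Tᶜ, r i ∈ gramDets r := by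
  let q : Fin n → Fin 2 → ℂ := fun i => if i ∈ T then ![(√(r i) : ℂ), 0] else ![0, (√(r i) : ℂ)]
  have hs : ∀ i, (√(r i) : ℂ) * √(r i) = r i := fun i => by
    rw [← Complex.ofReal_mul, Real.mul_self_sqrt (hr i)]
  refine ⟨q, fun i => ?_, ?_⟩
  · by_cases hi : i ∈ T <;>
      simp [q, hi, sqNorm_eq, Complex.normSq_ofReal, Real.mul_self_sqrt (hr i)]
  · have h00 : gram q 0 0 = ((∑ i ∈ T, r i : ℝ) : ℂ) := by
      have : ∀ i, q i 0 * conj (q i 0) = if i ∈ T then (r i : ℂ) else 0 := fun i => by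
        by_cases hi : i ∈ T <;> simp [q, hi, hs]
      rw [gram_apply]
      simp only [this, sum_ite_compl, Finset.sum_const_zero, add_zero]
      push_cast
      rfl
    have h11 : gram q 1 1 = ((∑ i ∈ Tᶜ, r i : ℝ) : ℂ) := by
      have : ∀ i, q i 1 * conj (q i 1) = if i ∈ T then 0 else (r i : ℂ) := fun i => by
        by_cases hi : i ∈ T <;> simp [q, hi, hs]
      rw [gram_apply]
      simp only [this, sum_ite_compl, Finset.sum_const_zero, zero_add]
      push_cast
      rfl
    have h01 : gram q 0 1 = 0 := by
      rw [gram_apply]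
      refine Finset.sum_eq_zero fun i _ => ?_
      by_cases hi : i ∈ T <;> simp [q, hi]
    simp only [Matrix.det_fin_two, h00, h11, h01, zero_mul, sub_zero, ← Complex.ofReal_mul,
      Complex.ofReal_re]

/-- Leave out the longest spinor, of index `m`. The others must have Gram matrix `s • 1 - u u^*`
with `|u|² = 2 α_m`, whose eigenvalues are `s` and `s - 2 α_m`. Once a system with the determinant
`s (s - 2 α_m)` exists, its Gram matrix leaves a remainder of rank one, which supplies `u`. -/
theorem nonempty_M (hα : ∀ i, 0 < α i) (hn : 0 < n) (hshort : ∀ m, 2 * α m < ∑ i, α i) :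
    (M α).Nonempty := by
  have : Nonempty (Fin n) := ⟨⟨0, hn⟩⟩
  obtain ⟨m, hm⟩ := Finite.exists_max α
  set s : ℝ := ∑ i, α i with hsdef
  have hms := hshort m
  have hm0 := hα m
  let r : Fin n → ℝ := fun i => if i = m then 0 else 2 * α i
  have hr : ∀ i, 0 ≤ r i ∧ r i ≤ 2 * α m := fun i => by
    have := hα i
    have := hm i
    by_cases hi : i = m
    · simp only [r, hi, if_true]
      exact ⟨le_rfl, by linarith⟩
    · simp only [r, hi, if_false]
      constructor <;> linarith
  have hrsum : ∑ i, r i = 2 * s - 2 * α m := by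
    have h1 : ∀ i, r i = 2 * α i - if i = m then 2 * α m else 0 := fun i => by
      by_cases hi : i = m <;> simp [r, hi]
    simp only [h1, Finset.sum_sub_distrib, ← Finset.mul_sum, Finset.sum_ite_eq', Finset.mem_univ,
      if_true, hsdef]
  obtain ⟨q, hq, hdet⟩ : s * (s - 2 * α m) ∈ gramDets r := by
    -- The target lies between two attained determinants. Parallel spinors give `0`, and a split
    -- into sums `x, y` with `|x - y| ≤ 2 α_m` gives `4xy = (x + y)² - (x - y)² ≥ (2s - 2α_m)² -
    -- (2α_m)² = 4s(s - 2α_m)`.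
    obtain ⟨T, hT⟩ := exists_abs_sum_sub_sum_compl_le (by linarith) hr
    have h1 := mul_mem_gramDets (fun i => (hr i).1) T
    have h0 := mul_mem_gramDets (fun i => (hr i).1) ∅
    rw [Finset.sum_empty, zero_mul] at h0
    refine (ordConnected_gramDets r).out h0 h1 ⟨mul_nonneg (by linarith) (by linarith), ?_⟩
    have h2 := Finset.sum_add_sum_compl T r
    rw [hrsum] at h2
    have h3 := sq_le_sq' (abs_le.1 hT).1 (abs_le.1 hT).2
    set x := ∑ i ∈ T, r i
    set y := ∑ i ∈ Tᶜ, r i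
    have h4 : y = 2 * s - 2 * α m - x := by linarith
    rw [h4] at h3 ⊢
    nlinarith
  have hGherm := isHermitian_gram q
  have hdet' : (gram q).det = ((s * (s - 2 * α m) : ℝ) : ℂ) := by
    rw [← det_ofReal_re_of_isHermitian hGherm]
    exact congrArg _ hdet
  have htr : (gram q).trace = ((2 * s - 2 * α m : ℝ) : ℂ) := by
    rw [trace_gram, ← hrsum]
    exact congrArg _ (Finset.sum_congr rfl fun i _ => hq i)
  have hKtr : ((s : ℂ) • (1 : Matrix (Fin 2) (Fin 2) ℂ) - gram q).trace = ((2 * α m : ℝ) : ℂ) := by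
    rw [Matrix.trace_sub, Matrix.trace_smul, Matrix.trace_one, htr, Fintype.card_fin, smul_eq_mul]
    push_cast
    ring
  obtain ⟨u, hu⟩ := exists_eq_vecMulVec (H := (s : ℂ) • 1 - gram q) (by
      refine Matrix.IsHermitian.sub ?_ hGherm
      ext k l
      fin_cases k <;> fin_cases l <;> simp) (by linarith : 0 ≤ 2 * α m) hKtr (by
      rw [Matrix.trace_fin_two] at htr
      rw [Matrix.det_fin_two] at hdet'
      rw [Matrix.det_fin_two]
      simp only [Matrix.sub_apply, Matrix.smul_apply, Matrix.one_apply_eq, smul_eq_mul, mul_one,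
        Matrix.one_apply_ne (zero_ne_one (α := Fin 2)),
        Matrix.one_apply_ne (one_ne_zero (α := Fin 2)), mul_zero, zero_sub]
      push_cast at htr hdet'
      linear_combination (-(s : ℂ)) * htr + hdet')
  have hun : sqNorm u = 2 * α m := by
    apply Complex.ofReal_injective
    rw [← trace_vecMulVec_star, ← hu, hKtr]
  have hqm : q m = 0 := by
    have h1 := hq m
    simp only [r, if_true, sqNorm_eq] at h1
    have h2 := Complex.normSq_nonneg (q m 0)
    have h3 := Complex.normSq_nonneg (q m 1)
    ext k
    fin_cases k
    · exact Complex.normSq_eq_zero.1 (show Complex.normSq (q m 0) = 0 by linarith)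
    · exact Complex.normSq_eq_zero.1 (show Complex.normSq (q m 1) = 0 by linarith)
  let q' : Fin n → Fin 2 → ℂ := fun i => if i = m then u else q i
  have hgram : gram q' = (s : ℂ) • 1 := by
    have h1 : ∀ i, Matrix.vecMulVec (q' i) (star (q' i)) = Matrix.vecMulVec (q i) (star (q i)) +
        if i = m then Matrix.vecMulVec u (star u) else 0 := fun i => by
      by_cases hi : i = m
      · simp [q', hi, hqm]
      · simp [q', hi]
    rw [gram]
    simp only [h1, Finset.sum_add_distrib, Finset.sum_ite_eq', Finset.mem_univ, if_true]
    rw [← hu]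
    exact add_sub_cancel _ _
  rw [← range_polygon]
  refine ⟨_, ⟨q', fun i => ?_, hgram⟩, rfl⟩
  by_cases hi : i = m
  · simp only [q', hi, if_true]
    exact hun
  · simp only [q', hi, if_false, hq i]
    simp [r, hi]

end Polygons

/-! ### Connected components of finite disjoint unions -/

theorem connectedComponentIn_eq_of_closed {T : Type*} [TopologicalSpace T] {C D : Set T}
    (hC : IsClosed C) (hD : IsClosed D) (hCD : Disjoint C D) (hconn : IsPreconnected C) {x : T}
    (hx : x ∈ C) : connectedComponentIn (C ∪ D) x = C := by
  refine Set.Subset.antisymm ?_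
    (hconn.subset_connectedComponentIn hx Set.subset_union_left)
  have h := isPreconnected_iff_subset_of_disjoint_closed.1
    (isPreconnected_connectedComponentIn (F := C ∪ D) (x := x)) C D hC hD
    (connectedComponentIn_subset _ _) (by rw [hCD.inter_eq, Set.inter_empty])
  rcases h with h | h
  · exact h
  · exact absurd (h (mem_connectedComponentIn (Or.inl hx)))
      (Set.disjoint_left.1 hCD hx)

section Components

variable {n : ℕ} {α : Fin n → ℝ}

theorem isClosed_Z (hα : ∀ i, 0 < α i) (S : Finset (Fin n)) : IsClosed (Z α S) := by
  rw [← (isOpenQuotientMap_mk α).isQuotientMap.isClosed_preimage]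
  have hcl : ∀ T : Finset (Fin n), IsClosed {x : level α | IsStraight T x.1} := by
    intro T
    have : {x : level α | IsStraight T x.1} = ⋂ i ∈ T, ⋂ j ∈ T,
        {x : level α | x.1.2 i 0 * x.1.2 j 1 - x.1.2 i 1 * x.1.2 j 0 = 0} := by
      ext x
      simp only [Set.mem_ofPred_eq, isStraight_iff hα x.2, Set.mem_iInter]
    rw [this]
    have hc : ∀ i k, Continuous fun x : level α => x.1.2 i k := fun i k =>
      (contDiff_snd_apply i k).continuous.comp continuous_subtype_val
    exact isClosed_biInter fun i _ => isClosed_biInter fun j _ =>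
      isClosed_eq (((hc i 0).mul (hc j 1)).sub ((hc i 1).mul (hc j 0))) continuous_const
  have : mk α ⁻¹' Z α S = {x | IsStraight S x.1} ∩ {x | IsStraight Sᶜ x.1} := by
    ext x
    exact mk_mem_Z_iff
  rw [this]
  exact (hcl S).inter (hcl Sᶜ)

/-- The fixed-point set is a finite disjoint union of closed connected sets, so the nonempty ones
are its components. Strata are never empty, while `M α` may be. -/
theorem components_fixedPoints (hα : ∀ i, 0 < α i) (hgen : IsGeneric α) :
    components (Function.fixedPoints (involution α)) =
      {C | C = M α ∧ (M α).Nonempty} ∪ Z α '' shortSets' α := by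
  have hfin : (shortSets' α).Finite := Set.toFinite _
  have hM : ∀ x ∈ M α, connectedComponentIn (Function.fixedPoints (involution α)) x = M α := by
    intro x hx
    rw [fixedPoints_involution hα hgen]
    refine connectedComponentIn_eq_of_closed isCompact_M.isClosed
      (hfin.isClosed_biUnion fun S _ => isClosed_Z hα S) ?_ isPreconnected_M hx
    exact Set.disjoint_iUnion₂_right.2 fun S hS => disjoint_M_Z hα hS
  have hZ : ∀ S ∈ shortSets' α, ∀ x ∈ Z α S,
      connectedComponentIn (Function.fixedPoints (involution α)) x = Z α S := by
    intro S hS x hx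
    have hF : Function.fixedPoints (involution α) =
        Z α S ∪ (M α ∪ ⋃ T ∈ shortSets' α \ {S}, Z α T) := by
      rw [fixedPoints_involution hα hgen, Set.union_left_comm, ← Set.biUnion_insert,
        Set.insert_sdiff_singleton, Set.insert_eq_of_mem hS]
    rw [hF]
    refine connectedComponentIn_eq_of_closed (isClosed_Z hα S) (isCompact_M.isClosed.union
      ((hfin.subset Set.sdiff_subset).isClosed_biUnion fun T _ => isClosed_Z hα T)) ?_
      (isPreconnected_Z hα hS) hx
    refine Set.disjoint_union_right.2 ⟨(disjoint_M_Z hα hS).symm,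
      Set.disjoint_iUnion₂_right.2 fun T hT => Set.disjoint_left.2 fun z hzS hzT => ?_⟩
    exact hT.2 (eq_of_mem_Z hα hgen hT.1 hS hzT hzS)
  ext C
  constructor
  · rintro ⟨x, hx, rfl⟩
    have hx' := hx
    rw [fixedPoints_involution hα hgen] at hx'
    rcases hx' with hxM | hxZ
    · exact Or.inl ⟨hM x hxM, ⟨x, hxM⟩⟩
    · obtain ⟨S, hS, hxS⟩ := Set.mem_iUnion₂.1 hxZ
      exact Or.inr ⟨S, hS, (hZ S hS x hxS).symm⟩
  · rintro (⟨rfl, x, hx⟩ | ⟨S, hS, rfl⟩)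
    · refine ⟨x, ?_, (hM x hx).symm⟩
      rw [fixedPoints_involution hα hgen]
      exact Or.inl hx
    · obtain ⟨x, hx⟩ := nonempty_Z hα hS
      refine ⟨x, ?_, (hZ S hS x hx).symm⟩
      rw [fixedPoints_involution hα hgen]
      exact Or.inr (Set.mem_iUnion₂.2 ⟨S, hS, hx⟩)

theorem injOn_Z (hα : ∀ i, 0 < α i) (hgen : IsGeneric α) : Set.InjOn (Z α) (shortSets' α) := by
  intro S hS T hT hST
  obtain ⟨z, hz⟩ := nonempty_Z hα hS
  exact eq_of_mem_Z hα hgen hS hT hz (hST ▸ hz)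

theorem isCompact_Z_iff (hα : ∀ i, 0 < α i) {S : Finset (Fin n)} (hS : S ∈ shortSets' α) :
    IsCompact (Z α S) ↔ S.card = n - 1 := by
  have h1 := Finset.card_add_card_compl S
  rw [Fintype.card_fin] at h1
  have h2 := Finset.card_pos.2 (hS.1.compl_nonempty hα)
  constructor
  · intro h
    by_contra hc
    exact not_isCompact_Z hα hS (by omega) h
  · intro h
    exact isCompact_Z hα hS (by omega)

/-! ### Counting short sets -/

open Classical in
-- By genericity, complementation exchanges short sets with the others.
theorem card_filter_isShort (hgen : IsGeneric α) (hn : 0 < n) :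
    (Finset.univ.filter fun S : Finset (Fin n) => IsShort α S).card = 2 ^ (n - 1) := by
  have h1 := Finset.card_filter_add_card_filter_not (s := (Finset.univ : Finset (Finset (Fin n))))
    (fun S => IsShort α S)
  have h2 : (Finset.univ.filter fun S : Finset (Fin n) => ¬ IsShort α S).card =
      (Finset.univ.filter fun S : Finset (Fin n) => IsShort α S).card := by
    refine Finset.card_bij (fun S _ => Sᶜ) ?_ ?_ ?_
    · intro S hS
      rw [Finset.mem_filter] at hS ⊢
      exact ⟨Finset.mem_univ _, (isShort_compl_iff hgen S).2 hS.2⟩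
    · intro S _ T _ h
      exact compl_injective h
    · intro S hS
      rw [Finset.mem_filter] at hS
      refine ⟨Sᶜ, ?_, compl_compl S⟩
      rw [Finset.mem_filter]
      exact ⟨Finset.mem_univ _, fun h => (isShort_compl_iff hgen S).1 h hS.2⟩
  rw [h2, Finset.card_univ, Fintype.card_finset, Fintype.card_fin] at h1
  obtain ⟨k, rfl⟩ : ∃ k, n = k + 1 := ⟨n - 1, by omega⟩
  rw [pow_succ] at h1
  rw [Nat.add_sub_cancel]
  omega

theorem isShort_empty (hα : ∀ i, 0 < α i) (hn : 0 < n) : IsShort α ∅ := by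
  rw [IsShort, epsilon, Finset.sum_empty, Finset.compl_empty, zero_sub, neg_lt_zero]
  exact Finset.sum_pos (fun i _ => hα i) ⟨⟨0, hn⟩, Finset.mem_univ _⟩

open Classical in
/-- Of each singleton and its complement, exactly one is short. -/
theorem card_filter_isShort_extreme (hα : ∀ i, 0 < α i) (hgen : IsGeneric α) (hn : 3 ≤ n) :
    (Finset.univ.filter fun S : Finset (Fin n) =>
      IsShort α S ∧ ¬ (2 ≤ S.card ∧ S.card ≠ n - 1)).card = n + 1 := by
  let f : Fin n → Finset (Fin n) := fun i => if IsShort α {i} then {i} else {i}ᶜ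
  have hcc : ∀ i : Fin n, ({i}ᶜ : Finset (Fin n)).card = n - 1 := fun i => by
    rw [Finset.card_compl, Fintype.card_fin, Finset.card_singleton]
  have hfs : ∀ i, IsShort α (f i) := fun i => by
    by_cases h : IsShort α {i}
    · simp only [f, h, if_true]
    · simpa only [f, h, if_false] using (isShort_compl_iff hgen _).2 h
  have hfc : ∀ i, (f i).card = 1 ∨ (f i).card = n - 1 := fun i => by
    by_cases h : IsShort α {i}
    · left; simp only [f, h, if_true, Finset.card_singleton]
    · right; simp only [f, h, if_false, hcc]
  -- A singleton is never the complement of a singleton, because `1 ≠ n - 1` when `n ≥ 3`.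
  have hfinj : Function.Injective f := by
    intro i j hij
    by_cases hi : IsShort α {i} <;> by_cases hj : IsShort α {j} <;>
      simp only [f, hi, hj, if_true, if_false] at hij
    · exact Finset.singleton_injective hij
    · have := congrArg Finset.card hij
      rw [Finset.card_singleton, hcc] at this
      omega
    · have := congrArg Finset.card hij
      rw [Finset.card_singleton, hcc] at this
      omega
    · exact Finset.singleton_injective (compl_injective hij)
  have hset : (Finset.univ.filter fun S : Finset (Fin n) =>
      IsShort α S ∧ ¬ (2 ≤ S.card ∧ S.card ≠ n - 1)) = insert ∅ (Finset.univ.image f) := by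
    ext S
    simp only [Finset.mem_filter, Finset.mem_univ, true_and, Finset.mem_insert, Finset.mem_image]
    constructor
    · rintro ⟨hS, hc⟩
      rcases Nat.lt_or_ge S.card 2 with h | h
      · rcases Nat.eq_zero_or_pos S.card with h0 | h0
        · exact Or.inl (Finset.card_eq_zero.1 h0)
        · obtain ⟨i, rfl⟩ := Finset.card_eq_one.1 (by omega : S.card = 1)
          exact Or.inr ⟨i, by simp only [f, hS, if_true]⟩
      · have h1 : S.card = n - 1 := by
          by_contra h1
          exact hc ⟨h, h1⟩
        have h2 := Finset.card_add_card_compl S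
        rw [Fintype.card_fin] at h2
        obtain ⟨i, hi⟩ := Finset.card_eq_one.1 (by omega : Sᶜ.card = 1)
        have hi' : S = {i}ᶜ := by rw [← hi, compl_compl]
        have hi'' : ¬ IsShort α {i} := by
          rw [hi', isShort_compl_iff hgen] at hS
          exact hS
        exact Or.inr ⟨i, by simp only [f, hi'', if_false, hi']⟩
    · rintro (rfl | ⟨i, rfl⟩)
      · exact ⟨isShort_empty hα (by omega), by simp⟩
      · refine ⟨hfs i, ?_⟩
        rcases hfc i with h | h <;> omega
  have hne : ∅ ∉ Finset.univ.image f := by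
    rw [Finset.mem_image]
    rintro ⟨i, -, hi⟩
    have := hfc i
    rw [hi, Finset.card_empty] at this
    omega
  rw [hset, Finset.card_insert_of_notMem hne, Finset.card_image_of_injective _ hfinj,
    Finset.card_univ, Fintype.card_fin]

theorem encard_shortSets'_ne (hα : ∀ i, 0 < α i) (hgen : IsGeneric α) (hn : 3 ≤ n) :
    {S ∈ shortSets' α | S.card ≠ n - 1}.encard = ((2 ^ (n - 1) - (n + 1) : ℕ) : ℕ∞) := by
  classical
  have h1 := Finset.card_filter_add_card_filter_not
    (s := Finset.univ.filter fun S : Finset (Fin n) => IsShort α S)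
    (fun S => 2 ≤ S.card ∧ S.card ≠ n - 1)
  rw [Finset.filter_filter, Finset.filter_filter, card_filter_isShort_extreme hα hgen hn,
    card_filter_isShort hgen (by omega)] at h1
  have h2 : {S ∈ shortSets' α | S.card ≠ n - 1} = ((Finset.univ.filter fun S : Finset (Fin n) =>
      IsShort α S ∧ 2 ≤ S.card ∧ S.card ≠ n - 1 : Finset (Finset (Fin n))) :
      Set (Finset (Fin n))) := by
    ext S
    simp only [shortSets', Set.mem_ofPred_eq, Finset.coe_filter, Finset.mem_univ, true_and,
      and_assoc]
  -- The count is an exact sum equal to `2 ^ (n - 1)`, so the truncated subtraction loses nothing.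
  rw [h2, Set.encard_coe_eq_coe_finsetCard]
  congr 1
  omega

/-! ### Compact and non-compact components -/

theorem encard_noncompact_components (hα : ∀ i, 0 < α i) (hgen : IsGeneric α) (hn : 3 ≤ n) :
    {C ∈ components (Function.fixedPoints (involution α)) | ¬ IsCompact C}.encard =
      ((2 ^ (n - 1) - (n + 1) : ℕ) : ℕ∞) := by
  have h : {C ∈ components (Function.fixedPoints (involution α)) | ¬ IsCompact C} =
      Z α '' {S ∈ shortSets' α | S.card ≠ n - 1} := by
    rw [components_fixedPoints hα hgen]
    ext C
    constructor
    · rintro ⟨⟨rfl, -⟩ | ⟨S, hS, rfl⟩, hC⟩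
      · exact absurd isCompact_M hC
      · exact ⟨S, ⟨hS, fun h => hC ((isCompact_Z_iff hα hS).2 h)⟩, rfl⟩
    · rintro ⟨S, ⟨hS, hc⟩, rfl⟩
      exact ⟨Or.inr ⟨S, hS, rfl⟩, fun h => hc ((isCompact_Z_iff hα hS).1 h)⟩
  rw [h, ((injOn_Z hα hgen).mono fun S hS => hS.1).encard_image, encard_shortSets'_ne hα hgen hn]

/-- A compact stratum is that of `{k}ᶜ` with `α_k` larger than the sum of the others. At most one
`k` has this property, and its existence is precisely what empties `M α`, so exactly one of the two
kinds of compact component is present. -/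
theorem encard_compact_components (hα : ∀ i, 0 < α i) (hgen : IsGeneric α) (hn : 3 ≤ n) :
    {C ∈ components (Function.fixedPoints (involution α)) | IsCompact C}.encard = 1 := by
  have hlong : ∀ S ∈ shortSets' α, S.card = n - 1 → ∃ k, S = {k}ᶜ ∧ ∑ i, α i < 2 * α k := by
    intro S hS hc
    have h2 := Finset.card_add_card_compl S
    rw [Fintype.card_fin] at h2
    obtain ⟨k, hk⟩ := Finset.card_eq_one.1 (by omega : Sᶜ.card = 1)
    refine ⟨k, by rw [← hk, compl_compl], ?_⟩
    have h3 := hS.1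
    rw [IsShort, ← neg_pos, ← epsilon_compl, hk, epsilon_singleton] at h3
    linarith
  rw [Set.encard_eq_one]
  by_cases h : ∃ m, ¬ IsShort α {m}
  · obtain ⟨m, hm⟩ := h
    have hm' : ∑ i, α i < 2 * α m := by
      have := (isShort_compl_iff hgen {m}).2 hm
      rw [IsShort, epsilon_compl, epsilon_singleton] at this
      linarith
    have hcard : ({m}ᶜ : Finset (Fin n)).card = n - 1 := by
      rw [Finset.card_compl, Fintype.card_fin, Finset.card_singleton]
    have hS : ({m}ᶜ : Finset (Fin n)) ∈ shortSets' α :=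
      ⟨(isShort_compl_iff hgen {m}).2 hm, by rw [hcard]; omega⟩
    refine ⟨Z α {m}ᶜ, Set.Subset.antisymm ?_ ?_⟩
    · rintro C ⟨hC, hcomp⟩
      rw [components_fixedPoints hα hgen] at hC
      rcases hC with ⟨-, hne⟩ | ⟨S, hSS, rfl⟩
      · rw [M_eq_empty hα hm'] at hne
        exact absurd hne Set.not_nonempty_empty
      · obtain ⟨k, rfl, hk⟩ := hlong S hSS ((isCompact_Z_iff hα hSS).1 hcomp)
        by_cases hkm : k = m
        · rw [hkm]; rfl
        · have h1 : α k + α m ≤ ∑ i, α i := by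
            rw [← Finset.sum_pair hkm]
            exact Finset.sum_le_sum_of_subset_of_nonneg (Finset.subset_univ _)
              fun i _ _ => (hα i).le
          linarith
    · rintro C rfl
      refine ⟨?_, (isCompact_Z_iff hα hS).2 hcard⟩
      rw [components_fixedPoints hα hgen]
      exact Or.inr ⟨_, hS, rfl⟩
  · have hall : ∀ m, 2 * α m < ∑ i, α i := fun m =>
      (isShort_singleton_iff m).1 (not_not.1 fun hm => h ⟨m, hm⟩)
    refine ⟨M α, Set.Subset.antisymm ?_ ?_⟩
    · rintro C ⟨hC, hcomp⟩
      rw [components_fixedPoints hα hgen] at hC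
      rcases hC with ⟨rfl, -⟩ | ⟨S, hSS, rfl⟩
      · rfl
      · obtain ⟨k, -, hk⟩ := hlong S hSS ((isCompact_Z_iff hα hSS).1 hcomp)
        exact absurd (hall k) hk.not_gt
    · rintro C rfl
      refine ⟨?_, isCompact_M⟩
      rw [components_fixedPoints hα hgen]
      exact Or.inl ⟨rfl, nonempty_M hα (by omega) hall⟩

end Components

end Hyperpolygon

theorem theorem4p1 (n : ℕ) (hn : 3 ≤ n) (α : Fin n → ℝ) (hα : ∀ i, 0 < α i)
    (hgen : Hyperpolygon.IsGeneric α) :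
    Function.fixedPoints (Hyperpolygon.involution α) =
        Hyperpolygon.M α ∪ ⋃ S ∈ Hyperpolygon.shortSets' α, Hyperpolygon.Z α S ∧
    (∀ S ∈ Hyperpolygon.shortSets' α,
      Hyperpolygon.IsSmoothManifold (Hyperpolygon.Z α S) (2 * (n - 3)) ∧
      (S.card ≠ n - 1 → ¬ IsCompact (Hyperpolygon.Z α S)) ∧
      (S.card = n - 1 →
        Hyperpolygon.Z α S = Hyperpolygon.XS α S ∧
        IsCompact (Hyperpolygon.Z α S) ∧
        Hyperpolygon.AreDiffeomorphic (Hyperpolygon.overProj (Hyperpolygon.Z α S))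
          (Hyperpolygon.cpProj (n - 3)))) ∧
    {C ∈ Hyperpolygon.components (Function.fixedPoints (Hyperpolygon.involution α)) |
        ¬ IsCompact C}.encard = ((2 ^ (n - 1) - (n + 1) : ℕ) : ℕ∞) ∧
    {C ∈ Hyperpolygon.components (Function.fixedPoints (Hyperpolygon.involution α)) |
        IsCompact C}.encard = 1 := by
  refine ⟨Hyperpolygon.fixedPoints_involution hα hgen, fun S hS => ⟨?_, ?_, fun hc => ?_⟩,
    Hyperpolygon.encard_noncompact_components hα hgen hn,
    Hyperpolygon.encard_compact_components hα hgen hn⟩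
  · exact Hyperpolygon.isSmoothManifold_Z hα hS
  · exact fun hc h => hc ((Hyperpolygon.isCompact_Z_iff hα hS).1 h)
  · have hcard : Sᶜ.card = 1 := by
      have := Finset.card_add_card_compl S
      rw [Fintype.card_fin] at this
      omega
    exact ⟨Hyperpolygon.Z_eq_XS hα hS hcard, Hyperpolygon.isCompact_Z hα hS hcard,
      Hyperpolygon.areDiffeomorphic_Z_CP hα hS hn hcard⟩
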